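/- Let $k$ be a field and let $A=\bigoplus_{i\ge 0}A_i$ be a ring-indecomposable basic $\mathbb N$-graded Artin--Schelter Gorenstein $k$-algebra of dimension $d$ with Gorenstein parameter $(p_i^A)_{i\in\mathbb I_A}$ and average $p^A_{\mathrm{av}}=(\#\mathbb I_A)^{-1}\sum_{i\in\mathbb I_A}p^A_i$. Then there exists a ring-indecomposable basic $\mathbb N$-graded Artin--Schelter Gorenstein $k$-algebra $B$ of the same dimension $d$, with Gorenstein parameter $(p_i^B)_{i\in\mathbb I_B}$ and average $p^B_{\mathrm{av}}$, such that 1. $B$ is graded Morita equivalent to $A$, that is, there is a ($k$-linear) equivalence between the categories of $\mathbb Z$-graded right modules over $A$ and over $B$ that commutes, up to isomorphism, with the degree shift $(1)$; 2. $|p_i^B-p^B_{\mathrm{av}}|<1$ for every $i\in\mathbb I_B$. In particular, if $p^A_{\mathrm{av}}\le 0$, then $p^B_i\le 0$ for every $i\in\mathbb I_B$. Here a Noetherian, locally finite-dimensional, bounded below $\mathbb Z$-graded algebra $A$ with complete set of primitive orthogonal idempotents $1=\sum_{i\in\mathbb I_A}e_i$ in $A_0$ is called basic if $e_iA\not\simeq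 e_jA$ as ungraded right modules for $i\ne j$. With $M(n)_i=M_{n+i}$, and with $S_i$ and $S_i^{\mathrm o}$ the tops of $e_iA$ and $Ae_i$ in the categories of graded right and left modules, such a basic algebra $A$ is Artin--Schelter Gorenstein of dimension $d$ with Gorenstein parameter $(p_i)_{i\in\mathbb I_A}$ if $A$ has injective dimension $d<\infty$ both as a right and as a left module over itself, and there is a map $\nu:\mathbb I_A\to\mathbb I_A$ such that, for every $i$, $\operatorname{Ext}^d_A(S_i,A)\simeq S^{\mathrm o}_{\nu i}(p_i)$ as graded left $A$-modules and $\operatorname{Ext}^\ell_A(S_i,A)=0$ for $\ell\ne d$. -/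

import Mathlib

open CategoryTheory CategoryTheory.Limits DirectSum MulOpposite

universe u v

/-! ### Graded modules over a graded algebra, and their abelian category -/

/-- A `ℤ`-graded (left) module `M = ⨁ Mᵢ` over the algebra `R` with grading `ℬ`, i.e.
`ℬ i • M j ⊆ M (i + j)`. -/
structure GrMod {k : Type v} {R : Type u} [Field k] [Ring R] [Algebra k R]
    (ℬ : ℤ → Submodule k R) where
  carrier : Type u
  [grp : AddCommGroup carrier]
  [mod : Module R carrier]
  deg : ℤ → AddSubgroup carrier
  isInternal : DirectSum.IsInternal deg
  smul_mem : ∀ {i j : ℤ} {r : R} {x : carrier}, r ∈ ℬ i → x ∈ deg j → r • x ∈ deg (i + j)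

namespace GrMod

section Aux

variable {M : Type*} [AddCommGroup M]

theorem isInternal_of_proj (deg : ℤ → AddSubgroup M) (pr : ℤ → M →+ M)
    (h₁ : ∀ i x, x ∈ deg i → pr i x = x)
    (h₂ : ∀ i j x, x ∈ deg i → j ≠ i → pr j x = 0)
    (h₃ : ∀ x : M, ∃ s : Finset ℤ, ∃ y : ℤ → M, (∀ i, y i ∈ deg i) ∧ x = ∑ i ∈ s, y i) :
    DirectSum.IsInternal deg := by
  constructor
  · have key : ∀ (x : ⨁ i, deg i) (j : ℤ),
        pr j (DirectSum.coeAddMonoidHom deg x) = (x j : M) := by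
      intro x j
      induction x using DirectSum.induction_on with
      | zero => simp
      | of i x =>
        rw [DirectSum.coeAddMonoidHom_of]
        by_cases h : j = i
        · subst h
          rw [h₁ _ _ x.2, DirectSum.of_eq_same]
        · rw [h₂ i j _ x.2 h, DirectSum.of_eq_of_ne _ _ _ h]
          rfl
      | add x y hx hy => simp [hx, hy]
    intro x y h
    refine DFinsupp.ext fun j => Subtype.ext ?_
    have := congrArg (pr j) h
    exact (key x j).symm.trans (this.trans (key y j))
  · intro x
    obtain ⟨s, y, hy, rfl⟩ := h₃ x
    refine ⟨∑ i ∈ s, DirectSum.of (fun i => deg i) i ⟨y i, hy i⟩, ?_⟩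
    rw [map_sum]
    exact Finset.sum_congr rfl fun i _ => DirectSum.coeAddMonoidHom_of _ _ _

end Aux

variable {k : Type v} {R : Type u} [Field k] [Ring R] [Algebra k R]
variable {ℬ : ℤ → Submodule k R}

attribute [instance] GrMod.grp GrMod.mod

instance : CoeSort (GrMod ℬ) (Type u) := ⟨GrMod.carrier⟩

/-- The projection of `M` to its component of degree `i`, seen as a map `M → M`. -/
noncomputable def pr (M : GrMod ℬ) (i : ℤ) : M →+ M :=
  letI := M.isInternal.chooseDecomposition
  (M.deg i).subtype.comp ((DFinsupp.evalAddMonoidHom i).comp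
    (DirectSum.decomposeAddEquiv M.deg).toAddMonoidHom)

theorem pr_mem (M : GrMod ℬ) (i : ℤ) (x : M) : M.pr i x ∈ M.deg i :=
  Subtype.property _

theorem pr_of_mem (M : GrMod ℬ) {i : ℤ} {x : M} (hx : x ∈ M.deg i) : M.pr i x = x := by
  let := M.isInternal.chooseDecomposition
  exact DirectSum.decompose_of_mem_same M.deg hx

theorem pr_of_mem_ne (M : GrMod ℬ) {i j : ℤ} {x : M} (hx : x ∈ M.deg i) (h : j ≠ i) :
    M.pr j x = 0 := by
  let := M.isInternal.chooseDecomposition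
  exact DirectSum.decompose_of_mem_ne M.deg hx h.symm

theorem exists_sum_pr (M : GrMod ℬ) (x : M) : ∃ s : Finset ℤ, x = ∑ i ∈ s, M.pr i x := by
  classical
  let := M.isInternal.chooseDecomposition
  exact ⟨_, (DirectSum.sum_support_decompose M.deg x).symm⟩

/-- A submodule is homogeneous if it contains the homogeneous components of its elements. -/
def IsHomog (M : GrMod ℬ) (N : Submodule R M) : Prop :=
  ∀ x ∈ N, ∀ i, M.pr i x ∈ N

/-- The graded submodule of `M` given by a homogeneous submodule. -/
@[reducible] def sub (M : GrMod ℬ) (N : Submodule R M) (hN : M.IsHomog N) : GrMod ℬ where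
  carrier := N
  deg i := (M.deg i).comap N.toAddSubgroup.subtype
  isInternal := by
    refine isInternal_of_proj _
      (fun i => ((M.pr i).comp N.toAddSubgroup.subtype).codRestrict N.toAddSubgroup
        (fun x => hN x x.2 i)) ?_ ?_ ?_
    · intro i x hx
      exact Subtype.ext (M.pr_of_mem hx)
    · intro i j x hx h
      exact Subtype.ext (M.pr_of_mem_ne hx h)
    · intro x
      obtain ⟨s, hs⟩ := M.exists_sum_pr x
      refine ⟨s, fun i => ⟨M.pr i x, hN x x.2 i⟩, fun i => M.pr_mem i x, Subtype.ext ?_⟩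
      rw [Submodule.coe_sum]
      exact hs
  smul_mem hr hx := M.smul_mem hr hx

/-- The quotient of `M` by a homogeneous submodule, with the quotient grading. -/
@[reducible] def quot (M : GrMod ℬ) (N : Submodule R M) (hN : M.IsHomog N) : GrMod ℬ where
  carrier := M ⧸ N
  deg i := (M.deg i).map N.mkQ.toAddMonoidHom
  isInternal := by
    refine isInternal_of_proj _
      (fun i => QuotientAddGroup.map N.toAddSubgroup N.toAddSubgroup (M.pr i)
        (fun x hx => hN x hx i)) ?_ ?_ ?_
    · rintro i _ ⟨x, hx, rfl⟩
      exact congrArg N.mkQ (M.pr_of_mem hx)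
    · rintro i j _ ⟨x, hx, rfl⟩ h
      exact (congrArg N.mkQ (M.pr_of_mem_ne hx h)).trans (map_zero _)
    · intro x
      obtain ⟨x, rfl⟩ := N.mkQ_surjective x
      obtain ⟨s, hs⟩ := M.exists_sum_pr x
      refine ⟨s, fun i => N.mkQ (M.pr i x), fun i => ⟨_, M.pr_mem i x, rfl⟩, ?_⟩
      rw [← map_sum, ← hs]
  smul_mem := by
    rintro i j r _ hr ⟨x, hx, rfl⟩
    exact ⟨r • x, M.smul_mem hr hx, rfl⟩

/-- Morphisms of graded modules: linear maps preserving degrees. -/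
@[ext] structure Hom (M N : GrMod ℬ) where
  lin : M.carrier →ₗ[R] N.carrier
  map_deg : ∀ i, ∀ x ∈ M.deg i, lin x ∈ N.deg i

instance : Category.{u} (GrMod ℬ) where
  Hom := Hom
  id M := ⟨LinearMap.id, fun _ _ h => h⟩
  comp f g := ⟨g.lin.comp f.lin, fun i x h => g.map_deg i _ (f.map_deg i x h)⟩

variable {M N P : GrMod ℬ}

@[ext] theorem hom_ext {f g : M ⟶ N} (h : ∀ x, f.lin x = g.lin x) : f = g :=
  Hom.ext (LinearMap.ext h)

@[simp] theorem id_lin (x : M) : Hom.lin (𝟙 M) x = x := rfl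

@[simp] theorem comp_lin (f : M ⟶ N) (g : N ⟶ P) (x : M) :
    (f ≫ g).lin x = g.lin (f.lin x) := rfl

instance : Zero (M ⟶ N) := ⟨⟨0, fun i _ _ => (N.deg i).zero_mem⟩⟩

instance : Add (M ⟶ N) :=
  ⟨fun f g => ⟨f.lin + g.lin,
    fun i x h => (N.deg i).add_mem (f.map_deg i x h) (g.map_deg i x h)⟩⟩

instance : Neg (M ⟶ N) :=
  ⟨fun f => ⟨-f.lin, fun i x h => (N.deg i).neg_mem (f.map_deg i x h)⟩⟩

@[simp] theorem zero_lin (x : M) : (0 : M ⟶ N).lin x = 0 := rfl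

@[simp] theorem add_lin (f g : M ⟶ N) (x : M) : (f + g).lin x = f.lin x + g.lin x := rfl

@[simp] theorem neg_lin (f : M ⟶ N) (x : M) : (-f).lin x = -f.lin x := rfl

instance : AddCommGroup (M ⟶ N) where
  add_assoc f g h := by ext x; simp [add_assoc]
  zero_add f := by ext x; simp
  add_zero f := by ext x; simp
  nsmul := nsmulRec
  zsmul := zsmulRec
  neg_add_cancel f := by ext x; simp
  add_comm f g := by ext x; simp [add_comm]

instance : Preadditive (GrMod ℬ) where
  add_comp _ _ _ f f' g := by ext x; simp
  comp_add _ _ _ f g g' := by ext x; simp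

section Linear

variable [SetLike.GradedOne ℬ]

theorem smul_scalar_mem {i : ℤ} {x : M} (c : k) (hx : x ∈ M.deg i) :
    algebraMap k R c • x ∈ M.deg i := by
  have h := M.smul_mem (SetLike.algebraMap_mem_graded ℬ c) hx
  rwa [zero_add] at h

instance : SMul k (M ⟶ N) :=
  ⟨fun c f =>
    { lin :=
        { toFun := fun x => algebraMap k R c • f.lin x
          map_add' := fun x y => by simp
          map_smul' := fun r x => by
            simp only [map_smul, RingHom.id_apply, ← mul_smul, Algebra.commutes] }
      map_deg := fun i x h => smul_scalar_mem c (f.map_deg i x h) }⟩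

@[simp] theorem smul_lin (c : k) (f : M ⟶ N) (x : M) :
    (c • f).lin x = algebraMap k R c • f.lin x := rfl

instance : Module k (M ⟶ N) where
  one_smul f := by ext x; simp
  mul_smul c d f := by ext x; simp [mul_smul]
  smul_zero c := by ext x; simp
  smul_add c f g := by ext x; simp
  add_smul c d f := by ext x; simp [add_smul]
  zero_smul f := by ext x; simp

/-- The category of graded modules is `k`-linear, `k` acting through `k → R`. -/
instance : Linear k (GrMod ℬ) where
  smul_comp _ _ _ c f g := by ext x; simp
  comp_smul _ _ _ f c g := by ext x; simp

end Linear

theorem lin_pr (f : M ⟶ N) (i : ℤ) (x : M) : f.lin (M.pr i x) = N.pr i (f.lin x) := by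
  classical
  obtain ⟨s, hs⟩ := M.exists_sum_pr x
  have hj : ∀ j, N.pr i (f.lin (M.pr j x)) = if j = i then f.lin (M.pr i x) else 0 := by
    intro j
    split_ifs with h
    · subst h
      exact N.pr_of_mem (f.map_deg _ _ (M.pr_mem _ x))
    · exact N.pr_of_mem_ne (f.map_deg _ _ (M.pr_mem _ x)) (Ne.symm h)
  have h1 : N.pr i (f.lin x) = ∑ j ∈ s, N.pr i (f.lin (M.pr j x)) := by
    conv_lhs => rw [hs]
    simp only [map_sum]
  rw [h1, Finset.sum_congr rfl fun j _ => hj j, Finset.sum_ite_eq']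
  split_ifs with h
  · rfl
  · have : M.pr i x = 0 := by
      conv_lhs => rw [hs]
      rw [map_sum]
      refine Finset.sum_eq_zero fun j hjs => ?_
      exact M.pr_of_mem_ne (M.pr_mem j x) (fun e => h (e ▸ hjs))
    rw [this, map_zero]

theorem isHomog_ker (f : M ⟶ N) : M.IsHomog (LinearMap.ker f.lin) := by
  intro x hx i
  rw [LinearMap.mem_ker] at hx ⊢
  rw [lin_pr, hx, map_zero]

theorem isHomog_range (f : M ⟶ N) : N.IsHomog (LinearMap.range f.lin) := by
  rintro _ ⟨x, rfl⟩ i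
  exact ⟨M.pr i x, lin_pr f i x⟩

theorem mem_deg_of_injective (f : M ⟶ N) (hf : Function.Injective f.lin) {i : ℤ} {x : M}
    (h : f.lin x ∈ N.deg i) : x ∈ M.deg i := by
  have : M.pr i x = x := hf (by rw [lin_pr, N.pr_of_mem h])
  exact this ▸ M.pr_mem i x

/-- The inclusion of a graded submodule. -/
def subι (M : GrMod ℬ) (L : Submodule R M) (hL : M.IsHomog L) : M.sub L hL ⟶ M :=
  ⟨L.subtype, fun _ _ h => h⟩

/-- The projection to a graded quotient. -/
def quotπ (M : GrMod ℬ) (L : Submodule R M) (hL : M.IsHomog L) : M ⟶ M.quot L hL :=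
  ⟨L.mkQ, fun _ x h => ⟨x, h, rfl⟩⟩

theorem injective_of_mono (f : M ⟶ N) [Mono f] : Function.Injective f.lin := by
  have h : M.subι _ (isHomog_ker f) = 0 := by
    rw [← cancel_mono f, zero_comp]
    ext x
    exact x.2
  rw [← LinearMap.ker_eq_bot, eq_bot_iff]
  intro x hx
  exact congrArg (fun g : M.sub _ (isHomog_ker f) ⟶ M => g.lin ⟨x, hx⟩) h

theorem surjective_of_epi (f : M ⟶ N) [Epi f] : Function.Surjective f.lin := by
  have h : N.quotπ _ (isHomog_range f) = 0 := by
    rw [← cancel_epi f, comp_zero]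
    ext x
    exact (Submodule.Quotient.mk_eq_zero _).2 ⟨x, rfl⟩
  intro y
  have hy := congrArg (fun g : N ⟶ N.quot _ (isHomog_range f) => g.lin y) h
  exact (Submodule.Quotient.mk_eq_zero _).1 hy

/-- An injective morphism is a kernel of each morphism whose set-theoretic kernel is its image. -/
noncomputable def isLimitOfExact (f : M ⟶ N) (g : N ⟶ P) (w : f ≫ g = 0)
    (hf : Function.Injective f.lin) (hfg : ∀ y, g.lin y = 0 → ∃ x, f.lin x = y) :
    IsLimit (KernelFork.ofι f w) :=
  KernelFork.IsLimit.ofι f w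
    (fun {W} h hh =>
      have hx : ∀ x, h.lin x ∈ LinearMap.range f.lin := fun x =>
        hfg _ (congrArg (fun t : W ⟶ P => t.lin x) hh)
      have hfac : ∀ x, f.lin ((LinearEquiv.ofInjective f.lin hf).symm ⟨h.lin x, hx x⟩) =
          h.lin x := fun x =>
        congrArg Subtype.val ((LinearEquiv.ofInjective f.lin hf).apply_symm_apply ⟨h.lin x, hx x⟩)
      { lin := (LinearEquiv.ofInjective f.lin hf).symm.toLinearMap.comp
          (h.lin.codRestrict (LinearMap.range f.lin) hx)
        map_deg := fun i x hxi => mem_deg_of_injective f hf (by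
          have := hfac x
          exact this.symm ▸ h.map_deg i x hxi) })
    (fun {W} h hh => by
      ext x
      exact congrArg Subtype.val
        ((LinearEquiv.ofInjective f.lin hf).apply_symm_apply
          ⟨h.lin x, hfg _ (congrArg (fun t : W ⟶ P => t.lin x) hh)⟩))
    (fun {W} h hh m hm => by
      ext x
      apply hf
      refine (congrArg (fun t : W ⟶ N => t.lin x) hm).trans ?_
      exact (congrArg Subtype.val
        ((LinearEquiv.ofInjective f.lin hf).apply_symm_apply
          ⟨h.lin x, hfg _ (congrArg (fun t : W ⟶ P => t.lin x) hh)⟩)).symm)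

/-- A surjective morphism is a cokernel of each morphism whose image is its set-theoretic
kernel. -/
noncomputable def isColimitOfExact (f : M ⟶ N) (g : N ⟶ P) (w : f ≫ g = 0)
    (hg : Function.Surjective g.lin) (hfg : ∀ y, g.lin y = 0 → ∃ x, f.lin x = y) :
    IsColimit (CokernelCofork.ofπ g w) :=
  have hker : ∀ {W : GrMod ℬ} (h : N ⟶ W), f ≫ h = 0 →
      LinearMap.ker g.lin ≤ LinearMap.ker h.lin := fun {W} h hh y hy => by
    obtain ⟨x, rfl⟩ := hfg y hy
    exact congrArg (fun t : M ⟶ W => t.lin x) hh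
  have hfac : ∀ {W : GrMod ℬ} (h : N ⟶ W) (hh : f ≫ h = 0) (y : N),
      ((LinearMap.ker g.lin).liftQ h.lin (hker h hh))
        ((g.lin.quotKerEquivOfSurjective hg).symm (g.lin y)) = h.lin y := fun h hh y => by
    have : (g.lin.quotKerEquivOfSurjective hg).symm (g.lin y) =
        (LinearMap.ker g.lin).mkQ y := by
      rw [LinearEquiv.symm_apply_eq]
      rfl
    rw [this]
    rfl
  CokernelCofork.IsColimit.ofπ g w
    (fun {W} h hh =>
      { lin := ((LinearMap.ker g.lin).liftQ h.lin (hker h hh)).comp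
          (g.lin.quotKerEquivOfSurjective hg).symm.toLinearMap
        map_deg := fun i z hz => by
          obtain ⟨y, rfl⟩ := hg z
          have h1 : g.lin y = g.lin (N.pr i y) := by rw [lin_pr, P.pr_of_mem hz]
          rw [h1]
          have := hfac h hh (N.pr i y)
          exact this.symm ▸ h.map_deg i _ (N.pr_mem i y) })
    (fun {W} h hh => by
      ext y
      exact hfac h hh y)
    (fun {W} h hh m hm => by
      ext z
      obtain ⟨y, rfl⟩ := hg z
      exact (congrArg (fun t : N ⟶ W => t.lin y) hm).trans (hfac h hh y).symm)

instance : HasKernels (GrMod ℬ) where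
  has_limit f := ⟨⟨⟨_, isLimitOfExact (subι _ _ (isHomog_ker f)) f
    (by ext x; exact x.2) Subtype.val_injective (fun y hy => ⟨⟨y, hy⟩, rfl⟩)⟩⟩⟩

instance : HasCokernels (GrMod ℬ) where
  has_colimit f := ⟨⟨⟨_, isColimitOfExact f (quotπ _ _ (isHomog_range f))
    (by ext x; exact (Submodule.Quotient.mk_eq_zero _).2 ⟨x, rfl⟩)
    (Submodule.mkQ_surjective _) (fun y hy => (Submodule.Quotient.mk_eq_zero _).1 hy)⟩⟩⟩

/-- The direct sum of two graded modules. -/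
@[reducible] def prod (M N : GrMod ℬ) : GrMod ℬ where
  carrier := M × N
  deg i := (M.deg i).prod (N.deg i)
  isInternal := by
    classical
    refine isInternal_of_proj _ (fun i => (M.pr i).prodMap (N.pr i)) ?_ ?_ ?_
    · rintro i ⟨x, y⟩ ⟨hx, hy⟩
      exact Prod.ext (M.pr_of_mem hx) (N.pr_of_mem hy)
    · rintro i j ⟨x, y⟩ ⟨hx, hy⟩ h
      exact Prod.ext (M.pr_of_mem_ne hx h) (N.pr_of_mem_ne hy h)
    · rintro ⟨x, y⟩
      obtain ⟨s, hs⟩ := M.exists_sum_pr x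
      obtain ⟨t, ht⟩ := N.exists_sum_pr y
      refine ⟨s ∪ t, fun i => (if i ∈ s then M.pr i x else 0, if i ∈ t then N.pr i y else 0),
        fun i => ⟨?_, ?_⟩, ?_⟩
      · dsimp only
        split_ifs
        exacts [M.pr_mem i x, (M.deg i).zero_mem]
      · dsimp only
        split_ifs
        exacts [N.pr_mem i y, (N.deg i).zero_mem]
      · refine Prod.ext ?_ ?_
        · rw [Prod.fst_sum, Finset.sum_ite_mem, Finset.union_inter_cancel_left]
          exact hs
        · rw [Prod.snd_sum, Finset.sum_ite_mem, Finset.union_inter_cancel_right]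
          exact ht
  smul_mem hr hx := ⟨M.smul_mem hr hx.1, N.smul_mem hr hx.2⟩

instance : HasBinaryProducts (GrMod ℬ) :=
  have : ∀ M N : GrMod ℬ, HasLimit (pair M N) := fun M N =>
    ⟨⟨⟨BinaryFan.mk (P := M.prod N)
        (⟨LinearMap.fst R M N, fun _ _ h => h.1⟩ : M.prod N ⟶ M)
        (⟨LinearMap.snd R M N, fun _ _ h => h.2⟩ : M.prod N ⟶ N),
      BinaryFan.isLimitMk
        (fun s => ⟨(Hom.lin s.fst).prod (Hom.lin s.snd),
          fun i x h => ⟨Hom.map_deg s.fst i x h, Hom.map_deg s.snd i x h⟩⟩)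
        (fun s => rfl) (fun s => rfl)
        (fun s m h₁ h₂ => by
          refine hom_ext fun x => Prod.ext ?_ ?_
          · exact congrArg (fun t : s.pt ⟶ M => t.lin x) h₁
          · exact congrArg (fun t : s.pt ⟶ N => t.lin x) h₂)⟩⟩⟩
  hasBinaryProducts_of_hasLimit_pair _

/-- The zero graded module. -/
@[reducible] def zeroObj (ℬ : ℤ → Submodule k R) : GrMod ℬ where
  carrier := PUnit
  deg _ := ⊤
  isInternal := isInternal_of_proj _ (fun _ => AddMonoidHom.id _) (fun _ _ _ => rfl)
    (fun _ _ _ _ _ => rfl) (fun _ => ⟨∅, fun _ => 0, fun _ => trivial, rfl⟩)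
  smul_mem _ _ := trivial

instance : HasTerminal (GrMod ℬ) :=
  (IsTerminal.ofUniqueHom (Y := zeroObj ℬ) (fun _ => 0)
    (fun _ _ => rfl)).hasTerminal

instance : HasFiniteProducts (GrMod ℬ) := hasFiniteProducts_of_has_binary_and_terminal

/-- The category of graded modules is abelian. -/
noncomputable instance : Abelian (GrMod ℬ) where
  normalMonoOfMono f _ :=
    ⟨{ Z := _
       g := quotπ _ _ (isHomog_range f)
       w := by ext x; exact (Submodule.Quotient.mk_eq_zero _).2 ⟨x, rfl⟩
       isLimit := isLimitOfExact _ _ _ (injective_of_mono f)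
        (fun _ hy => (Submodule.Quotient.mk_eq_zero _).1 hy) }⟩
  normalEpiOfEpi f _ :=
    ⟨{ W := _
       g := subι _ _ (isHomog_ker f)
       w := by ext x; exact x.2
       isColimit := isColimitOfExact _ _ _ (surjective_of_epi f)
        (fun y hy => ⟨⟨y, hy⟩, rfl⟩) }⟩

instance : HasExt.{u + 1} (GrMod ℬ) := HasExt.standard _

/-- The degree shift `M(n)`, with `M(n)ᵢ = Mₙ₊ᵢ`. -/
@[reducible] def shift (M : GrMod ℬ) (n : ℤ) : GrMod ℬ where
  carrier := M
  deg i := M.deg (n + i)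
  isInternal := by
    refine isInternal_of_proj _ (fun i => M.pr (n + i)) (fun i x hx => M.pr_of_mem hx)
      (fun i j x hx h => M.pr_of_mem_ne hx (by simpa using h)) (fun x => ?_)
    obtain ⟨s, hs⟩ := M.exists_sum_pr x
    refine ⟨s.image (fun i => i - n), fun i => M.pr (n + i) x, fun i => M.pr_mem _ x, ?_⟩
    rw [Finset.sum_image (fun a _ b _ h => by simpa using h)]
    simpa using hs
  smul_mem {i j r x} hr hx := by
    have := M.smul_mem hr hx
    rwa [add_left_comm] at this

/-- The degree shift functor `(n)`. -/
@[reducible] def shiftFunctor (ℬ : ℤ → Submodule k R) (n : ℤ) : GrMod ℬ ⥤ GrMod ℬ where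
  obj M := M.shift n
  map f := ⟨f.lin, fun i x h => f.map_deg (n + i) x h⟩

/-- `N` is a maximal element among the proper graded submodules of `M`. -/
def IsMaximalGraded (M : GrMod ℬ) (N : Submodule R M) : Prop :=
  M.IsHomog N ∧ N ≠ ⊤ ∧ ∀ L, M.IsHomog L → N ≤ L → L = N ∨ L = ⊤

/-- The graded radical: the intersection of all maximal graded submodules. -/
def rad (M : GrMod ℬ) : Submodule R M := sInf {N | M.IsMaximalGraded N}

theorem isHomog_rad (M : GrMod ℬ) : M.IsHomog M.rad := by
  intro x hx i
  rw [rad, Submodule.mem_sInf] at hx ⊢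
  exact fun N hN => hN.1 x (hx N hN) i

/-- The graded top `M / rad M`. -/
@[reducible] def top (M : GrMod ℬ) : GrMod ℬ := M.quot M.rad M.isHomog_rad

end GrMod

/-! ### Graded algebras -/

section Algebras

variable {k : Type v} {A : Type u} [Field k] [Ring A] [Algebra k A]

/-- The grading of the opposite algebra. -/
def opGrading (𝒜 : ℤ → Submodule k A) (i : ℤ) : Submodule k Aᵐᵒᵖ :=
  (𝒜 i).comap (opLinearEquiv k).symm.toLinearMap

instance (𝒜 : ℤ → Submodule k A) [SetLike.GradedOne 𝒜] : SetLike.GradedOne (opGrading 𝒜) :=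
  ⟨SetLike.GradedOne.one_mem (A := 𝒜)⟩

/-- Graded right `A`-modules, i.e. graded `Aᵐᵒᵖ`-modules. Graded left `A`-modules are `GrMod 𝒜`. -/
abbrev GrRMod (𝒜 : ℤ → Submodule k A) := GrMod (opGrading 𝒜)

variable (𝒜 : ℤ → Submodule k A) [GradedAlgebra 𝒜]

theorem isInternal_toAddSubgroup : DirectSum.IsInternal fun i => (𝒜 i).toAddSubgroup := by
  classical
  refine GrMod.isInternal_of_proj _ (fun i => GradedRing.proj 𝒜 i) ?_ ?_ ?_
  · intro i x hx
    exact DirectSum.decompose_of_mem_same 𝒜 hx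
  · intro i j x hx h
    exact DirectSum.decompose_of_mem_ne 𝒜 hx h.symm
  · intro x
    exact ⟨_, fun i => DirectSum.decompose 𝒜 x i, fun i => SetLike.coe_mem _,
      (DirectSum.sum_support_decompose 𝒜 x).symm⟩

/-- `A` as a graded left module over itself. -/
@[reducible] def regL : GrMod 𝒜 where
  carrier := A
  deg i := (𝒜 i).toAddSubgroup
  isInternal := isInternal_toAddSubgroup 𝒜
  smul_mem hr hx := SetLike.mul_mem_graded hr hx

/-- `A` as a graded right module over itself. -/
@[reducible] def regR : GrRMod 𝒜 where
  carrier := A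
  deg i := (𝒜 i).toAddSubgroup
  isInternal := isInternal_toAddSubgroup 𝒜
  smul_mem {i j r x} hr hx := by
    have h : x * r.unop ∈ 𝒜 (j + i) := SetLike.mul_mem_graded hx hr
    rwa [add_comm] at h

/-- Left multiplication by `a`, as a map of right modules. -/
def lmulLin (a : A) : A →ₗ[Aᵐᵒᵖ] A where
  toFun x := a * x
  map_add' := mul_add a
  map_smul' r x := (mul_assoc a x r.unop).symm

/-- Right multiplication by `a`, as a map of left modules. -/
def rmulLin (a : A) : A →ₗ[A] A where
  toFun x := x * a
  map_add' x y := add_mul x y a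
  map_smul' r x := mul_assoc r x a

/-- Left multiplication by `a` of degree `m`, as a morphism `A(n) ⟶ A(n + m)` of graded right
modules. -/
def lmulHom (n m : ℤ) (a : 𝒜 m) : (regR 𝒜).shift n ⟶ (regR 𝒜).shift (n + m) where
  lin := lmulLin (a : A)
  map_deg i x hx := by
    have h : (a : A) * x ∈ 𝒜 (m + (n + i)) := SetLike.mul_mem_graded a.2 hx
    rwa [← add_assoc, add_comm m n] at h

/-- The graded right module `eA`, for `e` of degree `0`. -/
@[reducible] def projR (e : 𝒜 0) : GrRMod 𝒜 :=
  (regR 𝒜).sub (LinearMap.range (lmulLin (e : A)))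
    (GrMod.isHomog_range (M := regR 𝒜) (N := regR 𝒜)
      ⟨lmulLin (e : A), fun i x hx => by
        have h : (e : A) * x ∈ 𝒜 (0 + i) := SetLike.mul_mem_graded e.2 hx
        rwa [zero_add] at h⟩)

/-- The graded left module `Ae`, for `e` of degree `0`. -/
@[reducible] def projL (e : 𝒜 0) : GrMod 𝒜 :=
  (regL 𝒜).sub (LinearMap.range (rmulLin (e : A)))
    (GrMod.isHomog_range (M := regL 𝒜) (N := regL 𝒜)
      ⟨rmulLin (e : A), fun i x hx => by
        have h : x * (e : A) ∈ 𝒜 (i + 0) := SetLike.mul_mem_graded hx e.2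
        rwa [add_zero] at h⟩)

/-- The graded right module `S = top (eA)`; it is simple if `e` is primitive. -/
@[reducible] def simpleR (e : 𝒜 0) : GrRMod 𝒜 := (projR 𝒜 e).top

/-- The graded left module `S° = top (Ae)`; it is simple if `e` is primitive. -/
@[reducible] def simpleL (e : 𝒜 0) : GrMod 𝒜 := (projL 𝒜 e).top

/-- `Extˡ_A(M, A) ≅ N` as graded left `A`-modules. Here `M` is a (finitely generated) graded right
`A`-module; the degree `n` part of `Extˡ_A(M, A)` is the `Ext`-group of `M` and `A(n)` in the
category of graded right modules, and a homogeneous element `a` of `A` of degree `m` acts by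
composition with the left multiplication `A(n) ⟶ A(n + m)`. -/
def GradedExtIso (M : GrRMod 𝒜) (l : ℕ) (N : GrMod 𝒜) : Prop :=
  ∃ φ : ∀ n : ℤ, Abelian.Ext M ((regR 𝒜).shift n) l ≃+ N.deg n,
    ∀ (n m : ℤ) (a : 𝒜 m) (x : Abelian.Ext M ((regR 𝒜).shift n) l),
      (φ (n + m) (x.comp (Abelian.Ext.mk₀ (lmulHom 𝒜 n m a)) (add_zero l)) : N) =
        (a : A) • (φ n x : N)

/-- A primitive idempotent. -/
def IsPrimitiveIdempotent (e : A) : Prop :=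
  IsIdempotentElem e ∧ e ≠ 0 ∧ ∀ f : A, IsIdempotentElem f → e * f = f → f * e = f → f = 0 ∨ f = e

/-- `A` is ring-indecomposable: nonzero and without nontrivial central idempotents, that is,
not a product of two nonzero rings. -/
def IsRingIndecomposable (A : Type u) [Ring A] : Prop :=
  Nontrivial A ∧ ∀ e : A, IsIdempotentElem e → (∀ x, e * x = x * e) → e = 0 ∨ e = 1

/-- `A` is `ℕ`-graded. -/
def IsNGraded : Prop := ∀ i < 0, 𝒜 i = ⊥


/-- `A` is a basic Artin-Schelter Gorenstein algebra of dimension `d`, with complete set of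
primitive orthogonal idempotents `e`, Nakayama permutation `ν` and Gorenstein parameter `p`. -/
structure IsBasicASGorenstein (d : ℕ) {n : ℕ} (e : Fin n → 𝒜 0) (ν : Fin n → Fin n)
    (p : Fin n → ℤ) : Prop where
  noetherian_left : IsNoetherianRing A
  noetherian_right : IsNoetherianRing Aᵐᵒᵖ
  locally_finite : ∀ i, FiniteDimensional k (𝒜 i)
  bounded_below : ∃ N : ℤ, ∀ i < N, 𝒜 i = ⊥
  complete : CompleteOrthogonalIdempotents fun i => (e i : A)
  primitive : ∀ i, IsPrimitiveIdempotent (e i : A)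
  basic : ∀ i j, i ≠ j →
    IsEmpty (LinearMap.range (lmulLin (e i : A)) ≃ₗ[Aᵐᵒᵖ] LinearMap.range (lmulLin (e j : A)))
  injdim_right : injectiveDimension (ModuleCat.of Aᵐᵒᵖ A) = d
  injdim_left : injectiveDimension (ModuleCat.of A A) = d
  ext_eq_zero : ∀ i (l : ℕ), l ≠ d → ∀ m : ℤ,
    Subsingleton (Abelian.Ext (simpleR 𝒜 (e i)) ((regR 𝒜).shift m) l)
  ext_iso : ∀ i, GradedExtIso 𝒜 (simpleR 𝒜 (e i)) d ((simpleL 𝒜 (e (ν i))).shift (p i))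

/-- Graded Morita equivalence: a (`k`-linear) equivalence between the categories of graded right
modules that commutes with the degree shift `(1)`. -/
def GradedMoritaEquivalent {B : Type u} [Ring B] [Algebra k B] (ℬ : ℤ → Submodule k B)
    [GradedAlgebra ℬ] : Prop :=
  ∃ F : GrRMod 𝒜 ≌ GrRMod ℬ, F.functor.Additive ∧ F.functor.Linear k ∧
    Nonempty (GrMod.shiftFunctor (opGrading 𝒜) 1 ⋙ F.functor ≅
      F.functor ⋙ GrMod.shiftFunctor (opGrading ℬ) 1)

end Algebras

/-- The average of a Gorenstein parameter. -/
def averageParameter {n : ℕ} (p : Fin n → ℤ) : ℚ := (∑ i, (p i : ℚ)) / n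

/-! `B` is the same ring as `A` with a new grading: for suitable integers `s i`, the Peirce
component `e_j A_l e_i` is placed in degree `l + s i - s j`. Regrading modules in the same way is an
equivalence commuting with the shift (`IsRegrading.gradedMoritaEquivalent`), and it induces
isomorphisms on `Ext` of finite modules. It sends the simple module `S_i` of `B` to `S_i(s i)` over
`A`, so the Gorenstein parameter becomes `p i + s (ν i) - s i` (`IsBasicASGorenstein.regrade`). It
remains to choose `s` so that `B` stays `ℕ`-graded and the new parameter is balanced.

Let `J` be the graded radical, and let an arrow from `j` to `i` of degree `l` be an element of `e_j
J e_i` of degree `l` outside `J²`. The heart of the proof is that `ν` acts on arrows: an arrow from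
`j` to `i` of degree `l` yields one from `ν j` to `ν i` of degree `l + p i - p j`
(`IsBasicASGorenstein.exists_arrow`). An arrow is a nonsplit extension of `S_j` by `S_i(-l)`. The
functor `Ext^d(-, A)` turns it into an extension of simple left modules, and if that is again
nonsplit the new arrow can be read off from it.

Nonsplitness survives because maps between the relevant groups `Ext^d(-, A)` come from maps of
modules (`FreeRes.exists_hom_of_ext`). Here the finite injective dimension of `A` enters: the dual
of a free resolution of a module without `Ext` above `d` is exact there, so its kernels are `Ext(-,
A)`-acyclic. A map on cohomology therefore lifts to the complexes and can be dualized back.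

Since `ν` is a permutation, `ν^N = 1` for some `N > 0`. Put `P_m(i) = p i + ⋯ + p (ν^(m-1) i)`
(`orbitSum`) and `W(i) = ∑_{m<N} P_m(i)` (`orbitWeight`). Applying `ν^N` repeatedly to an arrow adds
multiples of `P_N(i) - P_N(j)` to its degree. Degrees of arrows are bounded on both sides, so `P_N`
agrees at the ends of each arrow and, by indecomposability, is a constant `S`. All degrees `l +
P_m(i) - P_m(j)` are nonnegative; summing over `m < N` gives `W(j) ≤ N l + W(i)`. This extends from
arrows to all nonzero `e_j A_l e_i` by `IsNGradedBasic.induction_on_arrows`.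

Finally `W(ν i) = W(i) + S - N p i`, so `s = W / N` would make the parameter constant, equal to `S /
N`. The integers `s i = ⌊W(i) / N⌋` still respect the inequality, so that `B` is `ℕ`-graded, and
rounding moves each parameter by less than `1`. -/

section LeftModules

/-! ### Ext-acyclicity and exact sequences of finite free left modules -/

variable {A : Type u} [Ring A]

/-- `Y` has no higher extensions by `Z`. -/
def ExtAcyclic (Z Y : ModuleCat.{u} A) : Prop :=
  ∀ l : ℕ, 1 ≤ l → ∀ x : Abelian.Ext Z Y l, x = 0

theorem ModuleCat.shortExact_of_ker {L M N : Type u} [AddCommGroup L] [AddCommGroup M]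
    [AddCommGroup N] [Module A L] [Module A M] [Module A N] (f : L →ₗ[A] M) (g : M →ₗ[A] N)
    (hf : Function.Injective f) (hg : Function.Surjective g)
    (hfg : LinearMap.range f = LinearMap.ker g) :
    (ShortComplex.mk (ModuleCat.ofHom f) (ModuleCat.ofHom g) (by
      ext x
      exact (hfg ▸ LinearMap.mem_range_self f x : f x ∈ LinearMap.ker g))).ShortExact := by
  refine ShortComplex.ShortExact.mk' ?_ ((ModuleCat.mono_iff_injective _).2 hf)
    ((ModuleCat.epi_iff_surjective _).2 hg)
  rw [ShortComplex.moduleCat_exact_iff_range_eq_ker]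
  exact hfg

theorem ExtAcyclic.target_right {S : ShortComplex (ModuleCat.{u} A)} (hS : S.ShortExact)
    {Z : ModuleCat.{u} A} (h₁ : ExtAcyclic Z S.X₁)
    (h₂ : ExtAcyclic Z S.X₂) : ExtAcyclic Z S.X₃ := by
  intro l hl x
  obtain ⟨x', rfl⟩ := Abelian.Ext.covariant_sequence_exact₃ Z hS x rfl (h₁ _ (by lia) _)
  rw [h₂ l hl x', Abelian.Ext.zero_comp]

theorem ExtAcyclic.of_projective (Z Y : ModuleCat.{u} A) [Projective Z] : ExtAcyclic Z Y := by
  intro l hl x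
  obtain ⟨l, rfl⟩ := Nat.exists_eq_add_of_le' hl
  exact Abelian.Ext.eq_zero_of_projective x

/-- The identity of a finite free module is a sum of maps factoring through `A`, so every class is a
sum of images of classes in `Ext(Z, A)`. -/
theorem ExtAcyclic.pi {Z : ModuleCat.{u} A} (h : ExtAcyclic Z (ModuleCat.of A A)) (n : ℕ) :
    ExtAcyclic Z (ModuleCat.of A (Fin n → A)) := by
  intro l hl x
  have key : ModuleCat.ofHom (LinearMap.id : (Fin n → A) →ₗ[A] (Fin n → A)) =
      ∑ i : Fin n, ModuleCat.ofHom (LinearMap.proj (R := A) (φ := fun _ : Fin n => A) i) ≫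
        ModuleCat.ofHom (LinearMap.single A (fun _ : Fin n => A) i) := by
    ext x
    simp
  have : x = x.comp (Abelian.Ext.mk₀ (ModuleCat.ofHom
      (LinearMap.id : (Fin n → A) →ₗ[A] (Fin n → A)))) (add_zero l) :=
    (Abelian.Ext.comp_mk₀_id x).symm
  rw [this, key, Abelian.Ext.mk₀_sum, Abelian.Ext.comp_sum]
  refine Finset.sum_eq_zero fun i _ => ?_
  rw [← Abelian.Ext.mk₀_comp_mk₀, ← Abelian.Ext.comp_assoc_of_third_deg_zero, h l hl (x.comp _ _),
    Abelian.Ext.zero_comp]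

variable {M N T : Type u} [AddCommGroup M] [AddCommGroup N] [AddCommGroup T]
  [Module A M] [Module A N] [Module A T]

/-- The obstruction to lifting along `T → T ⧸ B` lies in `Ext¹(Z, B)`. -/
theorem ExtAcyclic.exists_lift {Z : Type u} [AddCommGroup Z] [Module A Z] (B : Submodule A T)
    (h : ExtAcyclic (ModuleCat.of A Z) (ModuleCat.of A B)) (f : Z →ₗ[A] T ⧸ B) :
    ∃ g : Z →ₗ[A] T, ∀ z, B.mkQ (g z) = f z := by
  have hS := ModuleCat.shortExact_of_ker B.subtype B.mkQ B.subtype_injective B.mkQ_surjective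
    (by simp)
  obtain ⟨x, hx⟩ := Abelian.Ext.covariant_sequence_exact₃ (ModuleCat.of A Z) hS
    (Abelian.Ext.mk₀ (ModuleCat.ofHom f)) (zero_add 1) (h 1 le_rfl _)
  obtain ⟨g, rfl⟩ := (Abelian.Ext.mk₀_bijective _ _).2 x
  rw [Abelian.Ext.mk₀_comp_mk₀] at hx
  have := (Abelian.Ext.mk₀_bijective _ _).1 hx
  refine ⟨g.hom, fun z => ?_⟩
  exact congrArg (fun t => t.hom z) this

/-- The obstruction to extending from the kernel of `f` lies in `Ext¹` of the cokernel of its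
inclusion, which is the range of `f`. -/
theorem ExtAcyclic.exists_extension {f : M →ₗ[A] N}
    (h : ExtAcyclic (ModuleCat.of A (LinearMap.range f)) (ModuleCat.of A T))
    (g : LinearMap.ker f →ₗ[A] T) :
    ∃ g' : M →ₗ[A] T, ∀ x : LinearMap.ker f, g' (x : M) = g x := by
  have hS := ModuleCat.shortExact_of_ker (LinearMap.ker f).subtype f.rangeRestrict
    (Submodule.subtype_injective _) f.surjective_rangeRestrict (by simp)
  obtain ⟨x, hx⟩ := Abelian.Ext.contravariant_sequence_exact₁ hS (ModuleCat.of A T)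
    (Abelian.Ext.mk₀ (ModuleCat.ofHom g)) (add_zero 1) (h 1 le_rfl _)
  obtain ⟨g', rfl⟩ := (Abelian.Ext.mk₀_bijective _ _).2 x
  rw [Abelian.Ext.mk₀_comp_mk₀] at hx
  have := (Abelian.Ext.mk₀_bijective _ _).1 hx
  exact ⟨g'.hom, fun z => congrArg (fun t => ModuleCat.Hom.hom t z) this⟩

instance (n : ℕ) : Projective (ModuleCat.of A (Fin n → A)) :=
  (IsProjective.iff_projective _).1 inferInstance

/-- Dimension shift: in an exact sequence of free modules, the kernels are `Ext(-, Y)`-acyclic if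
`Y` has finite injective dimension. -/
theorem ExtAcyclic.ker_of_exact {Y : ModuleCat.{u} A} {c : ℕ} [HasInjectiveDimensionLT Y c]
    (m : ℕ → ℕ) (ρ : ∀ t, (Fin (m t) → A) →ₗ[A] (Fin (m (t + 1)) → A))
    (hρ : ∀ t, LinearMap.range (ρ t) = LinearMap.ker (ρ (t + 1))) (t : ℕ) :
    ExtAcyclic (ModuleCat.of A (LinearMap.ker (ρ t))) Y := by
  -- Induction on the slack `s` between `l` and the vanishing bound `c`: the connecting map embeds
  -- `Ext^l` of the kernel at `t` into `Ext^(l+1)` of the kernel at `t + 1`, as free modules have no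
  -- higher `Ext`.
  have main : ∀ s t l : ℕ, 1 ≤ l → c ≤ l + s →
      ∀ x : Abelian.Ext (ModuleCat.of A (LinearMap.ker (ρ t))) Y l, x = 0 := by
    intro s
    induction s with
    | zero =>
      intro t l _ hc x
      exact Abelian.Ext.eq_zero_of_hasInjectiveDimensionLT x c (by simpa using hc)
    | succ s ih =>
      intro t l hl hc x
      have hS := ModuleCat.shortExact_of_ker (LinearMap.ker (ρ t)).subtype
        ((ρ t).codRestrict (LinearMap.ker (ρ (t + 1)))
          (fun x => hρ t ▸ LinearMap.mem_range_self _ x))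
        (Submodule.subtype_injective _)
        (fun ⟨y, hy⟩ => by
          rw [← hρ t] at hy
          obtain ⟨x, rfl⟩ := hy
          exact ⟨x, rfl⟩) (by simp)
      obtain ⟨x', rfl⟩ := Abelian.Ext.contravariant_sequence_exact₁ hS Y x (add_comm 1 l)
        (ih _ _ (by lia) (by lia) _)
      rw [ExtAcyclic.of_projective (ModuleCat.of A (Fin (m t) → A)) Y l hl x',
        Abelian.Ext.comp_zero]
  exact fun l hl => main c t l hl (by lia)

/-- The images in an initial exact sequence `0 → A^{n₀} → ⋯ → A^{n_d}` are acyclic targets. -/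
theorem ExtAcyclic.target_of_exact {Z : ModuleCat.{u} A} (hZ : ExtAcyclic Z (ModuleCat.of A A))
    {d : ℕ} (n : ℕ → ℕ) (σ : ∀ t, (Fin (n t) → A) →ₗ[A] (Fin (n (t + 1)) → A))
    (B : ∀ t, Submodule A (Fin (n t) → A)) (hB₀ : B 0 = ⊥)
    (hB : ∀ t, B (t + 1) = LinearMap.range (σ t)) (hσ : ∀ t < d, LinearMap.ker (σ t) = B t) :
    ∀ t ≤ d, ExtAcyclic Z (ModuleCat.of A (B t)) := by
  intro t
  induction t with
  | zero =>
    intro _ l _ x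
    have : Subsingleton (ModuleCat.of A (B 0)) := by
      rw [hB₀]; exact inferInstanceAs (Subsingleton (⊥ : Submodule A (Fin (n 0) → A)))
    have h0 := ModuleCat.isZero_of_subsingleton (ModuleCat.of A (B 0))
    rw [← Abelian.Ext.comp_mk₀_id x, h0.eq_of_src (𝟙 _) 0, Abelian.Ext.mk₀_zero,
      Abelian.Ext.comp_zero]
  | succ t ih =>
    intro ht
    have hS := ModuleCat.shortExact_of_ker (B t).subtype ((σ t).codRestrict (B (t + 1))
        (fun x => hB t ▸ LinearMap.mem_range_self _ x))
        (Submodule.subtype_injective _)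
        (fun ⟨y, hy⟩ => by
          rw [hB t] at hy
          obtain ⟨x, rfl⟩ := hy
          exact ⟨x, rfl⟩) (by simp [hσ t (by lia)])
    exact ExtAcyclic.target_right hS (ih (by lia)) (hZ.pi _)

/-- In an exact sequence of finite free modules, each functional on a term which vanishes on the
kernel of the differential factors through the differential. -/
theorem exists_factor_of_exact {c : ℕ} [HasInjectiveDimensionLT (ModuleCat.of A A) c]
    (m : ℕ → ℕ) (ρ : ∀ t, (Fin (m t) → A) →ₗ[A] (Fin (m (t + 1)) → A))
    (hρ : ∀ t, LinearMap.range (ρ t) = LinearMap.ker (ρ (t + 1))) (t : ℕ)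
    (φ : (Fin (m t) → A) →ₗ[A] A) (hφ : LinearMap.ker (ρ t) ≤ LinearMap.ker φ) :
    ∃ ψ : (Fin (m (t + 1)) → A) →ₗ[A] A, φ = ψ ∘ₗ ρ t := by
  -- The functional descends to the range of `ρ t`, which is the kernel of `ρ (t + 1)`. Extending it
  -- from there is obstructed on the range of `ρ (t + 1)`, that is, the kernel of `ρ (t + 2)`; hence
  -- the index.
  have hac := ExtAcyclic.ker_of_exact (Y := ModuleCat.of A A) (c := c) m ρ hρ (t + 2)
  rw [← hρ (t + 1)] at hac
  let φ' : LinearMap.range (ρ t) →ₗ[A] A :=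
    ((LinearMap.ker (ρ t)).liftQ φ hφ) ∘ₗ (ρ t).quotKerEquivRange.symm.toLinearMap
  have hφ' : ∀ x, φ' ⟨ρ t x, x, rfl⟩ = φ x := fun x => by
    have : (ρ t).quotKerEquivRange.symm ⟨ρ t x, x, rfl⟩ = (LinearMap.ker (ρ t)).mkQ x := by
      rw [LinearEquiv.symm_apply_eq]; rfl
    simp [φ', this]
  obtain ⟨ψ, hψ⟩ := hac.exists_extension (T := A)
    (φ' ∘ₗ (LinearEquiv.ofEq _ _ (hρ t).symm).toLinearMap)
  refine ⟨ψ, LinearMap.ext fun x => ?_⟩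
  have := hψ ⟨ρ t x, hρ t ▸ LinearMap.mem_range_self _ x⟩
  exact ((this).trans (hφ' x)).symm

/-- Lifting a homomorphism of top cohomology modules to a homomorphism of complexes. -/
theorem exists_map_of_exact {c : ℕ} [HasInjectiveDimensionLT (ModuleCat.of A A) c]
    (m : ℕ → ℕ) (ρ : ∀ t, (Fin (m t) → A) →ₗ[A] (Fin (m (t + 1)) → A))
    (hρ : ∀ t, LinearMap.range (ρ t) = LinearMap.ker (ρ (t + 1)))
    {d : ℕ} (n : ℕ → ℕ) (σ : ∀ t, (Fin (n t) → A) →ₗ[A] (Fin (n (t + 1)) → A))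
    (B : ∀ t, Submodule A (Fin (n t) → A)) (hB₀ : B 0 = ⊥)
    (hB : ∀ t, B (t + 1) = LinearMap.range (σ t)) (hσ : ∀ t < d, LinearMap.ker (σ t) = B t)
    (BY : Submodule A (Fin (m 0) → A)) (ζ : Fin (m 0) → A) (η : Fin (n d) → A)
    (hBY : BY ≤ LinearMap.ker (ρ 0)) (hζ : ζ ∈ LinearMap.ker (ρ 0))
    (hgen : ∀ w ∈ LinearMap.ker (ρ 0), ∃ a : A, w - a • ζ ∈ BY)
    (hann : ∀ a : A, a • ζ ∈ BY → a • η ∈ B d) :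
    ∃ Θ : (Fin (m 0) → A) →ₗ[A] (Fin (n d) → A),
      Θ ζ - η ∈ B d ∧ ∀ w ∈ BY, Θ w ∈ B d := by
  have hZ := ExtAcyclic.ker_of_exact (Y := ModuleCat.of A A) (c := c) m ρ hρ
  have h1 := ExtAcyclic.target_of_exact (hZ 0) n σ B hB₀ hB hσ d le_rfl
  -- Cocycles modulo `BY` form a cyclic module generated by the class of `ζ`, so `hann` is what
  -- makes `ζ ↦ η` well defined.
  have hζη : ∃ f : LinearMap.ker (ρ 0) →ₗ[A] (Fin (n d) → A) ⧸ B d,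
      f ⟨ζ, hζ⟩ = (B d).mkQ η ∧ ∀ w (hw : w ∈ BY), f ⟨w, hBY hw⟩ = 0 := by
    let Q := (LinearMap.ker (ρ 0)) ⧸ (BY.comap (LinearMap.ker (ρ 0)).subtype)
    let q : LinearMap.ker (ρ 0) →ₗ[A] Q := Submodule.mkQ _
    let g : A →ₗ[A] Q := LinearMap.toSpanSingleton A Q (q ⟨ζ, hζ⟩)
    let h : A →ₗ[A] (Fin (n d) → A) ⧸ B d := LinearMap.toSpanSingleton A _ ((B d).mkQ η)
    have hg : Function.Surjective g := by
      intro y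
      obtain ⟨⟨w, hw⟩, rfl⟩ := Submodule.mkQ_surjective _ y
      obtain ⟨a, ha⟩ := hgen w hw
      refine ⟨a, ?_⟩
      have : q (⟨w, hw⟩ - a • ⟨ζ, hζ⟩) = 0 := (Submodule.Quotient.mk_eq_zero _).2 ha
      rw [map_sub, map_smul, sub_eq_zero] at this
      exact this.symm
    have hgh : LinearMap.ker g ≤ LinearMap.ker h := by
      intro a ha
      have ha' : q (a • ⟨ζ, hζ⟩) = 0 := by rw [map_smul]; exact ha
      have := hann a ((Submodule.Quotient.mk_eq_zero
        (BY.comap (LinearMap.ker (ρ 0)).subtype)).1 ha')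
      rw [LinearMap.mem_ker]
      change a • (B d).mkQ η = 0
      rw [← map_smul]
      exact (Submodule.Quotient.mk_eq_zero _).2 this
    let f : Q →ₗ[A] (Fin (n d) → A) ⧸ B d :=
      ((LinearMap.ker g).liftQ h hgh) ∘ₗ (g.quotKerEquivOfSurjective hg).symm.toLinearMap
    refine ⟨f ∘ₗ q, ?_, fun w hw => ?_⟩
    · have : (g.quotKerEquivOfSurjective hg).symm (q ⟨ζ, hζ⟩) = (LinearMap.ker g).mkQ 1 := by
        rw [LinearEquiv.symm_apply_eq]
        exact (one_smul A (q ⟨ζ, hζ⟩)).symm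
      simp only [LinearMap.comp_apply, f, LinearEquiv.coe_coe, this]
      exact one_smul A ((B d).mkQ η)
    · have : q ⟨w, hBY hw⟩ = 0 := (Submodule.Quotient.mk_eq_zero _).2 hw
      rw [LinearMap.comp_apply, this, map_zero]
  obtain ⟨f, hf, hf'⟩ := hζη
  obtain ⟨g, hg⟩ := h1.exists_lift (B d) f
  -- So far the map is lifted on cocycles only; acyclicity of the next kernel extends it to the
  -- whole free module.
  have hac : ExtAcyclic (ModuleCat.of A (LinearMap.range (ρ 0)))
      (ModuleCat.of A (Fin (n d) → A)) := by
    rw [hρ 0]; exact (hZ 1).pi _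
  obtain ⟨Θ, hΘ⟩ := hac.exists_extension g
  refine ⟨Θ, ?_, fun w hw => ?_⟩
  · have := (hg ⟨ζ, hζ⟩).trans hf
    rw [← hΘ] at this
    rw [← (B d).ker_mkQ, LinearMap.mem_ker, map_sub, this, sub_self]
  · have := (hg ⟨w, hBY hw⟩).trans (hf' w hw)
    rw [← hΘ] at this
    rw [← (B d).ker_mkQ, LinearMap.mem_ker]
    exact this

end LeftModules

/-! ### Ext groups computed from syzygies -/

section Syzygies

universe w v₁ u₁

/-- A projective resolution of `K 0`, presented by short exact sequences of syzygies. -/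
structure SyzygySequence (C : Type u₁) [Category.{v₁} C] [Abelian C] where
  K : ℕ → C
  F : ℕ → C
  ι : ∀ t, K (t + 1) ⟶ F t
  π : ∀ t, F t ⟶ K t
  w : ∀ t, ι t ≫ π t = 0
  shortExact : ∀ t, (ShortComplex.mk (ι t) (π t) (w t)).ShortExact
  proj : ∀ t, Projective (F t)

namespace SyzygySequence

variable {C : Type u₁} [Category.{v₁} C] [Abelian C] [HasExt.{w} C] (R : SyzygySequence C)

attribute [instance] SyzygySequence.proj

omit [HasExt.{w} C] in
theorem exists_desc (t : ℕ) {Y : C} (g : R.F t ⟶ Y) (hg : R.ι t ≫ g = 0) :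
    ∃ h : R.K t ⟶ Y, R.π t ≫ h = g :=
  have : Epi (R.π t) := (R.shortExact t).epi_g
  ⟨(R.shortExact t).exact.desc g hg, (R.shortExact t).exact.g_desc g hg⟩

open Abelian

/-- The class in `Ext^l(K₀, K_l)` of the resolution. -/
noncomputable def cls : ∀ l : ℕ, Ext (R.K 0) (R.K l) l
  | 0 => Ext.mk₀ (𝟙 _)
  | l + 1 => (cls l).comp (R.shortExact l).extClass rfl

/-- Dimension shifting: `cls l` is an iterated connecting class, and each connecting map is
surjective because its cokernel embeds in a positive `Ext` group of a projective. -/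
theorem exists_cls_comp {Y : C} (l : ℕ) : ∀ (j c : ℕ) (h : l + j = c)
    (x : Ext (R.K 0) Y c), ∃ x' : Ext (R.K l) Y j, (R.cls l).comp x' h = x := by
  induction l with
  | zero =>
    intro j c h x
    obtain rfl : j = c := by lia
    exact ⟨x, Ext.mk₀_id_comp x⟩
  | succ l ih =>
    intro j c h x
    obtain ⟨x', rfl⟩ := ih (j + 1) c (by lia) x
    obtain ⟨x'', rfl⟩ := Ext.contravariant_sequence_exact₃ (R.shortExact l) Y x'
      (Ext.eq_zero_of_projective (P := R.F l) _) (add_comm 1 j)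
    exact ⟨x'', Ext.comp_assoc _ _ _ _ _ (by lia)⟩

/-- The injective half of dimension shifting. The degree `j + 1` is positive, since in degree `0`
maps extending to the projective are killed. -/
theorem cls_comp_eq_zero {Y : C} (l : ℕ) : ∀ (j c : ℕ) (h : l + (j + 1) = c)
    (x : Ext (R.K l) Y (j + 1)), (R.cls l).comp x h = 0 → x = 0 := by
  induction l with
  | zero =>
    intro j c h x hx
    obtain rfl : j + 1 = c := by lia
    exact (Ext.mk₀_id_comp x).symm.trans hx
  | succ l ih =>
    intro j c h x hx
    have h1 := (Ext.comp_assoc (R.cls l) (R.shortExact l).extClass x rfl (add_comm 1 (j + 1))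
      (by lia)).symm.trans hx
    have h2 := ih (j + 1) c (by lia) _ h1
    obtain ⟨x', rfl⟩ := Ext.contravariant_sequence_exact₁ (R.shortExact l) Y x
      (add_comm 1 (j + 1)) h2
    rw [Ext.eq_zero_of_projective (P := R.F l) x', Ext.comp_zero]

/-- The class in `Ext^l(K₀, Y)` of a homomorphism from the `l`-th syzygy. -/
noncomputable def toExt (l : ℕ) {Y : C} (h : R.K l ⟶ Y) : Ext (R.K 0) Y l :=
  (R.cls l).comp (Ext.mk₀ h) (add_zero l)

theorem toExt_surjective (l : ℕ) {Y : C} (x : Ext (R.K 0) Y l) :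
    ∃ h : R.K l ⟶ Y, R.toExt l h = x := by
  obtain ⟨x', rfl⟩ := R.exists_cls_comp l 0 l rfl x
  obtain ⟨h, rfl⟩ := (Ext.mk₀_bijective _ _).2 x'
  exact ⟨h, rfl⟩

theorem toExt_comp (l : ℕ) {Y Y' : C} (h : R.K l ⟶ Y) (g : Y ⟶ Y') :
    R.toExt l (h ≫ g) = (R.toExt l h).comp (Ext.mk₀ g) (add_zero l) := by
  rw [toExt, toExt, Ext.comp_assoc_of_third_deg_zero, Ext.mk₀_comp_mk₀]

theorem toExt_sub (l : ℕ) {Y : C} (h h' : R.K l ⟶ Y) :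
    R.toExt l (h - h') = R.toExt l h - R.toExt l h' := by
  rw [toExt, toExt, toExt, sub_eq_add_neg, Ext.mk₀_add, Ext.comp_add, Ext.mk₀_neg, Ext.comp_neg,
    sub_eq_add_neg]

theorem toExt_zero_eq_zero {Y : C} (h : R.K 0 ⟶ Y) : R.toExt 0 h = 0 ↔ h = 0 := by
  rw [toExt, cls, Ext.mk₀_id_comp, Ext.mk₀_eq_zero_iff]

/-- This presents `Ext^(l+1)` as `Hom(K_(l+1), Y)` modulo maps extending to `F_l`: all but the last
connecting map are injective on the degrees in question. -/
theorem toExt_succ_eq_zero (l : ℕ) {Y : C} (h : R.K (l + 1) ⟶ Y) :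
    R.toExt (l + 1) h = 0 ↔ ∃ u : R.F l ⟶ Y, h = R.ι l ≫ u := by
  have hass : R.toExt (l + 1) h =
      (R.cls l).comp ((R.shortExact l).extClass.comp (Ext.mk₀ h) (add_zero 1)) rfl :=
    Ext.comp_assoc _ _ _ _ _ (by lia)
  constructor
  · intro h0
    rw [hass] at h0
    have h1 := R.cls_comp_eq_zero l 0 _ rfl _ h0
    obtain ⟨x, hx⟩ := Ext.contravariant_sequence_exact₁ (R.shortExact l) Y (Ext.mk₀ h)
      (add_zero 1) h1
    obtain ⟨u, rfl⟩ := (Ext.mk₀_bijective _ _).2 x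
    rw [Ext.mk₀_comp_mk₀] at hx
    exact ⟨u, ((Ext.mk₀_bijective _ _).1 hx).symm⟩
  · rintro ⟨u, rfl⟩
    have := (R.shortExact l).extClass_comp_assoc (Ext.mk₀ u) (h := add_zero 1)
    rw [Ext.mk₀_comp_mk₀] at this
    rw [hass, this, Ext.comp_zero]

/-- Naturality of the classes of resolutions under a lift of a homomorphism by one step. -/
theorem cls_comp_extClass_naturality (R R' : SyzygySequence C) (t : ℕ)
    (u : R.F t ⟶ R'.F t) (k : R.K (t + 1) ⟶ R'.K (t + 1)) (k' : R.K t ⟶ R'.K t)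
    (h : k ≫ R'.ι t = R.ι t ≫ u) (h' : R.π t ≫ k' = u ≫ R'.π t) (f : R.K 0 ⟶ R'.K 0)
    (hf : (Ext.mk₀ f).comp (R'.cls t) (zero_add t) = R.toExt t k') :
    (Ext.mk₀ f).comp (R'.cls (t + 1)) (zero_add (t + 1)) = R.toExt (t + 1) k := by
  have nat := ShortComplex.ShortExact.extClass_naturality (R.shortExact t) (R'.shortExact t)
    { τ₁ := k, τ₂ := u, τ₃ := k', comm₁₂ := h, comm₂₃ := h'.symm }
  have e1 : (Ext.mk₀ f).comp (R'.cls (t + 1)) (zero_add (t + 1)) =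
      ((Ext.mk₀ f).comp (R'.cls t) (zero_add t)).comp (R'.shortExact t).extClass rfl :=
    (Ext.comp_assoc _ _ _ _ _ (by lia)).symm
  have e2 : R.toExt (t + 1) k =
      (R.cls t).comp ((R.shortExact t).extClass.comp (Ext.mk₀ k) (add_zero 1)) rfl :=
    Ext.comp_assoc _ _ _ _ _ (by lia)
  rw [e1, e2, hf, nat, toExt]
  exact Ext.comp_assoc _ _ _ _ _ (by lia)

end SyzygySequence

/-- A fully faithful exact functor preserving enough projectives induces isomorphisms on `Ext`. -/
theorem mapExtAddHom_bijective {C : Type u₁} [Category.{v₁} C] [Abelian C] [HasExt.{w} C]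
    {D : Type*} [Category* D] [Abelian D] [HasExt.{w} D] (F : C ⥤ D) [F.Additive]
    [PreservesFiniteLimits F] [PreservesFiniteColimits F] [F.Full] [F.Faithful]
    [F.PreservesProjectiveObjects] (R : SyzygySequence C) (Y : C) (n : ℕ) :
    ∀ t, Function.Bijective (F.mapExtAddHom (R.K t) Y n) := by
  induction n with
  | zero =>
    intro t
    simpa [Abelian.Ext.mapExactFunctor₀] using
      ⟨Functor.Faithful.map_injective, Functor.Full.map_surjective⟩
  | succ n hn =>
    intro t
    have hS := R.shortExact t
    have : Projective (F.obj (R.F t)) :=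
      Functor.PreservesProjectiveObjects.projective_obj (R.proj t)
    -- The four-term comparison below needs only surjectivity on `Ext^n(F_t, Y)`: it is fullness for
    -- `n = 0`, and for `n > 0` the target vanishes.
    have hF : Function.Surjective (F.mapExtAddHom (R.F t) Y n) := by
      cases n with
      | zero =>
        simpa [Abelian.Ext.mapExactFunctor₀] using Functor.Full.map_surjective
      | succ n => exact fun y => ⟨0, by rw [map_zero, Abelian.Ext.eq_zero_of_projective y]⟩
    exact AddMonoidHom.bijective_of_surjective_of_bijective_of_right_exact _ _ _ _
      (F.mapExtAddHom (R.F t) Y n) (F.mapExtAddHom (R.K (t + 1)) Y n)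
      (F.mapExtAddHom (R.K t) Y (n + 1))
      (by
        ext x
        simp [Abelian.Ext.mapExactFunctor_comp, Abelian.Ext.mapExactFunctor_mk₀]
        rfl)
      (by
        ext x
        simp [Abelian.Ext.mapExactFunctor_comp, Abelian.Ext.mapExactFunctor_extClass]
        rfl)
      ((ShortComplex.ab_exact_iff_function_exact _).1
        (Abelian.Ext.contravariant_sequence_exact₁' hS Y n (n + 1) (add_comm 1 n)))
      ((ShortComplex.ab_exact_iff_function_exact _).1
        (Abelian.Ext.contravariant_sequence_exact₁' (hS.map_of_exact F) (F.obj Y) n (n + 1)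
          (add_comm 1 n)))
      hF (hn _)
      (fun x₃ ↦ Abelian.Ext.contravariant_sequence_exact₃ hS _ x₃
        (Abelian.Ext.eq_zero_of_projective (P := R.F t) _) (add_comm 1 n))
      (fun y₃ ↦ Abelian.Ext.contravariant_sequence_exact₃ (hS.map_of_exact F) _ y₃
        (Abelian.Ext.eq_zero_of_projective (P := F.obj (R.F t)) _) (add_comm 1 n))

end Syzygies

/-! ### Graded free right modules and finite free resolutions -/

section FreeModules

variable {k : Type v} {A : Type u} [Field k] [Ring A] [Algebra k A]
variable (𝒜 : ℤ → Submodule k A) [GradedAlgebra 𝒜]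

/-- The vectors whose `j`-th entry is homogeneous of degree `s j + i`. -/
def piDeg {n : ℕ} (s : Fin n → ℤ) (i : ℤ) : AddSubgroup (Fin n → A) where
  carrier := {v | ∀ j, v j ∈ 𝒜 (s j + i)}
  add_mem' hv hw j := (𝒜 _).add_mem (hv j) (hw j)
  zero_mem' _ := (𝒜 _).zero_mem
  neg_mem' hv j := (𝒜 _).neg_mem (hv j)

/-- The homogeneous components of a vector. -/
noncomputable def piProj {n : ℕ} (s : Fin n → ℤ) (i : ℤ) : (Fin n → A) →+ (Fin n → A) where
  toFun v j := GradedRing.proj 𝒜 (s j + i) (v j)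
  map_zero' := by ext; simp
  map_add' v w := by ext; simp

theorem isInternal_piDeg {n : ℕ} (s : Fin n → ℤ) : DirectSum.IsInternal (piDeg 𝒜 s) := by
  classical
  refine GrMod.isInternal_of_proj _ (piProj 𝒜 s) ?_ ?_ ?_
  · intro i v hv
    ext j
    exact DirectSum.decompose_of_mem_same 𝒜 (hv j)
  · intro i i' v hv h
    ext j
    exact DirectSum.decompose_of_mem_ne 𝒜 (hv j) (by simpa using h.symm)
  · intro v
    refine ⟨Finset.univ.biUnion fun j => (DirectSum.decompose 𝒜 (v j)).support.image
      fun t => t - s j, fun i => piProj 𝒜 s i v, fun i j => SetLike.coe_mem _, ?_⟩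
    ext j
    rw [Finset.sum_apply]
    have hinj : ∀ a b : ℤ, a - s j = b - s j → a = b := fun a b h => by simpa using h
    refine (DirectSum.sum_support_decompose 𝒜 (v j)).symm.trans ?_
    refine Eq.trans ?_ (Finset.sum_subset (Finset.subset_biUnion_of_mem
      (fun j => (DirectSum.decompose 𝒜 (v j)).support.image fun t => t - s j)
      (Finset.mem_univ j)) ?_)
    · rw [Finset.sum_image (fun a _ b _ h => hinj a b h)]
      refine Finset.sum_congr rfl fun t _ => ?_
      change _ = GradedRing.proj 𝒜 (s j + (t - s j)) (v j)
      rw [add_sub_cancel]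
      rfl
    · intro t _ ht
      change GradedRing.proj 𝒜 (s j + t) (v j) = 0
      by_contra hne
      refine ht (Finset.mem_image.2 ⟨s j + t, ?_, by ring⟩)
      rw [DFinsupp.mem_support_iff]
      intro h0
      refine hne ?_
      change ((DirectSum.decompose 𝒜 (v j) (s j + t) : 𝒜 (s j + t)) : A) = 0
      rw [h0]; rfl

/-- The free graded left module with generators of degrees `-s j`. -/
@[reducible] def frL {n : ℕ} (s : Fin n → ℤ) : GrMod 𝒜 where
  carrier := Fin n → A
  deg := piDeg 𝒜 s
  isInternal := isInternal_piDeg 𝒜 s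
  smul_mem {i j r x} hr hx l := by
    have h : r * x l ∈ 𝒜 (i + (s l + j)) := SetLike.mul_mem_graded hr (hx l)
    rwa [add_left_comm] at h

/-- The free graded right module with generators of degrees `-s j`. -/
@[reducible] def frR {n : ℕ} (s : Fin n → ℤ) : GrRMod 𝒜 where
  carrier := Fin n → A
  deg := piDeg 𝒜 s
  isInternal := isInternal_piDeg 𝒜 s
  smul_mem {i j r x} hr hx l := by
    have h : x l * r.unop ∈ 𝒜 (s l + j + i) := SetLike.mul_mem_graded (hx l) hr
    rwa [add_assoc, add_comm j i] at h

variable {𝒜}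
variable {n n' : ℕ} {s : Fin n → ℤ} {s' : Fin n' → ℤ}

theorem single_mem_piDeg (s : Fin n → ℤ) (j : Fin n) :
    (Pi.single j 1 : Fin n → A) ∈ piDeg 𝒜 s (-s j) := by
  intro l
  by_cases h : l = j
  · subst h
    simpa using SetLike.GradedOne.one_mem (A := 𝒜)
  · simp [h]

/-- The morphism from a free graded right module with given values on the generators. -/
def frR.desc {M : GrRMod 𝒜} (x : Fin n → M) (hx : ∀ j, x j ∈ M.deg (-s j)) : frR 𝒜 s ⟶ M where
  lin :=
    { toFun := fun v => ∑ j, op (v j) • x j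
      map_add' := fun v w => by
        rw [← Finset.sum_add_distrib]
        exact Finset.sum_congr rfl fun j _ => add_smul (op (v j)) (op (w j)) (x j)
      map_smul' := fun r v => by
        simp only [RingHom.id_apply, Finset.smul_sum, ← mul_smul]
        rfl }
  map_deg i v hv := by
    change ∑ j, op (v j) • x j ∈ M.deg i
    refine AddSubgroup.sum_mem (M.deg i) fun j _ => ?_
    have := M.smul_mem (r := op (v j)) (i := s j + i) (hv j) (hx j)
    rwa [add_neg_cancel_comm] at this

theorem frR.desc_lin {M : GrRMod 𝒜} (x : Fin n → M) (hx : ∀ j, x j ∈ M.deg (-s j))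
    (v : Fin n → A) : (frR.desc (s := s) x hx).lin v = ∑ j, op (v j) • x j := rfl

theorem frR.lin_eq_sum {M : GrRMod 𝒜} (f : frR 𝒜 s ⟶ M) (v : Fin n → A) :
    f.lin v = ∑ j, op (v j) • f.lin (Pi.single j 1) := by
  have : v = ∑ j, op (v j) • (Pi.single j 1 : Fin n → A) := by
    ext l
    simp [Finset.sum_apply, Pi.single_apply]
  conv_lhs => rw [this]
  rw [map_sum]
  exact Finset.sum_congr rfl fun j _ => map_smul f.lin _ _

theorem frR.hom_ext {M : GrRMod 𝒜} {f g : frR 𝒜 s ⟶ M}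
    (h : ∀ j, f.lin (Pi.single j 1) = g.lin (Pi.single j 1)) : f = g := by
  ext v
  rw [frR.lin_eq_sum f, frR.lin_eq_sum g]
  simp only [h]

instance : Projective (frR 𝒜 s) where
  factors {E X} f e _ := by
    have hs := GrMod.surjective_of_epi e
    choose g hg using hs
    -- An arbitrary preimage of a generator need not be homogeneous; its component of degree `-s j`
    -- is again a preimage.
    refine ⟨frR.desc (fun j => E.pr (-s j) (g (f.lin (Pi.single j 1))))
      (fun j => E.pr_mem _ _), frR.hom_ext fun j => ?_⟩
    rw [GrMod.comp_lin, frR.desc_lin, Finset.sum_eq_single j]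
    · simp only [Pi.single_eq_same, op_one, one_smul]
      rw [GrMod.lin_pr, hg]
      exact X.pr_of_mem (f.map_deg _ _ (single_mem_piDeg s j))
    · intro b _ hb
      simp [hb]
    · simp

/-- The projection of a free graded right module to a rank one summand. -/
def frR.proj (s : Fin n → ℤ) (j : Fin n) : frR 𝒜 s ⟶ (regR 𝒜).shift (s j) where
  lin :=
    { toFun := fun v => v j
      map_add' := fun _ _ => rfl
      map_smul' := fun _ _ => rfl }
  map_deg _ _ hv := hv j

/-- The morphism to a free graded right module with given components. -/
def frR.lift {M : GrRMod 𝒜} (f : ∀ j, M ⟶ (regR 𝒜).shift (s j)) : M ⟶ frR 𝒜 s where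
  lin :=
    { toFun := fun x j => (f j).lin x
      map_add' := fun x y => by ext j; simp
      map_smul' := fun r x => by ext j; simp }
  map_deg i x hx j := (f j).map_deg i x hx

theorem GrMod.mono_of_injective {R : Type u} [Ring R] [Algebra k R] {ℬ : ℤ → Submodule k R}
    {M N : GrMod ℬ} (f : M ⟶ N) (hf : Function.Injective f.lin) : Mono f :=
  ⟨fun g h e => by
    ext x
    exact hf (congrArg (fun t => GrMod.Hom.lin t x) e)⟩

theorem GrMod.epi_of_surjective {R : Type u} [Ring R] [Algebra k R] {ℬ : ℤ → Submodule k R}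
    {M N : GrMod ℬ} (f : M ⟶ N) (hf : Function.Surjective f.lin) : Epi f :=
  ⟨fun g h e => by
    ext x
    obtain ⟨y, rfl⟩ := hf x
    exact congrArg (fun t => GrMod.Hom.lin t y) e⟩

theorem GrMod.shortExact {R : Type u} [Ring R] [Algebra k R] {ℬ : ℤ → Submodule k R}
    {M N P : GrMod ℬ} (f : M ⟶ N) (g : N ⟶ P) (w : f ≫ g = 0)
    (hf : Function.Injective f.lin) (hg : Function.Surjective g.lin)
    (hfg : ∀ y, g.lin y = 0 → ∃ x, f.lin x = y) : (ShortComplex.mk f g w).ShortExact :=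
  ShortComplex.ShortExact.mk'
    (ShortComplex.exact_of_f_is_kernel _ (GrMod.isLimitOfExact f g w hf hfg))
    (GrMod.mono_of_injective f hf) (GrMod.epi_of_surjective g hg)

theorem exists_frR_surjective (M : GrRMod 𝒜) [hM : Module.Finite Aᵐᵒᵖ M] :
    ∃ (n : ℕ) (s : Fin n → ℤ) (f : frR 𝒜 s ⟶ M), Function.Surjective f.lin := by
  classical
  obtain ⟨m, x, hx⟩ := Module.Finite.exists_fin (R := Aᵐᵒᵖ) (M := M)
  choose S hS using fun a => M.exists_sum_pr (x a)
  let I := Σ a : Fin m, S a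
  let eI : Fin (Fintype.card I) ≃ I := (Fintype.equivFin I).symm
  -- The generators are the homogeneous components of a finite generating set; the sign is there
  -- because a shift `s j` places the generator in degree `-s j`.
  refine ⟨_, fun j => -((eI j).2 : ℤ), frR.desc (fun j => M.pr (eI j).2 (x (eI j).1))
    (fun j => by rw [neg_neg]; exact M.pr_mem _ _), ?_⟩
  rw [← LinearMap.range_eq_top, eq_top_iff, ← hx, Submodule.span_le]
  rintro _ ⟨a, rfl⟩
  rw [hS a]
  refine Submodule.sum_mem _ fun i hi => ⟨Pi.single (eI.symm ⟨a, i, hi⟩) 1, ?_⟩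
  rw [frR.desc_lin, Finset.sum_eq_single (eI.symm ⟨a, i, hi⟩)]
  · have : ∀ b : I, b = ⟨a, i, hi⟩ → M.pr b.2 (x b.1) = M.pr i (x a) := by
      rintro _ rfl; rfl
    simpa using this _ (eI.apply_symm_apply _)
  · intro b _ hb
    simp [hb]
  · simp

variable (𝒜) in
/-- A resolution by finite free graded right modules of `K 0`, with syzygies `K t`. -/
structure FreeRes where
  K : ℕ → GrRMod 𝒜
  n : ℕ → ℕ
  s : ∀ t, Fin (n t) → ℤ
  ι : ∀ t, K (t + 1) ⟶ frR 𝒜 (s t)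
  π : ∀ t, frR 𝒜 (s t) ⟶ K t
  w : ∀ t, ι t ≫ π t = 0
  inj : ∀ t, Function.Injective (ι t).lin
  surj : ∀ t, Function.Surjective (π t).lin
  ex : ∀ t y, (π t).lin y = 0 → ∃ x, (ι t).lin x = y

/-- Kernels of maps from finite free modules stay finite over a right Noetherian ring, so taking
syzygies can be iterated on the type of finite graded modules. -/
theorem exists_freeRes [IsNoetherianRing Aᵐᵒᵖ] (M : GrRMod 𝒜) (hM : Module.Finite Aᵐᵒᵖ M) :
    ∃ R : FreeRes 𝒜, R.K 0 = M := by
  let T := {M : GrRMod 𝒜 // Module.Finite Aᵐᵒᵖ M}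
  have hex : ∀ M : T, ∃ (n : ℕ) (s : Fin n → ℤ) (f : frR 𝒜 s ⟶ M.1), Function.Surjective f.lin :=
    fun M => have := M.2; exists_frR_surjective M.1
  choose n s f hf using hex
  have hfin : ∀ M : T, Module.Finite Aᵐᵒᵖ (LinearMap.ker (f M).lin) := fun M =>
    have : IsNoetherian Aᵐᵒᵖ A :=
      isNoetherian_of_linearEquiv (MulOpposite.opLinearEquiv Aᵐᵒᵖ : A ≃ₗ[Aᵐᵒᵖ] Aᵐᵒᵖ).symm
    have : IsNoetherian Aᵐᵒᵖ (Fin (n M) → A) := inferInstance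
    Module.IsNoetherian.finite Aᵐᵒᵖ _
  let next : T → T := fun M => ⟨(frR 𝒜 (s M)).sub _ (GrMod.isHomog_ker (f M)), hfin M⟩
  let K : ℕ → T := fun t => Nat.rec ⟨M, hM⟩ (fun _ => next) t
  exact ⟨{ K := fun t => (K t).1
           n := fun t => n (K t)
           s := fun t => s (K t)
           ι := fun t => GrMod.subι _ _ (GrMod.isHomog_ker (f (K t)))
           π := fun t => f (K t)
           w := fun t => by ext x; exact x.2
           inj := fun t => Subtype.val_injective
           surj := fun t => hf _
           ex := fun t y hy => ⟨⟨y, hy⟩, rfl⟩ }, rfl⟩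

namespace FreeRes

variable (R : FreeRes 𝒜)

theorem shortExact (t : ℕ) : (ShortComplex.mk (R.ι t) (R.π t) (R.w t)).ShortExact :=
  GrMod.shortExact _ _ (R.w t) (R.inj t) (R.surj t) (R.ex t)

/-- The underlying abstract resolution. -/
@[reducible] def syz : SyzygySequence (GrRMod 𝒜) where
  K := R.K
  F t := frR 𝒜 (R.s t)
  ι := R.ι
  π := R.π
  w := R.w
  shortExact := R.shortExact
  proj _ := inferInstance

end FreeRes

end FreeModules

/-! ### The dual complex of a free resolution -/

section FreeModules

variable {k : Type v} {A : Type u} [Field k] [Ring A] [Algebra k A]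
variable {𝒜 : ℤ → Submodule k A} [GradedAlgebra 𝒜]

/-- The morphism from a free graded right module given by a homogeneous row vector. -/
def rowHom {n : ℕ} {s : Fin n → ℤ} (m : ℤ) (w : Fin n → A)
    (hw : w ∈ piDeg 𝒜 (fun j => -s j) m) : frR 𝒜 s ⟶ (regR 𝒜).shift m :=
  frR.desc w (fun j => by
    change w j ∈ 𝒜 (m + -s j)
    rw [add_comm]
    exact hw j)

theorem rowHom_lin {n : ℕ} {s : Fin n → ℤ} (m : ℤ) (w : Fin n → A)
    (hw : w ∈ piDeg 𝒜 (fun j => -s j) m) (v : Fin n → A) :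
    (rowHom m w hw).lin v = ∑ j, w j * v j := rfl

theorem regR_lin_eq_sum {n : ℕ} {s : Fin n → ℤ} {m : ℤ} (f : frR 𝒜 s ⟶ (regR 𝒜).shift m)
    (v : Fin n → A) : f.lin v = ∑ j, (f.lin (Pi.single j 1) : A) * v j :=
  frR.lin_eq_sum f v

theorem lin_single_mem_piDeg {n : ℕ} {s : Fin n → ℤ} {m : ℤ}
    (f : frR 𝒜 s ⟶ (regR 𝒜).shift m) :
    (fun j => (f.lin (Pi.single j 1) : A)) ∈ piDeg 𝒜 (fun j => -s j) m := by
  intro j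
  have : (f.lin (Pi.single j 1) : A) ∈ 𝒜 (m + -s j) := f.map_deg _ _ (single_mem_piDeg s j)
  rwa [add_comm] at this

theorem sum_single_mul {n : ℕ} (w : Fin n → A) (j : Fin n) :
    ∑ i, w i * (Pi.single j 1 : Fin n → A) i = w j := by
  simp [Pi.single_apply]

theorem sum_mul_single {n : ℕ} (w : Fin n → A) (j : Fin n) :
    ∑ i, (Pi.single j 1 : Fin n → A) i * w i = w j := by
  simp [Pi.single_apply]

namespace FreeRes

variable (R : FreeRes 𝒜)

/-- The entries of the differential of a free resolution. -/
def entry (t : ℕ) (i : Fin (R.n t)) (j : Fin (R.n (t + 1))) : A :=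
  (R.ι t).lin ((R.π (t + 1)).lin (Pi.single j 1)) i

theorem entry_mem (t : ℕ) (i : Fin (R.n t)) (j : Fin (R.n (t + 1))) :
    R.entry t i j ∈ 𝒜 (R.s t i + -R.s (t + 1) j) :=
  (R.ι t).map_deg _ _ ((R.π (t + 1)).map_deg _ _ (single_mem_piDeg _ j)) i

theorem differential_lin (t : ℕ) (v : Fin (R.n (t + 1)) → A) (i : Fin (R.n t)) :
    ((R.ι t).lin ((R.π (t + 1)).lin v) : Fin (R.n t) → A) i = ∑ j, R.entry t i j * v j := by
  have := frR.lin_eq_sum (R.π (t + 1) ≫ R.ι t) v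
  rw [GrMod.comp_lin] at this
  rw [this]
  exact Finset.sum_apply _ _ _

/-- The differential of the complex of left modules dual to a free resolution. -/
def dual (t : ℕ) : (Fin (R.n t) → A) →ₗ[A] (Fin (R.n (t + 1)) → A) where
  toFun w j := ∑ i, w i * R.entry t i j
  map_add' w w' := by ext j; simp [add_mul, Finset.sum_add_distrib]
  map_smul' a w := by ext j; simp [Finset.mul_sum, mul_assoc]

theorem sum_dual_mul (t : ℕ) (w : Fin (R.n t) → A) (v : Fin (R.n (t + 1)) → A) :
    ∑ j, R.dual t w j * v j =
      ∑ i, w i * ((R.ι t).lin ((R.π (t + 1)).lin v) : Fin (R.n t) → A) i := by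
  have h1 : ∀ j, R.dual t w j * v j = ∑ i, w i * (R.entry t i j * v j) := fun j => by
    change (∑ i, w i * R.entry t i j) * v j = _
    rw [Finset.sum_mul]
    exact Finset.sum_congr rfl fun i _ => mul_assoc _ _ _
  rw [Finset.sum_congr rfl fun j _ => h1 j, Finset.sum_comm]
  refine Finset.sum_congr rfl fun i _ => ?_
  rw [differential_lin, Finset.mul_sum]

/-- A row vector is a cocycle exactly when it annihilates the embedded syzygy, since the next free
module surjects onto that syzygy. -/
theorem dual_eq_zero_iff (t : ℕ) (w : Fin (R.n t) → A) :
    R.dual t w = 0 ↔ ∀ y : R.K (t + 1), ∑ i, w i * ((R.ι t).lin y : Fin (R.n t) → A) i = 0 := by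
  constructor
  · intro h y
    obtain ⟨v, rfl⟩ := R.surj (t + 1) y
    rw [← sum_dual_mul, h]
    simp
  · intro h
    ext j
    rw [← sum_single_mul (R.dual t w) j, sum_dual_mul]
    exact h _

/-- The dual differential as a morphism of graded left modules. -/
def dualHom (t : ℕ) : frL 𝒜 (fun j => -R.s t j) ⟶ frL 𝒜 (fun j => -R.s (t + 1) j) where
  lin := R.dual t
  map_deg m w hw j := by
    change ∑ i, w i * R.entry t i j ∈ 𝒜 (-R.s (t + 1) j + m)
    refine Submodule.sum_mem (𝒜 _) fun i _ => ?_
    have := SetLike.mul_mem_graded (hw i) (R.entry_mem t i j)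
    rwa [show -R.s t i + m + (R.s t i + -R.s (t + 1) j) = -R.s (t + 1) j + m by ring] at this

/-- The boundaries in the dual complex. -/
def bnd : ∀ t, Submodule A (Fin (R.n t) → A)
  | 0 => ⊥
  | t + 1 => LinearMap.range (R.dual t)

theorem isHomog_bnd (t : ℕ) : (frL 𝒜 (fun j => -R.s t j)).IsHomog (R.bnd t) := by
  cases t with
  | zero =>
    intro x hx i
    rw [(Submodule.mem_bot A).1 hx, map_zero]
    exact Submodule.zero_mem _
  | succ t => exact GrMod.isHomog_range (R.dualHom t)

theorem bnd_le_ker (t : ℕ) : R.bnd t ≤ LinearMap.ker (R.dual t) := by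
  cases t with
  | zero => exact bot_le
  | succ t =>
    rintro _ ⟨w, rfl⟩
    rw [LinearMap.mem_ker, dual_eq_zero_iff]
    intro y
    rw [sum_dual_mul, show (R.π (t + 1)).lin ((R.ι (t + 1)).lin y) = 0 from
      congrArg (fun f => GrMod.Hom.lin f y) (R.w (t + 1)), map_zero]
    exact Finset.sum_eq_zero fun i _ => mul_zero (w i)

/-- The row vector of a morphism from a syzygy. -/
def row {t : ℕ} {m : ℤ} (h : R.K t ⟶ (regR 𝒜).shift m) (j : Fin (R.n t)) : A :=
  h.lin ((R.π t).lin (Pi.single j 1))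

theorem row_mem {t : ℕ} {m : ℤ} (h : R.K t ⟶ (regR 𝒜).shift m) :
    R.row h ∈ piDeg 𝒜 (fun j => -R.s t j) m :=
  lin_single_mem_piDeg (R.π t ≫ h)

theorem sum_row_mul {t : ℕ} {m : ℤ} (h : R.K t ⟶ (regR 𝒜).shift m) (v : Fin (R.n t) → A) :
    ∑ j, R.row h j * v j = h.lin ((R.π t).lin v) :=
  (regR_lin_eq_sum (R.π t ≫ h) v).symm

theorem row_mem_ker {t : ℕ} {m : ℤ} (h : R.K t ⟶ (regR 𝒜).shift m) :
    R.row h ∈ LinearMap.ker (R.dual t) := by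
  rw [LinearMap.mem_ker, dual_eq_zero_iff]
  intro y
  rw [sum_row_mul, show (R.π t).lin ((R.ι t).lin y) = 0 from
    congrArg (fun f => GrMod.Hom.lin f y) (R.w t), map_zero]

theorem row_injective {t : ℕ} {m : ℤ} {h h' : R.K t ⟶ (regR 𝒜).shift m}
    (e : R.row h = R.row h') : h = h' := by
  ext y
  obtain ⟨v, rfl⟩ := R.surj t y
  rw [← sum_row_mul, ← sum_row_mul, e]

/-- A homogeneous cocycle defines a map on the free module that kills the next syzygy, so it
descends to `K t`. -/
theorem exists_row_eq {t : ℕ} {m : ℤ} (w : Fin (R.n t) → A)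
    (hw : w ∈ piDeg 𝒜 (fun j => -R.s t j) m) (hw' : w ∈ LinearMap.ker (R.dual t)) :
    ∃ h : R.K t ⟶ (regR 𝒜).shift m, R.row h = w := by
  obtain ⟨h, hh⟩ := R.syz.exists_desc t (rowHom m w hw) (by
    ext y
    exact (R.dual_eq_zero_iff t w).1 hw' y)
  refine ⟨h, ?_⟩
  ext j
  have := congrArg (fun f => GrMod.Hom.lin f (Pi.single j 1 : Fin (R.n t) → A)) hh
  exact this.trans (sum_single_mul w j)

theorem row_ι_comp {t : ℕ} {m : ℤ} (u : frR 𝒜 (R.s t) ⟶ (regR 𝒜).shift m) :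
    R.row (R.ι t ≫ u) = R.dual t (fun j => u.lin (Pi.single j 1)) := by
  ext j
  rw [← sum_single_mul (R.dual t _) j, sum_dual_mul, ← sum_single_mul (R.row _) j, sum_row_mul]
  exact regR_lin_eq_sum u _

/-- Together with `exists_row_eq` this identifies `Ext^t(K_0, A(m))` with the degree `m` part of the
cohomology of the dual complex; index `0` agrees because `bnd 0 = ⊥`. -/
theorem toExt_eq_zero_iff (t : ℕ) {m : ℤ} (h : R.K t ⟶ (regR 𝒜).shift m) :
    R.syz.toExt t h = 0 ↔ R.row h ∈ R.bnd t := by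
  cases t with
  | zero =>
    rw [SyzygySequence.toExt_zero_eq_zero]
    constructor
    · rintro rfl
      exact (Submodule.mem_bot A).2 (funext fun j => rfl)
    · intro h0
      exact R.row_injective (((Submodule.mem_bot A).1 h0).trans (funext fun j => rfl))
  | succ t =>
    rw [SyzygySequence.toExt_succ_eq_zero]
    constructor
    · rintro ⟨u, rfl⟩
      exact ⟨_, (R.row_ι_comp u).symm⟩
    · rintro ⟨w, hw⟩
      -- The given cochain need not be homogeneous; its component of degree `m` has the same
      -- coboundary, because the differential has degree `0`.
      have hw' : R.dual t ((frL 𝒜 (fun j => -R.s t j)).pr m w) = R.row h := by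
        have := GrMod.lin_pr (R.dualHom t) m w
        refine this.trans ?_
        change (frL 𝒜 (fun j => -R.s (t + 1) j)).pr m (R.dual t w) = R.row h
        rw [hw]
        exact GrMod.pr_of_mem _ (R.row_mem h)
      refine ⟨rowHom m _ (GrMod.pr_mem (frL 𝒜 (fun j => -R.s t j)) m w), R.row_injective ?_⟩
      rw [row_ι_comp, ← hw']
      congr 1
      ext j
      rw [rowHom_lin, sum_single_mul]

/-- Vanishing of the graded `Ext` groups in all degrees gives ungraded exactness: cocycles form a
homogeneous submodule, so each homogeneous component can be treated separately. -/
theorem ker_dual_eq_bnd (t : ℕ)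
    (hvan : ∀ m, ∀ x : Abelian.Ext (R.K 0) ((regR 𝒜).shift m) t, x = 0) :
    LinearMap.ker (R.dual t) = R.bnd t := by
  refine le_antisymm (fun w hw => ?_) (R.bnd_le_ker t)
  obtain ⟨S, hS⟩ := (frL 𝒜 (fun j => -R.s t j)).exists_sum_pr w
  rw [hS]
  refine Submodule.sum_mem _ fun m _ => ?_
  obtain ⟨h, hh⟩ := R.exists_row_eq _
    (GrMod.pr_mem (frL 𝒜 (fun j => -R.s t j)) m w)
    (GrMod.isHomog_ker (R.dualHom t) w hw m)
  rw [← hh]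
  exact (R.toExt_eq_zero_iff t h).1 (hvan m _)

end FreeRes

end FreeModules

/-! ### Realizing maps on top Ext groups by module homomorphisms -/

section FreeModules

variable {k : Type v} {A : Type u} [Field k] [Ring A] [Algebra k A]
variable {𝒜 : ℤ → Submodule k A} [GradedAlgebra 𝒜]

theorem GrMod.pr_smul {R : Type u} [Ring R] [Algebra k R] {ℬ : ℤ → Submodule k R}
    (M : GrMod ℬ) {i : ℤ} {r : R} (hr : r ∈ ℬ i) (j : ℤ) (x : M) :
    M.pr (i + j) (r • x) = r • M.pr j x := by
  obtain ⟨S, hS⟩ := M.exists_sum_pr x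
  have h1 : ∀ l, M.pr (i + j) (r • M.pr l x) = r • M.pr j (M.pr l x) := fun l => by
    by_cases h : l = j
    · subst h
      rw [M.pr_of_mem (M.smul_mem hr (M.pr_mem _ x)), M.pr_of_mem (M.pr_mem _ x)]
    · rw [M.pr_of_mem_ne (M.smul_mem hr (M.pr_mem _ x)) (by intro e; exact h (by lia)),
        M.pr_of_mem_ne (M.pr_mem _ x) (Ne.symm h), smul_zero]
  conv_lhs => rw [hS]
  conv_rhs => rw [hS]
  simp only [Finset.smul_sum, map_sum]
  exact Finset.sum_congr rfl fun l _ => h1 l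

theorem GrMod.pr_smul_of_mem (M : GrMod 𝒜) {j : ℤ} {x : M} (hx : x ∈ M.deg j) (i : ℤ) (a : A) :
    M.pr (i + j) (a • x) = GradedRing.proj 𝒜 i a • x := by
  classical
  have h1 : ∀ l, M.pr (i + j) (GradedRing.proj 𝒜 l a • x) =
      GradedRing.proj 𝒜 i (GradedRing.proj 𝒜 l a) • x := fun l => by
    have hl : GradedRing.proj 𝒜 l a ∈ 𝒜 l := SetLike.coe_mem _
    by_cases h : l = i
    · subst h
      rw [M.pr_of_mem (M.smul_mem hl hx)]
      congr 1
      exact (DirectSum.decompose_of_mem_same 𝒜 hl).symm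
    · rw [M.pr_of_mem_ne (M.smul_mem hl hx) (by intro e; exact h (by lia))]
      rw [show GradedRing.proj 𝒜 i (GradedRing.proj 𝒜 l a) = 0 from
        DirectSum.decompose_of_mem_ne 𝒜 hl h, zero_smul]
  have ha : a = ∑ l ∈ (DirectSum.decompose 𝒜 a).support, GradedRing.proj 𝒜 l a :=
    (DirectSum.sum_support_decompose 𝒜 a).symm
  conv_lhs => rw [ha]
  conv_rhs => rw [ha]
  simp only [Finset.sum_smul, map_sum]
  exact Finset.sum_congr rfl fun l _ => h1 l

/-- Left multiplication by a homogeneous element, as a morphism between shifts of `A`. -/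
def lmulShift (r m : ℤ) (a : A) (ha : a ∈ 𝒜 (m - r)) :
    (regR 𝒜).shift r ⟶ (regR 𝒜).shift m where
  lin := lmulLin a
  map_deg i x hx := by
    have h : a * x ∈ 𝒜 (m - r + (r + i)) := SetLike.mul_mem_graded ha hx
    rwa [show m - r + (r + i) = m + i by ring] at h

/-- The homogeneous part of degree zero of a linear map between free graded modules. -/
noncomputable def homogPart {n n' : ℕ} (s : Fin n → ℤ) (s' : Fin n' → ℤ)
    (Θ : (Fin n' → A) →ₗ[A] (Fin n → A)) (i : Fin n') : Fin n → A :=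
  (frL 𝒜 (fun j => -s j)).pr (s' i) (Θ (Pi.single i 1))

theorem homogPart_mem {n n' : ℕ} (s : Fin n → ℤ) (s' : Fin n' → ℤ)
    (Θ : (Fin n' → A) →ₗ[A] (Fin n → A)) (i : Fin n') :
    homogPart (𝒜 := 𝒜) s s' Θ i ∈ piDeg 𝒜 (fun j => -s j) (s' i) :=
  GrMod.pr_mem (frL 𝒜 (fun j => -s j)) _ _

theorem sum_smul_homogPart {n n' : ℕ} (s : Fin n → ℤ) (s' : Fin n' → ℤ)
    (Θ : (Fin n' → A) →ₗ[A] (Fin n → A)) {m : ℤ} {w : Fin n' → A}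
    (hw : w ∈ piDeg 𝒜 (fun j => -s' j) m) :
    ∑ i, w i • homogPart (𝒜 := 𝒜) s s' Θ i = (frL 𝒜 (fun j => -s j)).pr m (Θ w) := by
  have h1 : w = ∑ i, w i • (Pi.single i 1 : Fin n' → A) := by
    ext l
    simp [Finset.sum_apply, Pi.single_apply]
  conv_rhs => rw [h1]
  rw [map_sum, map_sum]
  refine Finset.sum_congr rfl fun i _ => ?_
  rw [map_smul]
  have := GrMod.pr_smul (frL 𝒜 (fun j => -s j)) (hw i) (s' i) (Θ (Pi.single i 1))
  rw [show -s' i + m + s' i = m by ring] at this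
  exact this.symm

theorem sum_smul_homogPart_mem {n n' : ℕ} (s : Fin n → ℤ) (s' : Fin n' → ℤ)
    (Θ : (Fin n' → A) →ₗ[A] (Fin n → A)) (S' : Submodule A (Fin n' → A))
    (S : Submodule A (Fin n → A)) (hS' : (frL 𝒜 (fun j => -s' j)).IsHomog S')
    (hS : (frL 𝒜 (fun j => -s j)).IsHomog S) (h : ∀ w ∈ S', Θ w ∈ S) (w : Fin n' → A)
    (hw : w ∈ S') : ∑ i, w i • homogPart (𝒜 := 𝒜) s s' Θ i ∈ S := by
  obtain ⟨T, hT⟩ := (frL 𝒜 (fun j => -s' j)).exists_sum_pr w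
  let L : (Fin n' → A) →ₗ[A] (Fin n → A) :=
    Fintype.linearCombination A (homogPart (𝒜 := 𝒜) s s' Θ)
  change L w ∈ S
  rw [hT, map_sum]
  refine Submodule.sum_mem S fun m _ => ?_
  change ∑ i, (frL 𝒜 (fun j => -s' j)).pr m w i • homogPart (𝒜 := 𝒜) s s' Θ i ∈ S
  rw [sum_smul_homogPart s s' Θ (GrMod.pr_mem (frL 𝒜 (fun j => -s' j)) m w)]
  exact hS _ (h _ (hS' w hw m)) m

namespace FreeRes

variable (R R' : FreeRes 𝒜)

theorem row_sub {t : ℕ} {m : ℤ} (h h' : R.K t ⟶ (regR 𝒜).shift m) :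
    R.row (h - h') = R.row h - R.row h' := by
  ext j
  change (h - h').lin _ = h.lin _ - h'.lin _
  rw [sub_eq_add_neg, sub_eq_add_neg, GrMod.add_lin, GrMod.neg_lin]

theorem row_comp_lmulShift {t : ℕ} {r m : ℤ} (h : R.K t ⟶ (regR 𝒜).shift r) (a : A)
    (ha : a ∈ 𝒜 (m - r)) : R.row (h ≫ lmulShift r m a ha) = a • R.row h := rfl

open Abelian

/-- A homomorphism of syzygies which is zero on the relevant `Ext` groups comes from a
homomorphism of the resolved modules. -/
theorem exists_hom_of_syzygy_hom {d : ℕ}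
    (hR : ∀ t < d, ∀ m, ∀ x : Ext (R.K 0) ((regR 𝒜).shift m) t, x = 0) :
    ∀ t, t + 1 ≤ d → ∀ g : R.K (t + 1) ⟶ R'.K (t + 1),
      (∀ i, R.syz.toExt (t + 1) (g ≫ R'.ι t ≫ frR.proj (R'.s t) i) = 0) →
      ∃ f : R.K 0 ⟶ R'.K 0,
        (Ext.mk₀ f).comp (R'.syz.cls (t + 1)) (zero_add _) = R.syz.toExt (t + 1) g := by
  intro t
  induction t with
  | zero =>
    intro _ g hg
    choose u hu using fun i => (R.syz.toExt_succ_eq_zero 0 _).1 (hg i)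
    have e1 : g ≫ R'.ι 0 = R.ι 0 ≫ frR.lift u := by
      ext x i
      exact congrArg (fun f => GrMod.Hom.lin f x) (hu i)
    obtain ⟨k', hk'⟩ := R.syz.exists_desc 0 (frR.lift u ≫ R'.π 0) (by
      change R.ι 0 ≫ frR.lift u ≫ R'.π 0 = 0
      rw [← Category.assoc, ← e1, Category.assoc, R'.w, comp_zero])
    refine ⟨k', SyzygySequence.cls_comp_extClass_naturality R.syz R'.syz 0 (frR.lift u) g k' e1
      hk' k' ?_⟩
    rw [SyzygySequence.toExt, SyzygySequence.cls, SyzygySequence.cls, Ext.mk₀_id_comp,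
      Ext.comp_mk₀_id]
  | succ t ih =>
    intro ht g hg
    choose u hu using fun i => (R.syz.toExt_succ_eq_zero (t + 1) _).1 (hg i)
    -- Each coordinate of `g` has zero class, hence extends to the free module; together these
    -- extensions lift `g` one step down the resolutions.
    have e1 : g ≫ R'.ι (t + 1) = R.ι (t + 1) ≫ frR.lift u := by
      ext x i
      exact congrArg (fun f => GrMod.Hom.lin f x) (hu i)
    obtain ⟨k', hk'⟩ := R.syz.exists_desc (t + 1) (frR.lift u ≫ R'.π (t + 1)) (by
      change R.ι (t + 1) ≫ frR.lift u ≫ R'.π (t + 1) = 0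
      rw [← Category.assoc, ← e1, Category.assoc, R'.w, comp_zero])
    -- The vanishing of classes for `k'` is automatic, because its degree `t + 1` is below `d`.
    obtain ⟨f, hf⟩ := ih (by lia) k' (fun i => hR (t + 1) (by lia) _ _)
    exact ⟨f, SyzygySequence.cls_comp_extClass_naturality R.syz R'.syz (t + 1) (frR.lift u) g k'
      e1 hk' f hf⟩

/-- If `Ext^d(N, A)` is generated by `z` and is the only nonzero `Ext^l(N, A)`, and
`Ext^l(M, A) = 0` for `l < d`, then each homomorphism `Ext^d(N, A) → Ext^d(M, A)` is induced by a
homomorphism `M → N`. -/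
theorem exists_hom_of_ext {c : ℕ} [HasInjectiveDimensionLT (ModuleCat.of A A) c] {d : ℕ}
    (hR : ∀ t < d, ∀ m, ∀ x : Ext (R.K 0) ((regR 𝒜).shift m) t, x = 0)
    (hR' : ∀ t, d < t → ∀ m, ∀ x : Ext (R'.K 0) ((regR 𝒜).shift m) t, x = 0)
    {r : ℤ} (z : Ext (R'.K 0) ((regR 𝒜).shift r) d) (y : Ext (R.K 0) ((regR 𝒜).shift r) d)
    (hgen : ∀ m, ∀ x : Ext (R'.K 0) ((regR 𝒜).shift m) d, ∃ (a : A) (ha : a ∈ 𝒜 (m - r)),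
      x = z.comp (Ext.mk₀ (lmulShift r m a ha)) (add_zero d))
    (hann : ∀ m (a : A) (ha : a ∈ 𝒜 (m - r)),
      z.comp (Ext.mk₀ (lmulShift r m a ha)) (add_zero d) = 0 →
      y.comp (Ext.mk₀ (lmulShift r m a ha)) (add_zero d) = 0) :
    ∃ f : R.K 0 ⟶ R'.K 0, (Ext.mk₀ f).comp z (zero_add d) = y := by
  obtain ⟨hz, rfl⟩ := R'.syz.toExt_surjective d z
  obtain ⟨hy, rfl⟩ := R.syz.toExt_surjective d y
  let P := frL 𝒜 (fun j => -R.s d j)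
  let P' := frL 𝒜 (fun j => -R'.s d j)
  have hgen' : ∀ w ∈ LinearMap.ker (R'.dual d), ∃ a : A, w - a • R'.row hz ∈ R'.bnd d := by
    intro w hw
    obtain ⟨S, hS⟩ := P'.exists_sum_pr w
    have hcomp : ∀ m, ∃ a : A, P'.pr m w - a • R'.row hz ∈ R'.bnd d := by
      intro m
      obtain ⟨h, hh⟩ := R'.exists_row_eq _ (P'.pr_mem m w)
        (GrMod.isHomog_ker (R'.dualHom d) w hw m)
      obtain ⟨a, ha, e⟩ := hgen m (R'.syz.toExt d h)
      refine ⟨a, ?_⟩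
      rw [← SyzygySequence.toExt_comp, ← sub_eq_zero, ← SyzygySequence.toExt_sub] at e
      have := (R'.toExt_eq_zero_iff d _).1 e
      rwa [row_sub, row_comp_lmulShift, hh] at this
    choose a ha using hcomp
    refine ⟨∑ m ∈ S, a m, ?_⟩
    rw [hS, Finset.sum_smul, ← Finset.sum_sub_distrib]
    exact Submodule.sum_mem _ fun m _ => ha m
  have hann' : ∀ a : A, a • R'.row hz ∈ R'.bnd d → a • R.row hy ∈ R.bnd d := by
    classical
    intro a ha
    have hsum : a = ∑ l ∈ (DirectSum.decompose 𝒜 a).support, GradedRing.proj 𝒜 l a :=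
      (DirectSum.sum_support_decompose 𝒜 a).symm
    rw [hsum, Finset.sum_smul]
    refine Submodule.sum_mem _ fun l _ => ?_
    have h1 := R'.isHomog_bnd d _ ha (l + r)
    rw [GrMod.pr_smul_of_mem P' (R'.row_mem hz)] at h1
    have hl : GradedRing.proj 𝒜 l a ∈ 𝒜 (l + r - r) := by
      rw [add_sub_cancel_right]; exact SetLike.coe_mem _
    rw [← R'.row_comp_lmulShift hz _ hl, ← R'.toExt_eq_zero_iff, SyzygySequence.toExt_comp] at h1
    have h2 := hann _ _ hl h1
    rwa [← SyzygySequence.toExt_comp, R.toExt_eq_zero_iff] at h2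
  -- Above degree `d` the dual complex of `R'` is exact. Its truncation from degree `d` on is the
  -- source of the lifted map, so the indices are offset by `d`.
  have hρ : ∀ t, LinearMap.range (R'.dual (d + t)) = LinearMap.ker (R'.dual (d + (t + 1))) :=
    fun t => (R'.ker_dual_eq_bnd (d + t + 1) (hR' _ (by lia))).symm
  obtain ⟨Θ, hΘ₁, hΘ₂⟩ := exists_map_of_exact (c := c) (fun t => R'.n (d + t))
    (fun t => R'.dual (d + t)) hρ (d := d) R.n R.dual R.bnd rfl (fun _ => rfl)
    (fun t ht => R.ker_dual_eq_bnd t (hR t ht)) (R'.bnd d) (R'.row hz) (R.row hy)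
    (R'.bnd_le_ker d) (R'.row_mem_ker hz) hgen' hann'
  have hΘ₃ : ∀ w ∈ LinearMap.ker (R'.dual d), Θ w ∈ LinearMap.ker (R.dual d) := by
    intro w hw
    obtain ⟨a, ha⟩ := hgen' w hw
    have h1 := R.bnd_le_ker d (hΘ₂ _ ha)
    have h2 := R.bnd_le_ker d hΘ₁
    have h3 := Submodule.add_mem _ h2 (R.row_mem_ker hy)
    rw [sub_add_cancel] at h3
    rw [map_sub, map_smul] at h1
    have h4 := Submodule.add_mem _ h1 (Submodule.smul_mem _ a h3)
    rwa [sub_add_cancel] at h4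
  -- `Θ` was obtained from ungraded `Ext` groups and need not respect degrees. Its part of degree
  -- `0` keeps the properties needed, since boundaries and cocycles are homogeneous.
  let C := homogPart (𝒜 := 𝒜) (R.s d) (R'.s d) Θ
  have hC : ∀ i, C i ∈ piDeg 𝒜 (fun j => -R.s d j) (R'.s d i) := homogPart_mem _ _ Θ
  let cc : frR 𝒜 (R.s d) ⟶ frR 𝒜 (R'.s d) := frR.lift (fun i => rowHom _ (C i) (hC i))
  have hcc : ∀ (w : Fin (R'.n d) → A) (v : Fin (R.n d) → A),
      ∑ i, w i * (cc.lin v : Fin (R'.n d) → A) i = ∑ j, (∑ i, w i • C i) j * v j := by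
    intro w v
    have e1 : ∀ i, w i * (cc.lin v : Fin (R'.n d) → A) i = ∑ j, w i * C i j * v j := fun i => by
      change w i * ∑ j, C i j * v j = _
      rw [Finset.mul_sum]
      exact Finset.sum_congr rfl fun j _ => (mul_assoc _ _ _).symm
    rw [Finset.sum_congr rfl fun i _ => e1 i, Finset.sum_comm]
    refine Finset.sum_congr rfl fun j _ => ?_
    rw [Finset.sum_apply, Finset.sum_mul]
    rfl
  -- The transpose of `Θ` must carry the syzygy of `R` into that of `R'`. Pairing with an image
  -- vector `u` is a functional vanishing on cocycles, hence it factors through the next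
  -- differential; this displays `u` as an image of that differential of the resolution.
  have hker : R.ι d ≫ cc ≫ R'.π d = 0 := by
    ext x
    let u : Fin (R'.n d) → A := cc.lin ((R.ι d).lin x)
    let φ : (Fin (R'.n d) → A) →ₗ[A] A :=
      { toFun := fun w => ∑ i, w i * u i
        map_add' := fun w w' => by simp [add_mul, Finset.sum_add_distrib]
        map_smul' := fun a w => by simp [Finset.mul_sum, mul_assoc] }
    have hφ : LinearMap.ker (R'.dual d) ≤ LinearMap.ker φ := by
      intro w hw
      have h1 := sum_smul_homogPart_mem (𝒜 := 𝒜) (R.s d) (R'.s d) Θ _ _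
        (GrMod.isHomog_ker (R'.dualHom d)) (GrMod.isHomog_ker (R.dualHom d)) hΘ₃ w hw
      rw [LinearMap.mem_ker]
      change ∑ i, w i * u i = 0
      rw [hcc]
      exact (R.dual_eq_zero_iff d _).1 h1 x
    obtain ⟨ψ, hψ⟩ := exists_factor_of_exact (c := c) (fun t => R'.n (d + t))
      (fun t => R'.dual (d + t)) hρ 0 φ hφ
    let u' : Fin (R'.n (d + 1)) → A := fun j => ψ (Pi.single j 1)
    have hψ' : ∀ w', ψ w' = ∑ j, w' j * u' j := by
      intro w'
      have e1 : w' = ∑ i, w' i • (Pi.single i 1 : Fin (R'.n (d + 1)) → A) := by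
        ext l
        simp [Finset.sum_apply, Pi.single_apply]
      conv_lhs => rw [e1]
      rw [map_sum]
      exact Finset.sum_congr rfl fun i _ => map_smul ψ _ _
    have hu : u = (R'.ι d).lin ((R'.π (d + 1)).lin u') := by
      funext i
      have e1 : φ (Pi.single i 1) = u i := sum_mul_single u i
      rw [← e1, hψ, LinearMap.comp_apply, hψ']
      exact (R'.sum_dual_mul d _ u').trans (sum_mul_single _ i)
    change (R'.π d).lin u = 0
    rw [hu]
    exact congrArg (fun f => GrMod.Hom.lin f ((R'.π (d + 1)).lin u')) (R'.w d)
  obtain ⟨g, hg⟩ := R.syz.exists_desc d (cc ≫ R'.π d) hker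
  have hg' : ∀ v, g.lin ((R.π d).lin v) = (R'.π d).lin (cc.lin v) := fun v =>
    congrArg (fun f => GrMod.Hom.lin f v) hg
  have hrow : R.row (g ≫ hz) = ∑ i, R'.row hz i • C i := by
    funext j
    rw [← sum_single_mul (∑ i, R'.row hz i • C i) j, ← hcc, sum_row_mul]
    exact congrArg (fun t => hz.lin t) (hg' _)
  have htoExt : R.syz.toExt d (g ≫ hz) = R.syz.toExt d hy := by
    rw [← sub_eq_zero, ← SyzygySequence.toExt_sub, R.toExt_eq_zero_iff, row_sub, hrow,
      show ∑ i, R'.row hz i • C i = P.pr r (Θ (R'.row hz)) from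
        sum_smul_homogPart _ _ Θ (R'.row_mem hz)]
    have := R.isHomog_bnd d _ hΘ₁ r
    rw [map_sub] at this
    rwa [GrMod.pr_of_mem P (R.row_mem hy)] at this
  have hf : ∃ f : R.K 0 ⟶ R'.K 0,
      (Ext.mk₀ f).comp (R'.syz.cls d) (zero_add _) = R.syz.toExt d g := by
    cases d with
    | zero =>
      refine ⟨g, ?_⟩
      rw [SyzygySequence.toExt, SyzygySequence.cls, SyzygySequence.cls, Ext.mk₀_id_comp,
        Ext.comp_mk₀_id]
    | succ d =>
      -- The coordinate maps correspond to coboundaries of basis vectors, which `Θ` sends to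
      -- boundaries; so their classes vanish and `g` descends to the resolved modules.
      refine exists_hom_of_syzygy_hom R R' hR d le_rfl g fun i => ?_
      rw [R.toExt_eq_zero_iff]
      have e1 : R.row (g ≫ R'.ι d ≫ frR.proj (R'.s d) i) =
          ∑ l, R'.dual d (Pi.single i 1) l • C l := by
        funext j
        rw [← sum_single_mul (∑ l, R'.dual d (Pi.single i 1) l • C l) j, ← hcc,
          R'.sum_dual_mul, sum_mul_single]
        exact congrArg (fun t => ((R'.ι d).lin t : Fin (R'.n d) → A) i) (hg' _)
      rw [e1]
      exact sum_smul_homogPart_mem (𝒜 := 𝒜) _ _ Θ _ _ (R'.isHomog_bnd (d + 1))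
        (R.isHomog_bnd (d + 1)) hΘ₂ _ ⟨_, rfl⟩
  obtain ⟨f, hf⟩ := hf
  refine ⟨f, ?_⟩
  rw [← htoExt, SyzygySequence.toExt_comp, ← hf, SyzygySequence.toExt,
    ← Ext.comp_assoc_of_third_deg_zero]

end FreeRes

end FreeModules

/-! ### Corners and radical of a finite-dimensional algebra -/

section FiniteDimensionalAlgebras

variable {k : Type v} {Λ : Type u} [Field k] [Ring Λ] [Algebra k Λ]

/-- In a finite-dimensional algebra, the corner of a primitive idempotent is local. -/
theorem IsPrimitiveIdempotent.isNilpotent_or_exists_inverse [FiniteDimensional k Λ] {E t : Λ}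
    (hE : IsPrimitiveIdempotent E) (h₁ : E * t = t) (h₂ : t * E = t) :
    IsNilpotent t ∨ ∃ s, E * s = s ∧ s * E = s ∧ s * t = E ∧ t * s = E := by
  obtain ⟨hidem, hne, hprim⟩ := hE
  -- Fitting decomposition for left multiplication by `t`: for a high power `T` of `t`, write `1 = u
  -- + T c` with `T u = 0`.
  have hcompl := (LinearMap.mulLeft k t).eventually_isCompl_ker_pow_range_pow
  obtain ⟨m, hm⟩ := Filter.eventually_atTop.1 hcompl
  have hc := hm (m + 1) (by lia)
  rw [LinearMap.pow_mulLeft] at hc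
  set T := t ^ (m + 1) with hT
  have hET : E * T = T := by rw [hT, pow_succ', ← mul_assoc, h₁]
  have hTE : T * E = T := by rw [hT, pow_succ, mul_assoc, h₂]
  obtain ⟨u, hu, w, hw, huw⟩ := Submodule.mem_sup.1
    (hc.sup_eq_top ▸ Submodule.mem_top : (1 : Λ) ∈ _ ⊔ _)
  obtain ⟨c, rfl⟩ := hw
  rw [LinearMap.mem_ker, LinearMap.mulLeft_apply] at hu
  rw [LinearMap.mulLeft_apply] at huw
  have hzero : T * c - T * c * (T * c) = 0 := by
    have h0 : T * c - T * c * (T * c) = u * (T * c) := by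
      have : u = 1 - T * c := eq_sub_of_add_eq huw
      rw [this]; noncomm_ring
    have hmem : T * c - T * c * (T * c) ∈
        LinearMap.ker (LinearMap.mulLeft k T) ⊓ LinearMap.range (LinearMap.mulLeft k T) := by
      refine ⟨?_, ⟨c - c * (T * c), ?_⟩⟩
      · rw [SetLike.mem_coe, h0, LinearMap.mem_ker, LinearMap.mulLeft_apply, ← mul_assoc, hu,
          zero_mul]
      · rw [LinearMap.mulLeft_apply]; noncomm_ring
    rw [hc.inf_eq_bot] at hmem
    exact (Submodule.mem_bot k).1 hmem
  have hid : T * c * (T * c) = T * c := (sub_eq_zero.1 hzero).symm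
  -- This idempotent lies in the corner of `E`, so it is `0` or `E`. In the first case `T = 0`; in
  -- the second `t` has a right inverse in the corner.
  have hw' : IsIdempotentElem (T * c * E) := by
    change T * c * E * (T * c * E) = T * c * E
    calc T * c * E * (T * c * E) = T * c * (E * T) * c * E := by noncomm_ring
      _ = T * c * (T * c) * E := by rw [hET]; noncomm_ring
      _ = _ := by rw [hid]
  rcases hprim _ hw' (by rw [mul_assoc, ← mul_assoc, hET]) (by rw [mul_assoc, hidem]) with h | h
  · left
    refine ⟨m + 1, ?_⟩
    have : T = T * (u * E) + T * (T * c * E) := by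
      rw [← mul_add, ← add_mul, huw, one_mul, hTE]
    rw [← hT, this, h, ← mul_assoc, hu]
    simp
  · right
    have hts : t * (t ^ m * c * E) = E := by
      refine Eq.trans ?_ h
      rw [hT, pow_succ']
      simp only [mul_assoc]
    set s := E * (t ^ m * c * E) with hs
    have hts' : t * s = E := by rw [hs, ← mul_assoc, h₂, hts]
    have hEs : E * s = s := by rw [hs, ← mul_assoc, hidem]
    have hsE : s * E = s := by rw [hs]; simp only [mul_assoc, hidem.eq]
    refine ⟨s, hEs, hsE, ?_, hts'⟩
    have hst : IsIdempotentElem (s * t) := by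
      change s * t * (s * t) = s * t
      calc s * t * (s * t) = s * (t * s) * t := by noncomm_ring
        _ = _ := by rw [hts', hsE]
    rcases hprim _ hst (by rw [← mul_assoc, hEs]) (by rw [mul_assoc, h₂]) with h0 | h0
    · exfalso
      apply hne
      have : E = t * (s * t) * s := by
        calc E = E * E := hidem.symm
          _ = t * s * (t * s) := by rw [hts']
          _ = _ := by noncomm_ring
      rw [this, h0]; simp
    · exact h0

/-- Because `x = x E`, the factor `E` can be inserted between consecutive factors of a power of `y
x`. -/
theorem isNilpotent_of_isNilpotent_corner {E x y : Λ} (hx : x * E = x)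
    (h : IsNilpotent (E * y * x)) : IsNilpotent (y * x) := by
  obtain ⟨m, hm⟩ := h
  have e1 : y * x * (y * x) = y * x * (E * y * x) := by
    calc y * x * (y * x) = y * (x * E) * (y * x) := by rw [hx, mul_assoc]
      _ = _ := by noncomm_ring
  have e2 : E * y * x * (y * x) = E * y * x * (E * y * x) := by
    calc E * y * x * (y * x) = E * (y * x * (y * x)) := by noncomm_ring
      _ = _ := by rw [e1]; noncomm_ring
  have : ∀ m, (y * x) ^ (m + 1) = y * x * (E * y * x) ^ m := by
    intro m
    induction m with
    | zero => simp
    | succ m ih =>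
      cases m with
      | zero => rw [pow_succ, ih, pow_zero, mul_one, e1, pow_one]
      | succ m =>
        have e3 : (E * y * x) ^ (m + 1) * (y * x) = (E * y * x) ^ (m + 1) * (E * y * x) := by
          rw [pow_succ, mul_assoc, e2, ← mul_assoc]
        rw [pow_succ (y * x), ih, mul_assoc (y * x), e3, ← pow_succ]
  exact ⟨m + 1, by rw [this, hm, mul_zero]⟩

/-- An element of a corner outside of the Jacobson radical is invertible. -/
theorem exists_inverse_of_not_mem_jacobson [FiniteDimensional k Λ] {E F x : Λ}
    (hE : IsPrimitiveIdempotent E) (hF : IsPrimitiveIdempotent F) (h₁ : E * x = x)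
    (h₂ : x * F = x) (hx : x ∉ Ring.jacobson Λ) :
    ∃ y, F * y = y ∧ y * E = y ∧ y * x = F ∧ x * y = E := by
  -- If every left multiple of `x` were nilpotent, each `1 + y x` would be a unit and `x` would lie
  -- in the radical.
  have hy : ∃ y, ¬ IsNilpotent (y * x) := by
    by_contra hcon
    push Not at hcon
    apply hx
    rw [← Ideal.jacobson_bot, Ideal.mem_jacobson_iff]
    intro y
    obtain ⟨z, hz⟩ := (hcon y).isUnit_one_add.exists_left_inv
    refine ⟨z, ?_⟩
    rw [Ideal.mem_bot, mul_assoc, sub_eq_zero, ← hz, mul_add, mul_one, add_comm]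
  obtain ⟨y, hy⟩ := hy
  rcases hF.isNilpotent_or_exists_inverse (k := k) (t := F * y * x)
    (by rw [← mul_assoc, ← mul_assoc, hF.1]) (by rw [mul_assoc, h₂]) with h | ⟨s, hs⟩
  · exact absurd (isNilpotent_of_isNilpotent_corner h₂ h) hy
  · have h3 : s * y * E * x = F := by
        calc s * y * E * x = s * y * (E * x) := mul_assoc _ _ _
        _ = s * F * y * x := by rw [h₁, hs.2.1]
        _ = s * (F * y * x) := by noncomm_ring
        _ = F := hs.2.2.1
    have hid : IsIdempotentElem (x * (s * y * E)) := by
      change x * (s * y * E) * (x * (s * y * E)) = _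
      calc _ = x * (s * y * E * x) * (s * y * E) := by noncomm_ring
        _ = _ := by rw [h3, h₂]
    refine ⟨s * y * E, by rw [← mul_assoc, ← mul_assoc, hs.1], by rw [mul_assoc, hE.1], h3, ?_⟩
    rcases hE.2.2 _ hid (by rw [← mul_assoc, h₁]) (by rw [mul_assoc, mul_assoc, hE.1]) with h | h
    · exfalso
      apply hx
      have : x = x * (s * y * E) * x := by
        rw [mul_assoc, h3, h₂]
      rw [this, h, zero_mul]
      exact Submodule.zero_mem _
    · exact h

/-- The powers of the Jacobson radical of a finite-dimensional algebra. -/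
theorem exists_filtration_jacobson (k : Type v) (Λ : Type u) [Field k] [Ring Λ] [Algebra k Λ]
    [FiniteDimensional k Λ] : ∃ (N : ℕ) (I : ℕ → Ideal Λ), I 0 = ⊤ ∧ I (N + 1) = ⊥ ∧
      ∀ r, ∀ x ∈ Ring.jacobson Λ, ∀ y ∈ I r, x * y ∈ I (r + 1) := by
  have : IsArtinianRing Λ := IsArtinianRing.of_finite k Λ
  obtain ⟨N, hN⟩ := IsSemiprimaryRing.isNilpotent (R := Λ)
  refine ⟨N, fun r => Ring.jacobson Λ ^ r, (Submodule.pow_zero _).trans Ideal.one_eq_top, ?_,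
    fun r x hx y hy => ?_⟩
  · change Ring.jacobson Λ ^ (N + 1) = ⊥
    rw [Ideal.IsTwoSided.pow_succ, hN]
    exact Ideal.mul_bot _
  change _ ∈ Ring.jacobson Λ ^ (r + 1)
  rw [Ideal.IsTwoSided.pow_succ]
  exact Ideal.mul_mem_mul hx hy

end FiniteDimensionalAlgebras

/-! ### Homogeneous components and homogeneous subspaces -/

section GradedSubmodules

variable {k : Type v} {A : Type u} [Field k] [Ring A] [Algebra k A]
variable (𝒜 : ℤ → Submodule k A) [GradedAlgebra 𝒜]

theorem proj_of_mem {l : ℤ} {a : A} (ha : a ∈ 𝒜 l) (m : ℤ) :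
    GradedRing.proj 𝒜 m a = if m = l then a else 0 := by
  split_ifs with h
  · subst h
    exact DirectSum.decompose_of_mem_same 𝒜 ha
  · exact DirectSum.decompose_of_mem_ne 𝒜 ha (Ne.symm h)

theorem proj_mem (m : ℤ) (a : A) : GradedRing.proj 𝒜 m a ∈ 𝒜 m := SetLike.coe_mem _

theorem sum_proj (a : A) : ∃ s : Finset ℤ, a = ∑ m ∈ s, GradedRing.proj 𝒜 m a := by
  classical
  exact ⟨_, (DirectSum.sum_support_decompose 𝒜 a).symm⟩

/-- The projections commute, up to a shift, with multiplication by homogeneous elements. -/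
theorem proj_mul_of_mem {t : ℤ} {b : A} (hb : b ∈ 𝒜 t) (m : ℤ) (a : A) :
    GradedRing.proj 𝒜 m (a * b) = GradedRing.proj 𝒜 (m - t) a * b := by
  have := DirectSum.coe_decompose_mul_add_of_right_mem 𝒜 (i := m - t) (j := t) (a := a) hb
  rwa [sub_add_cancel] at this

theorem proj_of_mem_mul {t : ℤ} {b : A} (hb : b ∈ 𝒜 t) (m : ℤ) (a : A) :
    GradedRing.proj 𝒜 m (b * a) = b * GradedRing.proj 𝒜 (m - t) a := by
  have := DirectSum.coe_decompose_mul_add_of_left_mem 𝒜 (i := t) (j := m - t) (b := a) hb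
  rwa [add_sub_cancel] at this

/-- A homogeneous `k`-subspace. -/
def IsHomogeneousSubspace (P : Submodule k A) : Prop := ∀ a ∈ P, ∀ m, GradedRing.proj 𝒜 m a ∈ P

variable {𝒜}

/-- The homogeneous components of an element of a product of homogeneous subspaces are sums of
products of homogeneous elements. -/
theorem proj_mem_closure_of_mem_mul {P Q : Submodule k A} (hP : IsHomogeneousSubspace 𝒜 P)
    (hQ : IsHomogeneousSubspace 𝒜 Q) {a : A} (ha : a ∈ P * Q) (l : ℤ) :
    GradedRing.proj 𝒜 l a ∈ AddSubgroup.closure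
      {c | ∃ s, ∃ b ∈ P, ∃ b' ∈ Q, b ∈ 𝒜 s ∧ b' ∈ 𝒜 (l - s) ∧ c = b * b'} := by
  induction ha using Submodule.mul_induction_on' with
  | mem_mul_mem b hb c hc =>
    obtain ⟨s, hs⟩ := sum_proj 𝒜 b
    rw [hs, Finset.sum_mul, map_sum]
    refine sum_mem fun i _ => ?_
    rw [proj_of_mem_mul 𝒜 (proj_mem 𝒜 i b)]
    exact AddSubgroup.subset_closure
      ⟨i, _, hP b hb i, _, hQ c hc (l - i), proj_mem 𝒜 i b, proj_mem 𝒜 _ c, rfl⟩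
  | add x hx y hy h₁ h₂ =>
    rw [map_add]
    exact add_mem h₁ h₂

theorem IsHomogeneousSubspace.mul {P Q : Submodule k A} (hP : IsHomogeneousSubspace 𝒜 P)
    (hQ : IsHomogeneousSubspace 𝒜 Q) : IsHomogeneousSubspace 𝒜 (P * Q) := by
  intro a ha l
  refine (AddSubgroup.closure_le (K := (P * Q).toAddSubgroup)).2 ?_
    (proj_mem_closure_of_mem_mul hP hQ ha l)
  rintro _ ⟨s, b, hb, b', hb', -, -, rfl⟩
  exact Submodule.mul_mem_mul hb hb'

end GradedSubmodules

/-! ### The graded Jacobson radical of an ℕ-graded basic algebra -/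

section GradedJacobson

variable {k : Type v} {A : Type u} [Field k] [Ring A] [Algebra k A]
variable (𝒜 : ℤ → Submodule k A) [GradedAlgebra 𝒜]

/-- The elements whose component of degree `0` lies in the Jacobson radical of `𝒜 0`. If `𝒜` is
`ℕ`-graded with finite-dimensional `𝒜 0`, this is the graded Jacobson radical. -/
def gradedJacobson : Submodule k A where
  carrier := {a | DirectSum.decompose 𝒜 a 0 ∈ Ring.jacobson (𝒜 0)}
  add_mem' {a b} ha hb := by
    rw [Set.mem_ofPred_eq, DirectSum.decompose_add]
    exact add_mem ha hb
  zero_mem' := by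
    rw [Set.mem_ofPred_eq, DirectSum.decompose_zero]
    exact zero_mem _
  smul_mem' c a ha := by
    rw [Set.mem_ofPred_eq, DirectSum.decompose_smul]
    have h : (c • DirectSum.decompose 𝒜 a) 0 = (c • (1 : 𝒜 0)) * DirectSum.decompose 𝒜 a 0 := by
      refine Subtype.ext ?_
      change c • (DirectSum.decompose 𝒜 a 0 : A) = c • (1 : A) * _
      rw [smul_mul_assoc, one_mul]
    rw [h]
    exact Ideal.mul_mem_left _ _ ha

/-- `𝒜` is `ℕ`-graded with finite-dimensional `𝒜 0`, and basic with complete set `e` of primitive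
orthogonal idempotents. -/
structure IsNGradedBasic {n : ℕ} (e : Fin n → 𝒜 0) : Prop where
  nGraded : IsNGraded 𝒜
  finite_zero : FiniteDimensional k (𝒜 0)
  complete : CompleteOrthogonalIdempotents fun i => (e i : A)
  primitive : ∀ i, IsPrimitiveIdempotent (e i : A)
  basic : ∀ i j, i ≠ j →
    IsEmpty (LinearMap.range (lmulLin (e i : A)) ≃ₗ[Aᵐᵒᵖ] LinearMap.range (lmulLin (e j : A)))

theorem mem_gradedJacobson {a : A} :
    a ∈ gradedJacobson 𝒜 ↔ DirectSum.decompose 𝒜 a 0 ∈ Ring.jacobson (𝒜 0) := Iff.rfl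

variable {𝒜}

theorem mem_gradedJacobson_of_mem {l : ℤ} (hl : l ≠ 0) {a : A} (ha : a ∈ 𝒜 l) :
    a ∈ gradedJacobson 𝒜 := by
  rw [mem_gradedJacobson, DirectSum.decompose_of_mem 𝒜 ha, DirectSum.of_eq_of_ne _ _ _ hl.symm]
  exact zero_mem _

theorem proj_zero_mem_gradedJacobson {a : A} :
    GradedRing.proj 𝒜 0 a ∈ gradedJacobson 𝒜 ↔ a ∈ gradedJacobson 𝒜 := by
  rw [mem_gradedJacobson, mem_gradedJacobson, GradedRing.proj_apply, DirectSum.decompose_coe,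
    DirectSum.of_eq_same]

theorem isHomogeneousSubspace_gradedJacobson :
    IsHomogeneousSubspace 𝒜 (gradedJacobson 𝒜) := by
  intro a ha m
  by_cases hm : m = 0
  · subst hm
    exact proj_zero_mem_gradedJacobson.2 ha
  · exact mem_gradedJacobson_of_mem hm (proj_mem 𝒜 m a)

omit [GradedAlgebra 𝒜] in
theorem IsNGraded.eq_zero (hN : IsNGraded 𝒜) {l : ℤ} (hl : l < 0) {a : A} (ha : a ∈ 𝒜 l) :
    a = 0 := by
  rw [hN l hl] at ha
  exact (Submodule.mem_bot k).1 ha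

/-- In an `ℕ`-graded algebra, the component of degree `0` is multiplicative. -/
theorem IsNGraded.decompose_zero_mul (hN : IsNGraded 𝒜) (a b : A) :
    DirectSum.decompose 𝒜 (a * b) 0 =
      DirectSum.decompose 𝒜 a 0 * DirectSum.decompose 𝒜 b 0 := by
  refine Subtype.ext ?_
  change GradedRing.proj 𝒜 0 (a * b) = GradedRing.proj 𝒜 0 a * GradedRing.proj 𝒜 0 b
  induction a using DirectSum.Decomposition.inductionOn 𝒜 with
  | zero => simp
  | @homogeneous i a =>
    rw [proj_of_mem_mul 𝒜 a.2, proj_of_mem 𝒜 a.2]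
    split_ifs with h
    · subst h
      rw [sub_zero]
    · rw [zero_mul]
      rcases lt_or_gt_of_ne h with h | h
      · rw [hN.eq_zero (by lia) (proj_mem 𝒜 (0 - i) b), mul_zero]
      · rw [hN.eq_zero h a.2, zero_mul]
  | add x y hx hy => rw [add_mul, map_add, hx, hy, map_add, add_mul]

theorem IsNGraded.mul_mem_gradedJacobson_left (hN : IsNGraded 𝒜) (a : A) {b : A}
    (hb : b ∈ gradedJacobson 𝒜) : a * b ∈ gradedJacobson 𝒜 := by
  rw [mem_gradedJacobson, hN.decompose_zero_mul]
  exact Ideal.mul_mem_left _ _ hb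

theorem IsNGraded.mul_mem_gradedJacobson_right (hN : IsNGraded 𝒜) {a : A} (b : A)
    (ha : a ∈ gradedJacobson 𝒜) : a * b ∈ gradedJacobson 𝒜 := by
  rw [mem_gradedJacobson, hN.decompose_zero_mul]
  exact Ideal.mul_mem_right _ _ ha

theorem regR_pr (m : ℤ) (a : A) : (regR 𝒜).pr m a = GradedRing.proj 𝒜 m a := by
  induction a using DirectSum.Decomposition.inductionOn 𝒜 with
  | zero => exact (map_zero ((regR 𝒜).pr m)).trans (map_zero _).symm
  | @homogeneous i a =>
    rw [proj_of_mem 𝒜 a.2]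
    split_ifs with hm
    · subst hm
      exact (regR 𝒜).pr_of_mem a.2
    · exact (regR 𝒜).pr_of_mem_ne a.2 hm
  | add x y hx hy =>
    refine (map_add ((regR 𝒜).pr m) x y).trans ?_
    exact (congrArg₂ _ hx hy).trans (map_add _ x y).symm

theorem regL_pr (m : ℤ) (a : A) : (regL 𝒜).pr m a = GradedRing.proj 𝒜 m a := by
  induction a using DirectSum.Decomposition.inductionOn 𝒜 with
  | zero => exact (map_zero ((regL 𝒜).pr m)).trans (map_zero _).symm
  | @homogeneous i a =>
    rw [proj_of_mem 𝒜 a.2]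
    split_ifs with hm
    · subst hm
      exact (regL 𝒜).pr_of_mem a.2
    · exact (regL 𝒜).pr_of_mem_ne a.2 hm
  | add x y hx hy =>
    refine (map_add ((regL 𝒜).pr m) x y).trans ?_
    exact (congrArg₂ _ hx hy).trans (map_add _ x y).symm

theorem projR_pr (E : 𝒜 0) (m : ℤ) (v : projR 𝒜 E) :
    ((projR 𝒜 E).pr m v : A) = GradedRing.proj 𝒜 m (v : A) :=
  (GrMod.lin_pr (GrMod.subι (regR 𝒜) _ _) m v).trans (regR_pr m _)

theorem projL_pr (E : 𝒜 0) (m : ℤ) (v : projL 𝒜 E) :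
    ((projL 𝒜 E).pr m v : A) = GradedRing.proj 𝒜 m (v : A) :=
  (GrMod.lin_pr (GrMod.subι (regL 𝒜) _ _) m v).trans (regL_pr m _)

theorem GrMod.rad_eq {ℬ : ℤ → Submodule k A} (M : GrMod ℬ) {P : Submodule A M}
    (hP : M.IsHomog P) (hne : P ≠ ⊤) (hmax : ∀ L, M.IsHomog L → L ≠ ⊤ → L ≤ P) : M.rad = P := by
  have : {N | M.IsMaximalGraded N} = {P} := by
    ext N
    constructor
    · rintro ⟨h₁, h₂, h₃⟩
      rcases h₃ P hP (hmax N h₁ h₂) with h | h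
      · exact h.symm
      · exact absurd h hne
    · rintro rfl
      refine ⟨hP, hne, fun L hL hNL => ?_⟩
      by_cases h : L = ⊤
      · exact Or.inr h
      · exact Or.inl (le_antisymm (hmax L hL h) hNL)
  rw [GrMod.rad, this, sInf_singleton]

/-- Taking the degree `0` component is multiplicative in an `ℕ`-graded algebra, so powers of the
graded radical are sent into the filtration of `𝒜 0`. -/
theorem decompose_zero_mem_of_mem_pow (hN : IsNGraded 𝒜) {I : ℕ → Ideal (𝒜 0)} (h₀ : I 0 = ⊤)
    (hI : ∀ r, ∀ x ∈ Ring.jacobson (𝒜 0), ∀ y ∈ I r, x * y ∈ I (r + 1)) {r : ℕ} {a : A}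
    (ha : a ∈ gradedJacobson 𝒜 ^ r) : DirectSum.decompose 𝒜 a 0 ∈ I r := by
  induction ha using Submodule.pow_induction_on_left' with
  | algebraMap c =>
    rw [h₀]
    trivial
  | add x y i hx hy h₁ h₂ =>
    rw [DirectSum.decompose_add]
    exact add_mem h₁ h₂
  | mem_mul m hm i x hx h₁ =>
    rw [hN.decompose_zero_mul]
    exact hI i _ hm _ h₁

-- The equation is the left-inverse criterion for membership in the radical, at the multiplier `-1`:
-- it says `z (1 - E) = 1`, and multiplying by `E` on the right gives `0 = E`.
omit [Field k] [Algebra k A] in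
theorem eq_zero_of_isIdempotentElem {E z : A} (hE : IsIdempotentElem E)
    (hz : z * -1 * E + z - 1 = 0) : E = 0 := by
  calc E = (z * -1 * E + z - (z * -1 * E + z - 1)) * E := by rw [sub_sub_cancel, one_mul]
    _ = z * (E - E * E) := by rw [hz]; noncomm_ring
    _ = 0 := by rw [hE, sub_self, mul_zero]

namespace IsNGradedBasic

variable {n : ℕ} {e : Fin n → 𝒜 0} (h : IsNGradedBasic 𝒜 e)
include h

omit [GradedAlgebra 𝒜] in
theorem idem (i : Fin n) : (e i : A) * e i = e i := (h.primitive i).1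

omit [GradedAlgebra 𝒜] in
theorem sum_mul (a : A) : ∑ j, (e j : A) * a = a := by
  rw [← Finset.sum_mul, h.complete.complete, one_mul]

omit [GradedAlgebra 𝒜] in
theorem mul_sum (a : A) : ∑ j, a * (e j : A) = a := by
  rw [← Finset.mul_sum, h.complete.complete, mul_one]

theorem not_mem_gradedJacobson (i : Fin n) : (e i : A) ∉ gradedJacobson 𝒜 := by
  intro hi
  rw [mem_gradedJacobson, DirectSum.decompose_coe, DirectSum.of_eq_same, ← Ideal.jacobson_bot,
    Ideal.mem_jacobson_iff] at hi
  obtain ⟨z, hz⟩ := hi (-1)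
  rw [Ideal.mem_bot] at hz
  have hid : e i * e i = e i := Subtype.ext (h.idem i)
  apply (h.primitive i).2.1
  have : e i = 0 := eq_zero_of_isIdempotentElem hid hz
  rw [this]
  rfl

/-- A homogeneous element of degree `0` of `e_j A e_i` outside of the radical is invertible, and
then `i = j`. -/
theorem exists_inverse {j i : Fin n} {x : A} (hx : x ∈ 𝒜 0) (h₁ : (e j : A) * x = x)
    (h₂ : x * (e i : A) = x) (hxJ : x ∉ gradedJacobson 𝒜) :
    j = i ∧ ∃ y ∈ 𝒜 0, y * x = e i ∧ x * y = e j := by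
  have : @FiniteDimensional k (𝒜 0) _ _ Algebra.toModule := h.finite_zero
  have prim : ∀ i, IsPrimitiveIdempotent (e i) := fun i =>
    ⟨Subtype.ext (h.primitive i).1, fun h0 => (h.primitive i).2.1 (by rw [h0]; rfl),
      fun f hf h1 h2 => by
        rcases (h.primitive i).2.2 (f : A) (congrArg Subtype.val hf) (congrArg Subtype.val h1)
          (congrArg Subtype.val h2) with h | h
        · exact Or.inl (Subtype.ext h)
        · exact Or.inr (Subtype.ext h)⟩
  have hxJ' : (⟨x, hx⟩ : 𝒜 0) ∉ Ring.jacobson (𝒜 0) := by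
    rwa [mem_gradedJacobson, DirectSum.decompose_of_mem 𝒜 hx, DirectSum.of_eq_same] at hxJ
  obtain ⟨y, hy1, hy2, hy3, hy4⟩ := exists_inverse_of_not_mem_jacobson (k := k) (prim j) (prim i)
    (show e j * ⟨x, hx⟩ = ⟨x, hx⟩ from Subtype.ext h₁)
    (show ⟨x, hx⟩ * e i = ⟨x, hx⟩ from Subtype.ext h₂) hxJ'
  have hy3' : (y : A) * x = e i := congrArg Subtype.val hy3
  have hy4' : x * (y : A) = e j := congrArg Subtype.val hy4
  have hy1' : (e i : A) * y = y := congrArg Subtype.val hy1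
  refine ⟨?_, y, y.2, hy3', hy4'⟩
  by_contra hji
  -- Left multiplications by `x` and `y` are inverse isomorphisms between `e_i A` and `e_j A`,
  -- contradicting basicness.
  refine (h.basic i j (Ne.symm hji)).false (LinearEquiv.ofLinearMap
    (((lmulLin x).comp (Submodule.subtype _)).codRestrict _ fun v => ⟨x * v, ?_⟩)
    (((lmulLin (y : A)).comp (Submodule.subtype _)).codRestrict _ fun v => ⟨y * v, ?_⟩) ?_ ?_)
  · change (e j : A) * (x * v) = x * v
    rw [← mul_assoc, h₁]
  · change (e i : A) * (y * v) = y * v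
    rw [← mul_assoc, hy1']
  · ext ⟨_, w, rfl⟩
    change x * (y * (e j * w)) = e j * w
    rw [← mul_assoc, ← mul_assoc, hy4', h.idem]
  · ext ⟨_, w, rfl⟩
    change (y : A) * (x * (e i * w)) = e i * w
    rw [← mul_assoc, ← mul_assoc, hy3', h.idem]

/-- A proper graded submodule of `e_i A` is contained in the radical. -/
theorem mem_gradedJacobson_of_isHomog {i : Fin n} {L : Submodule Aᵐᵒᵖ (projR 𝒜 (e i))}
    (hL : (projR 𝒜 (e i)).IsHomog L) (hLt : L ≠ ⊤) {v : projR 𝒜 (e i)} (hv : v ∈ L) :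
    (v : A) ∈ gradedJacobson 𝒜 := by
  by_contra hvP
  apply hLt
  have hv0 : GradedRing.proj 𝒜 0 (v : A) ∉ gradedJacobson 𝒜 := fun hc =>
    hvP (proj_zero_mem_gradedJacobson.1 hc)
  have hev : (e i : A) * v = v := by
    obtain ⟨_, w, rfl⟩ := v
    change (e i : A) * (e i * w) = e i * w
    rw [← mul_assoc, h.idem]
  obtain ⟨b, hb⟩ : ∃ b, GradedRing.proj 𝒜 0 (v : A) * e b ∉ gradedJacobson 𝒜 := by
    by_contra hcon
    push Not at hcon
    exact hv0 (h.mul_sum (GradedRing.proj 𝒜 0 (v : A)) ▸ sum_mem fun b _ => hcon b)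
  obtain ⟨hib, y, hy, -, hxy⟩ := h.exists_inverse (j := i) (i := b)
    (x := GradedRing.proj 𝒜 0 (v : A) * e b)
    (by simpa using SetLike.mul_mem_graded (proj_mem 𝒜 0 (v : A)) (e b).2)
    (by
      rw [← mul_assoc]
      have := proj_of_mem_mul 𝒜 (e i).2 0 (v : A)
      rw [sub_zero, hev] at this
      rw [← this])
    (by rw [mul_assoc, h.idem]) hb
  rw [eq_top_iff]
  rintro w -
  -- The degree `0` component of `v` has an entry with right inverse `y`, so its right multiples
  -- exhaust `e_i A`.
  have hmem := L.smul_mem (op ((e b : A) * y * w)) (hL v hv 0)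
  have : op ((e b : A) * y * w) • (projR 𝒜 (e i)).pr 0 v = w := by
    refine Subtype.ext ?_
    change ((projR 𝒜 (e i)).pr 0 v : A) * (e b * y * w) = w
    rw [projR_pr, ← mul_assoc, ← mul_assoc, hxy]
    obtain ⟨_, w, rfl⟩ := w
    change (e i : A) * (e i * w) = e i * w
    rw [← mul_assoc, h.idem]
  rwa [this] at hmem

/-- The elements of `e_i A` in the graded radical form a proper graded submodule containing every
other one, hence the unique maximal one. -/
theorem rad_projR (i : Fin n) (v : projR 𝒜 (e i)) :
    v ∈ (projR 𝒜 (e i)).rad ↔ (v : A) ∈ gradedJacobson 𝒜 := by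
  let P : Submodule Aᵐᵒᵖ (projR 𝒜 (e i)) :=
    { carrier := {v | (v : A) ∈ gradedJacobson 𝒜}
      add_mem' := fun ha hb => (gradedJacobson 𝒜).add_mem ha hb
      zero_mem' := (gradedJacobson 𝒜).zero_mem
      smul_mem' := fun c v hv => h.nGraded.mul_mem_gradedJacobson_right c.unop hv }
  have hP : (projR 𝒜 (e i)).IsHomog P := fun v hv m => by
    change ((projR 𝒜 (e i)).pr m v : A) ∈ gradedJacobson 𝒜
    rw [projR_pr]
    exact isHomogeneousSubspace_gradedJacobson _ hv m
  have hne : P ≠ ⊤ := fun ht => h.not_mem_gradedJacobson i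
    (ht.symm ▸ Submodule.mem_top : (⟨e i, 1, mul_one _⟩ : projR 𝒜 (e i)) ∈ P)
  rw [GrMod.rad_eq (k := k) _ hP hne]
  · rfl
  · exact fun L hL hLt v hv => h.mem_gradedJacobson_of_isHomog hL hLt hv

theorem rad_projL (i : Fin n) (v : projL 𝒜 (e i)) :
    v ∈ (projL 𝒜 (e i)).rad ↔ (v : A) ∈ gradedJacobson 𝒜 := by
  let P : Submodule A (projL 𝒜 (e i)) :=
    { carrier := {v | (v : A) ∈ gradedJacobson 𝒜}
      add_mem' := fun ha hb => (gradedJacobson 𝒜).add_mem ha hb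
      zero_mem' := (gradedJacobson 𝒜).zero_mem
      smul_mem' := fun c v hv => h.nGraded.mul_mem_gradedJacobson_left c hv }
  have hP : (projL 𝒜 (e i)).IsHomog P := fun v hv m => by
    change ((projL 𝒜 (e i)).pr m v : A) ∈ gradedJacobson 𝒜
    rw [projL_pr]
    exact isHomogeneousSubspace_gradedJacobson _ hv m
  have hne : P ≠ ⊤ := fun ht => h.not_mem_gradedJacobson i
    (ht.symm ▸ Submodule.mem_top : (⟨e i, 1, one_mul _⟩ : projL 𝒜 (e i)) ∈ P)
  rw [GrMod.rad_eq (k := k) _ hP hne]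
  · rfl
  · intro L hL hLt v hv
    by_contra hvP
    apply hLt
    have hv0 : GradedRing.proj 𝒜 0 (v : A) ∉ gradedJacobson 𝒜 := fun hc =>
      hvP (proj_zero_mem_gradedJacobson.1 hc)
    have hev : (v : A) * e i = v := by
      obtain ⟨_, w, rfl⟩ := v
      change w * (e i : A) * e i = w * e i
      rw [mul_assoc, h.idem]
    obtain ⟨b, hb⟩ : ∃ b, (e b : A) * GradedRing.proj 𝒜 0 (v : A) ∉ gradedJacobson 𝒜 := by
      by_contra hcon
      push Not at hcon
      exact hv0 (h.sum_mul (GradedRing.proj 𝒜 0 (v : A)) ▸ sum_mem fun b _ => hcon b)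
    obtain ⟨hib, y, hy, hyx, -⟩ := h.exists_inverse (j := b) (i := i)
      (x := (e b : A) * GradedRing.proj 𝒜 0 (v : A))
      (by simpa using SetLike.mul_mem_graded (e b).2 (proj_mem 𝒜 0 (v : A)))
      (by rw [← mul_assoc, h.idem])
      (by
        rw [mul_assoc]
        have := proj_mul_of_mem 𝒜 (e i).2 0 (v : A)
        rw [sub_zero, hev] at this
        rw [← this]) hb
    rw [eq_top_iff]
    rintro w -
    have hmem := L.smul_mem ((w : A) * (y * e b)) (hL v hv 0)
    have : ((w : A) * (y * e b)) • (projL 𝒜 (e i)).pr 0 v = w := by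
      refine Subtype.ext ?_
      change (w : A) * (y * e b) * ((projL 𝒜 (e i)).pr 0 v : A) = w
      rw [projL_pr, mul_assoc, mul_assoc, hyx]
      obtain ⟨_, w, rfl⟩ := w
      change w * (e i : A) * e i = w * e i
      rw [mul_assoc, h.idem]
    rwa [this] at hmem

/-- A high power of the graded radical has no nonzero homogeneous elements of a given degree. -/
theorem exists_pow_disjoint (l : ℤ) :
    ∃ r : ℕ, ∀ a ∈ gradedJacobson 𝒜 ^ (r + 1), a ∈ 𝒜 l → a = 0 := by
  have : @FiniteDimensional k (𝒜 0) _ _ Algebra.toModule := h.finite_zero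
  obtain ⟨N, I, h₀, hN, hI⟩ := exists_filtration_jacobson k (𝒜 0)
  -- The degree `0` part dies by nilpotency of the radical of `𝒜 0`, so this power lives in degrees
  -- at least `1`, and its `m`-th power in degrees at least `m`.
  have h1 : ∀ a ∈ gradedJacobson 𝒜 ^ (N + 1), ∀ t < 1, GradedRing.proj 𝒜 t a = 0 := by
    intro a ha t ht
    rcases lt_or_eq_of_le (show t ≤ 0 by lia) with ht | rfl
    · exact h.nGraded.eq_zero ht (proj_mem 𝒜 t a)
    · have := decompose_zero_mem_of_mem_pow h.nGraded h₀ hI ha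
      rw [hN] at this
      exact congrArg Subtype.val ((Submodule.mem_bot _).1 this)
  have h2 : ∀ m : ℕ, ∀ a ∈ gradedJacobson 𝒜 ^ ((N + 1) * m), ∀ t < (m : ℤ),
      GradedRing.proj 𝒜 t a = 0 := by
    intro m
    induction m with
    | zero =>
      intro a _ t ht
      exact h.nGraded.eq_zero (by simpa using ht) (proj_mem 𝒜 t a)
    | succ m ih =>
      intro a ha t ht
      rw [mul_add, mul_one, pow_add] at ha
      induction ha using Submodule.mul_induction_on' with
      | mem_mul_mem b hb c hc =>
        obtain ⟨s, hs⟩ := sum_proj 𝒜 b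
        rw [hs, Finset.sum_mul, map_sum]
        refine Finset.sum_eq_zero fun i _ => ?_
        rw [proj_of_mem_mul 𝒜 (proj_mem 𝒜 i b)]
        by_cases hi : i < m
        · rw [ih b hb i hi, zero_mul]
        · rw [h1 c hc (t - i) (by push_cast at ht; lia), mul_zero]
      | add x hx y hy h₁ h₂ => rw [map_add, h₁, h₂, add_zero]
  -- The exponent `r + 1` is `(N + 1) * (l.toNat + 1)`, large enough to force degrees above `l`.
  refine ⟨N * l.toNat + N + l.toNat, fun a ha hal => ?_⟩
  rw [show N * l.toNat + N + l.toNat + 1 = (N + 1) * (l.toNat + 1) by ring] at ha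
  have := h2 _ a ha l (by push_cast; lia)
  rwa [proj_of_mem 𝒜 hal, if_pos rfl] at this

end IsNGradedBasic

end GradedJacobson

/-! ### The left action on Ext and homogeneous generators -/

section ExtAction

open Abelian

variable {k : Type v} {A : Type u} [Field k] [Ring A] [Algebra k A]
variable {𝒜 : ℤ → Submodule k A} [GradedAlgebra 𝒜]

/-- The action of a homogeneous element `a` of `A` on `Ext(M, A)`. -/
noncomputable def extAct {M : GrRMod 𝒜} {d : ℕ} {r : ℤ} (y : Ext M ((regR 𝒜).shift r) d) (m : ℤ)
    (a : A) (ha : a ∈ 𝒜 (m - r)) : Ext M ((regR 𝒜).shift m) d :=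
  y.comp (Ext.mk₀ (lmulShift r m a ha)) (add_zero d)

variable {M : GrRMod 𝒜} {d : ℕ} {r m : ℤ}

theorem extAct_add (y : Ext M ((regR 𝒜).shift r) d) {a b : A} (ha : a ∈ 𝒜 (m - r))
    (hb : b ∈ 𝒜 (m - r)) :
    extAct y m (a + b) (add_mem ha hb) = extAct y m a ha + extAct y m b hb := by
  have : lmulShift r m (a + b) (add_mem ha hb) = lmulShift r m a ha + lmulShift r m b hb :=
    GrMod.hom_ext fun x => add_mul a b x
  rw [extAct, this, Ext.mk₀_add, Ext.comp_add]
  rfl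

theorem extAct_zero (y : Ext M ((regR 𝒜).shift r) d) {a : A} (ha : a ∈ 𝒜 (m - r)) (h0 : a = 0) :
    extAct y m a ha = 0 := by
  subst h0
  have : lmulShift r m (0 : A) ha = 0 := GrMod.hom_ext fun x => zero_mul x
  rw [extAct, this, Ext.mk₀_zero, Ext.comp_zero]

theorem zero_extAct {a : A} (ha : a ∈ 𝒜 (m - r)) :
    extAct (0 : Ext M ((regR 𝒜).shift r) d) m a ha = 0 := by
  rw [extAct, Ext.zero_comp]

theorem extAct_extAct (y : Ext M ((regR 𝒜).shift r) d) {a : A} (ha : a ∈ 𝒜 (m - r)) {l : ℤ}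
    {b : A} (hb : b ∈ 𝒜 (l - m)) (hba : b * a ∈ 𝒜 (l - r)) :
    extAct (extAct y m a ha) l b hb = extAct y l (b * a) hba := by
  have : lmulShift r l (b * a) hba = lmulShift r m a ha ≫ lmulShift m l b hb :=
    GrMod.hom_ext fun x => mul_assoc b a x
  rw [extAct, extAct, extAct, this, ← Ext.mk₀_comp_mk₀]
  exact Ext.comp_assoc_of_third_deg_zero _ _ _ _

theorem extAct_one (y : Ext M ((regR 𝒜).shift r) d) {a : A} (ha : a ∈ 𝒜 (r - r)) (h1 : a = 1) :
    extAct y r a ha = y := by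
  subst h1
  have : lmulShift r r (1 : A) ha = 𝟙 _ := GrMod.hom_ext fun x => one_mul x
  rw [extAct, this, Ext.comp_mk₀_id]

theorem mk₀_comp_extAct {N : GrRMod 𝒜} (f : N ⟶ M) (y : Ext M ((regR 𝒜).shift r) d) {a : A}
    (ha : a ∈ 𝒜 (m - r)) : (Ext.mk₀ f).comp (extAct y m a ha) (zero_add d) =
      extAct ((Ext.mk₀ f).comp y (zero_add d)) m a ha :=
  (Ext.comp_assoc_of_third_deg_zero _ _ _ _).symm

/-- The action on a given element, as an additive map. -/
noncomputable def extActHom (y : Ext M ((regR 𝒜).shift r) d) (m : ℤ) :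
    𝒜 (m - r) →+ Ext M ((regR 𝒜).shift m) d :=
  AddMonoidHom.mk' (fun a => extAct y m a a.2) fun a b => extAct_add y a.2 b.2

theorem extAct_sub (y : Ext M ((regR 𝒜).shift r) d) {a b : A} (ha : a ∈ 𝒜 (m - r))
    (hb : b ∈ 𝒜 (m - r)) :
    extAct y m (a - b) (sub_mem ha hb) = extAct y m a ha - extAct y m b hb := by
  rw [eq_sub_iff_add_eq, ← extAct_add]
  congr 1
  exact sub_add_cancel a b

theorem extAct_sum {n : ℕ} (y : Ext M ((regR 𝒜).shift r) d) {a : Fin n → A}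
    (ha : ∀ j, a j ∈ 𝒜 (m - r)) :
    extAct y m (∑ j, a j) (sum_mem fun j _ => ha j) = ∑ j, extAct y m (a j) (ha j) := by
  have h := map_sum (extActHom y m) (fun j => (⟨a j, ha j⟩ : 𝒜 (m - r))) Finset.univ
  refine Eq.trans ?_ h
  congr 1
  simp

/-- `Ext^d(M, A)` is generated by the homogeneous element `z`, whose annihilator consists of the
elements `a` with `aE ∈ J`. -/
structure IsExtGenerator (J : Submodule k A) (E : A) (z : Ext M ((regR 𝒜).shift r) d) : Prop where
  gen : ∀ m (x : Ext M ((regR 𝒜).shift m) d), ∃ a, ∃ ha : a ∈ 𝒜 (m - r), x = extAct z m a ha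
  ann : ∀ m a (ha : a ∈ 𝒜 (m - r)), extAct z m a ha = 0 ↔ a * E ∈ J

theorem IsExtGenerator.of_iso {J : Submodule k A} {E : A} {z : Ext M ((regR 𝒜).shift r) d}
    (hz : IsExtGenerator J E z) {N : GrRMod 𝒜} (f : N ≅ M) :
    IsExtGenerator J E ((Ext.mk₀ f.hom).comp z (zero_add d)) where
  gen m x := by
    obtain ⟨a, ha, hx⟩ := hz.gen m ((Ext.mk₀ f.inv).comp x (zero_add d))
    refine ⟨a, ha, ?_⟩
    rw [← mk₀_comp_extAct, ← hx, Ext.mk₀_comp_mk₀_assoc, f.hom_inv_id, Ext.mk₀_id_comp]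
  ann m a ha := by
    rw [← hz.ann m a ha, ← mk₀_comp_extAct]
    constructor
    · intro h
      have := congrArg (fun w => (Ext.mk₀ f.inv).comp w (zero_add d)) h
      simpa only [Ext.mk₀_comp_mk₀_assoc, f.inv_hom_id, Ext.mk₀_id_comp, Ext.comp_zero] using this
    · intro h
      rw [h, Ext.comp_zero]

theorem extAct_lmulHom (x : Ext M ((regR 𝒜).shift r) d) (a : 𝒜 m)
    (ha : (a : A) ∈ 𝒜 (r + m - r)) :
    x.comp (Ext.mk₀ (lmulHom 𝒜 r m a)) (add_zero d) = extAct x (r + m) a ha := rfl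

variable {n : ℕ} {e : Fin n → 𝒜 0}

/-- The class of `e_b` generates the top of `A e_b` and is annihilated exactly by the `a` with `a
e_b` in the radical; in the shift by `q` it has degree `-q`. -/
theorem IsNGradedBasic.exists_isExtGenerator (h : IsNGradedBasic 𝒜 e) {b : Fin n} {q : ℤ}
    (hM : GradedExtIso 𝒜 M d ((simpleL 𝒜 (e b)).shift q)) :
    ∃ z : Ext M ((regR 𝒜).shift (-q)) d, IsExtGenerator (gradedJacobson 𝒜) (e b : A) z := by
  obtain ⟨φ, hφ⟩ := hM
  let g : projL 𝒜 (e b) := ⟨e b, 1, one_mul _⟩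
  let π : projL 𝒜 (e b) ⟶ simpleL 𝒜 (e b) := GrMod.quotπ _ _ (GrMod.isHomog_rad _)
  have hg : π.lin g ∈ ((simpleL 𝒜 (e b)).shift q).deg (-q) := by
    refine π.map_deg (q + -q) g ?_
    rw [add_neg_cancel]
    exact (e b).2
  have key : ∀ m a (ha : a ∈ 𝒜 (m - -q)),
      (φ m (extAct ((φ (-q)).symm ⟨π.lin g, hg⟩) m a ha) : simpleL 𝒜 (e b)) = a • π.lin g := by
    intro m a ha
    obtain ⟨t, rfl⟩ : ∃ t, m = -q + t := ⟨m + q, by ring⟩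
    have ha' : a ∈ 𝒜 t := by rwa [show -q + t - -q = t by ring] at ha
    have := hφ (-q) t ⟨a, ha'⟩ ((φ (-q)).symm ⟨π.lin g, hg⟩)
    rw [AddEquiv.apply_symm_apply] at this
    exact this
  refine ⟨(φ (-q)).symm ⟨π.lin g, hg⟩, fun m x => ?_, fun m a ha => ?_⟩
  · obtain ⟨v, hv, hvx⟩ : ∃ v ∈ (projL 𝒜 (e b)).deg (q + m), π.lin v = φ m x := (φ m x).2
    have hvm : (v : A) ∈ 𝒜 (m - -q) := by
      rw [show m - -q = q + m by ring]
      exact hv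
    refine ⟨v, hvm, (φ m).injective (Subtype.ext ?_)⟩
    rw [key, ← hvx, ← map_smul]
    congr 1
    refine Subtype.ext ?_
    obtain ⟨_, w, rfl⟩ := v
    change w * (e b : A) = w * e b * e b
    rw [mul_assoc, h.idem]
  · rw [← EmbeddingLike.map_eq_zero_iff (f := φ m), ← Subtype.val_inj, key, ← map_smul]
    refine (Submodule.Quotient.mk_eq_zero _).trans ?_
    exact h.rad_projL b (a • g)

/-- An `Ext` class is sent to the action of any of its coefficients on the class of `e_b`. A
coefficient is unique only up to the annihilator, which is the same on both sides; hence additivity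
and bijectivity. -/
theorem IsNGradedBasic.gradedExtIso (h : IsNGradedBasic 𝒜 e) {b : Fin n} {q : ℤ}
    {z : Ext M ((regR 𝒜).shift (-q)) d} (hz : IsExtGenerator (gradedJacobson 𝒜) (e b : A) z) :
    GradedExtIso 𝒜 M d ((simpleL 𝒜 (e b)).shift q) := by
  choose c hc hcx using hz.gen
  let g : projL 𝒜 (e b) := ⟨e b, 1, one_mul _⟩
  let π : projL 𝒜 (e b) ⟶ simpleL 𝒜 (e b) := GrMod.quotπ _ _ (GrMod.isHomog_rad _)
  have hπ : ∀ a : A, a • π.lin g = 0 ↔ a * (e b : A) ∈ gradedJacobson 𝒜 := fun a => by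
    rw [← map_smul]
    exact (Submodule.Quotient.mk_eq_zero _).trans (h.rad_projL b (a • g))
  have key : ∀ m a (ha : a ∈ 𝒜 (m - -q)) a' (ha' : a' ∈ 𝒜 (m - -q)),
      extAct z m a ha = extAct z m a' ha' ↔ a • π.lin g = a' • π.lin g := by
    intro m a ha a' ha'
    rw [← sub_eq_zero, ← extAct_sub, hz.ann, ← hπ, sub_smul, sub_eq_zero]
  have hdeg : ∀ m a, a ∈ 𝒜 (m - -q) → a • π.lin g ∈ ((simpleL 𝒜 (e b)).shift q).deg m := by
    intro m a ha
    have h0 : g ∈ (projL 𝒜 (e b)).deg 0 := (e b).2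
    have := (simpleL 𝒜 (e b)).smul_mem ha (π.map_deg 0 g h0)
    rwa [show m - -q + 0 = q + m by ring] at this
  have hadd : ∀ m (x y : Ext M ((regR 𝒜).shift m) d),
      c m (x + y) • π.lin g = c m x • π.lin g + c m y • π.lin g := by
    intro m x y
    rw [← add_smul, ← key m _ (hc m _) _ (add_mem (hc m x) (hc m y)), ← hcx,
      extAct_add z (hc m x) (hc m y), ← hcx, ← hcx]
  refine ⟨fun m => AddEquiv.ofBijective (AddMonoidHom.mk'
    (fun x => (⟨c m x • π.lin g, hdeg m _ (hc m x)⟩ : ((simpleL 𝒜 (e b)).shift q).deg m))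
    fun x y => Subtype.ext (hadd m x y)) ⟨fun x y hxy => ?_, ?_⟩, fun m t a x => ?_⟩
  · rw [hcx m x, hcx m y, key]
    exact congrArg Subtype.val hxy
  · rintro ⟨_, v, hv, rfl⟩
    have hvm : (v : A) ∈ 𝒜 (m - -q) := by
      rw [show m - -q = q + m by ring]
      exact hv
    refine ⟨extAct z m v hvm, Subtype.ext ?_⟩
    change c m _ • π.lin g = π.lin v
    rw [(key m _ (hc m _) v hvm).1 (hcx m _).symm, ← map_smul]
    congr 1
    refine Subtype.ext ?_
    obtain ⟨_, w, rfl⟩ := v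
    change w * (e b : A) * e b = w * e b
    rw [mul_assoc, h.idem]
  · have ha : (a : A) ∈ 𝒜 (m + t - m) := by
      rw [add_sub_cancel_left]
      exact a.2
    have hac : (a : A) * c m x ∈ 𝒜 (m + t - -q) := by
      have := SetLike.mul_mem_graded a.2 (hc m x)
      rwa [show t + (m - -q) = m + t - -q by ring] at this
    change c (m + t) _ • π.lin g = (a : A) • c m x • π.lin g
    rw [← mul_smul, ← key _ _ (hc _ _) _ hac, ← hcx, extAct_lmulHom x a ha,
      ← extAct_extAct z (hc m x) ha hac, ← hcx]

end ExtAction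

/-! ### Regradings of an algebra by shifts of Peirce components -/

theorem GrMod.isInternal_of_proj_of_iSup {M : Type*} [AddCommGroup M] (deg : ℤ → AddSubgroup M)
    (pr : ℤ → M →+ M) (h₁ : ∀ i x, x ∈ deg i → pr i x = x)
    (h₂ : ∀ i j x, x ∈ deg i → j ≠ i → pr j x = 0) (h₃ : ∀ x : M, x ∈ ⨆ i, deg i) :
    DirectSum.IsInternal deg := by
  classical
  refine GrMod.isInternal_of_proj deg pr h₁ h₂ fun x => ?_
  have hle : ⨆ i, deg i ≤ (DirectSum.coeAddMonoidHom deg).range :=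
    iSup_le fun i x hx => ⟨DirectSum.of (fun i => deg i) i ⟨x, hx⟩,
      DirectSum.coeAddMonoidHom_of _ _ _⟩
  obtain ⟨w, rfl⟩ := hle (h₃ x)
  exact ⟨DFinsupp.support w, fun i => w i, fun i => (w i).2,
    DirectSum.coeAddMonoidHom_eq_dfinsuppSum _ _⟩

theorem GrMod.isIso_of_bijective {k : Type v} {R : Type u} [Field k] [Ring R] [Algebra k R]
    {ℬ : ℤ → Submodule k R} {M N : GrMod ℬ} (f : M ⟶ N) (hf : Function.Bijective f.lin) :
    IsIso f := by
  have := GrMod.mono_of_injective f hf.1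
  have := GrMod.epi_of_surjective f hf.2
  exact isIso_of_mono_of_epi f

section Regrading

variable {k : Type v} {A : Type u} [Field k] [Ring A] [Algebra k A]

/-- The grading `ℬ` of `A` arises from `𝒜` by shifting the degrees of the Peirce components
`e_j A e_i` by `s_i - s_j`. -/
structure IsRegrading (𝒜 ℬ : ℤ → Submodule k A) {n : ℕ} (e : Fin n → A) (s : Fin n → ℤ) :
    Prop where
  complete : CompleteOrthogonalIdempotents e
  mem_left : ∀ i, e i ∈ 𝒜 0
  mem_iff : ∀ m a, a ∈ ℬ m ↔ ∀ j i, e j * a * e i ∈ 𝒜 (m + s j - s i)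

section Peirce

variable {n : ℕ} {e : Fin n → A} (he : CompleteOrthogonalIdempotents e)
include he

theorem CompleteOrthogonalIdempotents.sum_mul_left (a : A) : ∑ j, e j * a = a := by
  rw [← Finset.sum_mul, he.complete, one_mul]

theorem CompleteOrthogonalIdempotents.sum_mul_right (a : A) : ∑ j, a * e j = a := by
  rw [← Finset.mul_sum, he.complete, mul_one]

theorem CompleteOrthogonalIdempotents.idem_mul (i : Fin n) : e i * e i = e i := he.idem i

/-- If `e_j a e_i` lies in `P j i`, then each of its Peirce components lies in the corresponding
`P j' i'`. -/
theorem CompleteOrthogonalIdempotents.peirce_mem {S : Type*} [SetLike S A] [AddSubmonoidClass S A]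
    {P : Fin n → Fin n → S} {j i : Fin n} {a : A} (ha : e j * a * e i ∈ P j i) (j' i' : Fin n) :
    e j' * (e j * a * e i) * e i' ∈ P j' i' := by
  by_cases hj : j' = j
  · subst hj
    by_cases hi : i = i'
    · subst hi
      have : e j' * (e j' * a * e i) * e i = e j' * e j' * a * (e i * e i) := by noncomm_ring
      rwa [this, he.idem_mul, he.idem_mul]
    · have : e j' * (e j' * a * e i) * e i' = e j' * (e j' * a) * (e i * e i') := by noncomm_ring
      rw [this, he.ortho hi, mul_zero]
      exact zero_mem _
  · have : e j' * (e j * a * e i) * e i' = e j' * e j * (a * e i * e i') := by noncomm_ring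
    rw [this, he.ortho hj, zero_mul]
    exact zero_mem _

theorem CompleteOrthogonalIdempotents.sum_sum (a : A) : ∑ j, ∑ i, e j * a * e i = a := by
  simp only [he.sum_mul_right, he.sum_mul_left]

end Peirce

namespace IsRegrading

variable {𝒜 ℬ : ℤ → Submodule k A} {n : ℕ} {e : Fin n → A} {s : Fin n → ℤ}

theorem peirce_mem (h : IsRegrading 𝒜 ℬ e s) {m : ℤ} {j i : Fin n} {a : A}
    (ha : e j * a * e i ∈ 𝒜 (m + s j - s i)) : e j * a * e i ∈ ℬ m :=
  (h.mem_iff _ _).2 (h.complete.peirce_mem (P := fun j i => 𝒜 (m + s j - s i)) ha)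

variable [GradedAlgebra 𝒜]

theorem peirce_mem_left (h : IsRegrading 𝒜 ℬ e s) {m : ℤ} {a : A} (ha : a ∈ 𝒜 m) (j i : Fin n) :
    e j * a * e i ∈ 𝒜 m := by
  have := SetLike.mul_mem_graded (SetLike.mul_mem_graded (h.mem_left j) ha) (h.mem_left i)
  rwa [zero_add, add_zero] at this

omit [GradedAlgebra 𝒜] in
theorem mem_right (h : IsRegrading 𝒜 ℬ e s) (i : Fin n) : e i ∈ ℬ 0 := by
  have h0 : e i * 1 * e i = e i := by rw [mul_one, h.complete.idem_mul]
  rw [← h0]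
  refine h.peirce_mem ?_
  rw [h0, zero_add, sub_self]
  exact h.mem_left i

/-- Makes regrading reversible, which supplies the preimages for essential surjectivity of the
module functor. -/
theorem symm (h : IsRegrading 𝒜 ℬ e s) : IsRegrading ℬ 𝒜 e (fun i => -s i) where
  complete := h.complete
  mem_left := h.mem_right
  mem_iff m a := by
    constructor
    · intro ha j i
      refine h.peirce_mem ?_
      rw [show m + -s j - -s i + s j - s i = m by ring]
      exact h.peirce_mem_left ha j i
    · intro ha
      rw [← h.complete.sum_sum a]
      refine sum_mem fun j _ => sum_mem fun i _ => ?_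
      have h1 := (h.mem_iff _ _).1 (ha j i) j i
      rw [show m + -s j - -s i + s j - s i = m by ring] at h1
      have : e j * (e j * a * e i) * e i = e j * e j * a * (e i * e i) := by noncomm_ring
      rwa [this, h.complete.idem_mul, h.complete.idem_mul] at h1

end IsRegrading

/-- The grading obtained from `𝒜` by shifting the degrees of the Peirce components. -/
def regraded (𝒜 : ℤ → Submodule k A) {n : ℕ} (e : Fin n → A) (s : Fin n → ℤ) (m : ℤ) :
    Submodule k A where
  carrier := {a | ∀ j i, e j * a * e i ∈ 𝒜 (m + s j - s i)}
  add_mem' {a b} ha hb j i := by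
    rw [mul_add, add_mul]
    exact add_mem (ha j i) (hb j i)
  zero_mem' j i := by
    rw [mul_zero, zero_mul]
    exact zero_mem _
  smul_mem' c a ha j i := by
    rw [mul_smul_comm, smul_mul_assoc]
    exact Submodule.smul_mem _ _ (ha j i)

theorem isRegrading_regraded {𝒜 : ℤ → Submodule k A} {n : ℕ} {e : Fin n → A}
    (s : Fin n → ℤ) (he : CompleteOrthogonalIdempotents e) (he0 : ∀ i, e i ∈ 𝒜 0) :
    IsRegrading 𝒜 (regraded 𝒜 e s) e s := ⟨he, he0, fun _ _ => Iff.rfl⟩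

theorem IsRegrading.isInternal {𝒜 ℬ : ℤ → Submodule k A} [GradedAlgebra 𝒜] {n : ℕ}
    {e : Fin n → A} {s : Fin n → ℤ} (h : IsRegrading 𝒜 ℬ e s) :
    DirectSum.IsInternal fun i => (ℬ i).toAddSubgroup := by
  refine GrMod.isInternal_of_proj_of_iSup _ (fun m => ∑ j, ∑ i,
    ((GradedRing.proj 𝒜 (m + s j - s i)).comp
      ((AddMonoidHom.mulRight (e i)).comp (AddMonoidHom.mulLeft (e j))))) ?_ ?_ ?_
  · intro m a ha
    simp only [AddMonoidHom.finsetSum_apply]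
    refine Eq.trans (Finset.sum_congr rfl fun j _ => Finset.sum_congr rfl fun i _ => ?_)
      (h.complete.sum_sum a)
    exact DirectSum.decompose_of_mem_same 𝒜 ((h.mem_iff m a).1 ha j i)
  · intro m m' a ha hm
    simp only [AddMonoidHom.finsetSum_apply]
    refine Finset.sum_eq_zero fun j _ => Finset.sum_eq_zero fun i _ => ?_
    exact DirectSum.decompose_of_mem_ne 𝒜 ((h.mem_iff m a).1 ha j i) (by lia)
  · intro a
    rw [← h.complete.sum_sum a]
    refine sum_mem fun j _ => sum_mem fun i _ => ?_
    obtain ⟨S, hS⟩ := sum_proj 𝒜 a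
    rw [hS, Finset.mul_sum, Finset.sum_mul]
    refine sum_mem fun t _ => AddSubgroup.mem_iSup_of_mem (t - s j + s i) (h.peirce_mem ?_)
    rw [show t - s j + s i + s j - s i = t by ring]
    exact h.peirce_mem_left (proj_mem 𝒜 t a) j i

/-- The regraded algebra. -/
theorem IsRegrading.nonempty_gradedAlgebra {𝒜 ℬ : ℤ → Submodule k A} [GradedAlgebra 𝒜] {n : ℕ}
    {e : Fin n → A} {s : Fin n → ℤ} (h : IsRegrading 𝒜 ℬ e s) : Nonempty (GradedAlgebra ℬ) := by
  have hint : DirectSum.IsInternal ℬ := h.isInternal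
  have hdec := hint.chooseDecomposition
  refine ⟨{ hdec with one_mem := ?_, mul_mem := ?_ }⟩
  · rw [← h.complete.complete]
    exact sum_mem fun i _ => h.mem_right i
  · intro m m' a b ha hb
    refine (h.mem_iff _ _).2 fun j i => ?_
    -- Insert `1 = ∑ e_l` between the factors; in each summand the shifts by `s l` cancel.
    have : e j * (a * b) * e i = ∑ l, e j * a * e l * (e l * b * e i) := by
      have h1 : ∀ l, e j * a * e l * (e l * b * e i) = e j * a * (e l * (b * e i)) := fun l => by
        calc _ = e j * a * (e l * e l) * b * e i := by noncomm_ring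
          _ = _ := by rw [h.complete.idem_mul]; noncomm_ring
      simp only [h1]
      rw [← Finset.mul_sum, h.complete.sum_mul_left]
      noncomm_ring
    rw [this]
    refine sum_mem fun l _ => ?_
    have := SetLike.mul_mem_graded ((h.mem_iff _ _).1 ha j l) ((h.mem_iff _ _).1 hb l i)
    rwa [show m + s j - s l + (m' + s l - s i) = m + m' + s j - s i by ring] at this

end Regrading

/-! ### Regrading modules as a graded Morita equivalence -/

section RegradingFunctor

variable {k : Type v} {A : Type u} [Field k] [Ring A] [Algebra k A]
variable {𝒜 ℬ : ℤ → Submodule k A} {n : ℕ} {e : Fin n → A} {s : Fin n → ℤ}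

theorem CompleteOrthogonalIdempotents.sum_op_smul (he : CompleteOrthogonalIdempotents e)
    {M : Type*} [AddCommGroup M] [Module Aᵐᵒᵖ M] (x : M) : ∑ i, op (e i) • x = x := by
  rw [← Finset.sum_smul, ← Finset.op_sum, he.complete, op_one, one_smul]

namespace IsRegrading

variable [GradedAlgebra 𝒜] (h : IsRegrading 𝒜 ℬ e s)
include h

omit [GradedAlgebra 𝒜] in
theorem op_smul_mem {M : GrRMod ℬ} {t : ℤ} {x : M} (hx : x ∈ M.deg t) (i : Fin n) :
    op (e i) • x ∈ M.deg t := by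
  have := M.smul_mem (r := op (e i)) (h.mem_right i) hx
  rwa [zero_add] at this

omit [GradedAlgebra 𝒜] in
theorem op_smul_op_smul_mem {M : GrRMod ℬ} {f : Fin n → ℤ} {i : Fin n} {x : M}
    (hx : op (e i) • x ∈ M.deg (f i)) (j : Fin n) :
    op (e j) • op (e i) • x ∈ M.deg (f j) := by
  rw [← mul_smul, ← op_mul]
  by_cases hij : i = j
  · subst hij
    rwa [h.complete.idem_mul]
  · rw [h.complete.ortho hij, MulOpposite.op_zero, zero_smul]
    exact zero_mem _

/-- A graded module for the grading `ℬ`, regraded for the grading `𝒜`. -/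
@[reducible] def regradeObj (M : GrRMod ℬ) : GrRMod 𝒜 where
  carrier := M
  deg t :=
    { carrier := {x | ∀ i, op (e i) • x ∈ M.deg (t + s i)}
      add_mem' := fun {x y} hx hy i => by
        rw [smul_add]
        exact add_mem (hx i) (hy i)
      zero_mem' := fun i => by
        rw [smul_zero]
        exact zero_mem _
      neg_mem' := fun {x} hx i => by
        rw [smul_neg]
        exact neg_mem (hx i) }
  isInternal := by
    have hpr : ∀ (t : ℤ) (x : M), (∑ i, (DistribSMul.toAddMonoidHom M (op (e i))).comp
        (M.pr (t + s i))) x = ∑ i, M.pr (t + s i) (op (e i) • x) := by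
      intro t x
      rw [AddMonoidHom.finsetSum_apply]
      refine Finset.sum_congr rfl fun i _ => ?_
      have := GrMod.pr_smul M (r := op (e i)) (h.mem_right i) (t + s i) x
      rw [zero_add] at this
      exact this.symm
    refine GrMod.isInternal_of_proj_of_iSup _ (fun t => ∑ i,
      (DistribSMul.toAddMonoidHom M (op (e i))).comp (M.pr (t + s i))) ?_ ?_ ?_
    · intro t x hx
      rw [hpr]
      exact (Finset.sum_congr rfl fun i _ => M.pr_of_mem (hx i)).trans
        (h.complete.sum_op_smul x)
    · intro t t' x hx ht
      rw [hpr]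
      exact Finset.sum_eq_zero fun i _ => M.pr_of_mem_ne (hx i) (by lia)
    · intro x
      rw [← h.complete.sum_op_smul x]
      refine sum_mem fun i _ => ?_
      obtain ⟨S, hS⟩ := M.exists_sum_pr x
      rw [hS, Finset.smul_sum]
      refine sum_mem fun t _ => AddSubgroup.mem_iSup_of_mem (t - s i) fun j => ?_
      refine h.op_smul_op_smul_mem (f := fun i' => t - s i + s i') ?_ j
      rw [sub_add_cancel]
      exact h.op_smul_mem (M.pr_mem t x) i
  smul_mem := by
    intro m t a x ha hx i
    -- As for the product in the algebra, splitting through the vertices `j` makes the intermediate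
    -- shifts cancel.
    have h1 : op (e i) • a • x = ∑ j, op (e j * a.unop * e i) • op (e j) • x := by
      have h2 : ∀ j, op (e j * a.unop * e i) • op (e j) • x = op (e j * (a.unop * e i)) • x :=
        fun j => by
          rw [← mul_smul, ← op_mul, ← mul_assoc, ← mul_assoc, h.complete.idem_mul, mul_assoc]
      rw [Finset.sum_congr rfl fun j _ => h2 j, ← Finset.sum_smul, ← Finset.op_sum,
        h.complete.sum_mul_left, op_mul, mul_smul]
      rfl
    rw [h1]
    refine sum_mem fun j _ => ?_
    have h3 : e j * a.unop * e i ∈ ℬ (m - s j + s i) := by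
      refine h.peirce_mem ?_
      rw [show m - s j + s i + s j - s i = m by ring]
      exact h.peirce_mem_left ha j i
    have := M.smul_mem (r := op (e j * a.unop * e i)) h3 (hx j)
    rwa [show m - s j + s i + (t + s j) = m + t + s i by ring] at this

/-- The regrading functor. -/
@[reducible] def functor : GrRMod ℬ ⥤ GrRMod 𝒜 where
  obj M := h.regradeObj M
  map f := ⟨f.lin, fun t x hx i => by
    have := f.map_deg _ _ (hx i)
    rwa [map_smul] at this⟩

instance : h.functor.Additive where

instance [SetLike.GradedOne ℬ] : h.functor.Linear k where

instance : h.functor.Faithful where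
  map_injective hfg := GrMod.hom_ext fun x => 
    congrArg (fun f : h.functor.obj _ ⟶ h.functor.obj _ => GrMod.Hom.lin f x) hfg

theorem mem_regradeObj_deg {M : GrRMod ℬ} {t : ℤ} {x : M} (hx : x ∈ M.deg t) (i : Fin n) :
    op (e i) • x ∈ (h.regradeObj M).deg (t - s i) := fun j => by
  refine h.op_smul_op_smul_mem (f := fun i' => t - s i + s i') ?_ j
  rw [sub_add_cancel]
  exact h.op_smul_mem hx i

instance : h.functor.Full where
  map_surjective {M N} f := ⟨⟨f.lin, fun t x hx => by
    rw [← h.complete.sum_op_smul (f.lin x)]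
    refine sum_mem fun i _ => ?_
    have h1 := f.map_deg _ _ (h.mem_regradeObj_deg hx i) i
    rw [map_smul, ← mul_smul, ← op_mul, h.complete.idem_mul, sub_add_cancel] at h1
    exact h1⟩, rfl⟩

variable [GradedAlgebra ℬ]

/-- Regrading back gives the original module. -/
def regradeSymmHom (M : GrRMod 𝒜) : h.functor.obj (h.symm.functor.obj M) ⟶ M where
  lin := LinearMap.id
  map_deg t x hx := by
    change x ∈ M.deg t
    rw [← h.complete.sum_op_smul x]
    refine sum_mem fun i _ => ?_
    have h1 := hx i i
    rw [← mul_smul, ← op_mul, h.complete.idem_mul, show t + s i + -s i = t by ring] at h1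
    exact h1

instance : h.functor.EssSurj where
  mem_essImage M := by
    have : IsIso (h.regradeSymmHom M) := GrMod.isIso_of_bijective _ Function.bijective_id
    exact ⟨h.symm.functor.obj M, ⟨asIso (h.regradeSymmHom M)⟩⟩

instance : h.functor.IsEquivalence where

/-- Regrading commutes with the degree shift. -/
def shiftHom (c : ℤ) (M : GrRMod ℬ) :
    h.functor.obj (M.shift c) ⟶ (h.functor.obj M).shift c where
  lin := LinearMap.id
  map_deg t x hx i := by
    have := hx i
    change _ ∈ M.deg _ at this
    change op (e i) • x ∈ M.deg _
    rwa [← add_assoc] at this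

/-- Regrading is a graded Morita equivalence. -/
theorem gradedMoritaEquivalent : GradedMoritaEquivalent ℬ 𝒜 := by
  have : ∀ M, IsIso (h.shiftHom 1 M) := fun M =>
    GrMod.isIso_of_bijective _ Function.bijective_id
  exact ⟨h.functor.asEquivalence, inferInstanceAs h.functor.Additive,
    inferInstanceAs (h.functor.Linear k),
    ⟨NatIso.ofComponents (fun M => @asIso _ _ _ _ (h.shiftHom 1 M) (this M)) fun f => GrMod.hom_ext fun x => rfl⟩⟩

end IsRegrading

end RegradingFunctor

/-! ### Ext groups under regrading -/

section RegradingExt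

open Abelian

variable {k : Type v} {A : Type u} [Field k] [Ring A] [Algebra k A]
variable {𝒜 ℬ : ℤ → Submodule k A} [GradedAlgebra 𝒜] [GradedAlgebra ℬ] {n : ℕ} {e : Fin n → A}
  {s : Fin n → ℤ}

namespace IsRegrading

variable (h : IsRegrading 𝒜 ℬ e s)
include h

/-- The inclusion of a summand of the regraded algebra. -/
def inj (m : ℤ) (j : Fin n) :
    (regR 𝒜).shift (m + s j) ⟶ h.functor.obj ((regR ℬ).shift m) where
  lin := lmulLin (e j)
  map_deg t x hx i := by
    change e j * x * e i ∈ ℬ (m + (t + s i))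
    refine h.peirce_mem ?_
    rw [show m + (t + s i) + s j - s i = m + s j + t by ring]
    exact h.peirce_mem_left (show x ∈ 𝒜 (m + s j + t) from hx) j i

/-- The projection to a summand of the regraded algebra. -/
def proj (m : ℤ) (j : Fin n) :
    h.functor.obj ((regR ℬ).shift m) ⟶ (regR 𝒜).shift (m + s j) where
  lin := lmulLin (e j)
  map_deg t x hx := by
    change e j * x ∈ 𝒜 (m + s j + t)
    rw [← h.complete.sum_mul_right (e j * x)]
    refine sum_mem fun i _ => ?_
    have h1 : x * e i ∈ ℬ (m + (t + s i)) := hx i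
    have h2 := (h.mem_iff _ _).1 h1 j i
    rwa [mul_assoc, mul_assoc, h.complete.idem_mul, ← mul_assoc,
      show m + (t + s i) + s j - s i = m + s j + t by ring] at h2

/-- The regraded free module is in general not a shift of `A`, but the direct sum of the `e_j A(m +
s j)`. So classes with values in it can be tested in shifts of `A`. -/
theorem sum_proj_inj (m : ℤ) : ∑ j, h.proj m j ≫ h.inj m j = 𝟙 _ := by
  refine GrMod.hom_ext fun x => ?_
  have hadd : ∀ S : Finset (Fin n),
      (fun f : h.functor.obj ((regR ℬ).shift m) ⟶ h.functor.obj ((regR ℬ).shift m) =>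
        GrMod.Hom.lin f x) (∑ j ∈ S, h.proj m j ≫ h.inj m j) = ∑ j ∈ S, (e j * x : A) := by
    classical
    intro S
    induction S using Finset.induction_on with
    | empty => rfl
    | insert j S hj ih =>
      rw [Finset.sum_insert hj, Finset.sum_insert hj, ← ih]
      change e j * (e j * x) + _ = e j * x + _
      rw [← mul_assoc, h.complete.idem_mul]
  exact (hadd _).trans (h.complete.sum_mul_left x)

theorem ext_eq_zero_iff {M : GrRMod 𝒜} {m : ℤ} {t : ℕ}
    (w : Ext M (h.functor.obj ((regR ℬ).shift m)) t) :
    w = 0 ↔ ∀ j, w.comp (Ext.mk₀ (h.proj m j)) (add_zero t) = 0 := by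
  constructor
  · rintro rfl j
    rw [Ext.zero_comp]
  · intro hw
    rw [← Ext.comp_mk₀_id w, ← h.sum_proj_inj m, Ext.mk₀_sum, Ext.comp_sum]
    refine Finset.sum_eq_zero fun j _ => ?_
    rw [← Ext.mk₀_comp_mk₀]
    refine (Ext.comp_assoc_of_third_deg_zero _ _ _ _).symm.trans ?_
    rw [hw, Ext.zero_comp]

theorem inj_comp_map_comp_proj {m₀ m : ℤ} {a : A} (ha : a ∈ ℬ (m - m₀)) (b j : Fin n)
    (hba : e j * a * e b ∈ 𝒜 (m + s j - (m₀ + s b))) :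
    h.inj m₀ b ≫ h.functor.map (lmulShift m₀ m a ha) ≫ h.proj m j =
      lmulShift (m₀ + s b) (m + s j) (e j * a * e b) hba :=
  GrMod.hom_ext fun x => by
    change e j * (a * (e b * x)) = e j * a * e b * x
    simp only [mul_assoc]

theorem proj_comp_lmulShift (m : ℤ) (j : Fin n) (hj : e j ∈ 𝒜 (m + s j - (m + s j))) :
    h.proj m j ≫ lmulShift (m + s j) (m + s j) (e j) hj = h.proj m j :=
  GrMod.hom_ext fun x => by
    change e j * (e j * x) = e j * x
    rw [← mul_assoc, h.complete.idem_mul]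

theorem mapExtAddHom_bijective [IsNoetherianRing Aᵐᵒᵖ] (T : GrRMod ℬ)
    (hT : Module.Finite Aᵐᵒᵖ T) (Y : GrRMod ℬ) (t : ℕ) :
    Function.Bijective (h.functor.mapExtAddHom T Y t) := by
  obtain ⟨R, rfl⟩ := exists_freeRes T hT
  exact _root_.mapExtAddHom_bijective h.functor R.syz Y t 0

theorem ext_eq_zero [IsNoetherianRing Aᵐᵒᵖ] (T : GrRMod ℬ) (hT : Module.Finite Aᵐᵒᵖ T) {t : ℕ}
    (h0 : ∀ m, ∀ x : Ext (h.functor.obj T) ((regR 𝒜).shift m) t, x = 0) (m : ℤ)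
    (x : Ext T ((regR ℬ).shift m) t) : x = 0 := by
  refine (h.mapExtAddHom_bijective T hT _ t).1 ?_
  rw [map_zero, h.ext_eq_zero_iff]
  exact fun j => h0 _ _

/-- Transport of generators of `Ext` along the regrading. -/
theorem exists_isExtGenerator [IsNoetherianRing Aᵐᵒᵖ] (T : GrRMod ℬ) (hT : Module.Finite Aᵐᵒᵖ T)
    {J : Submodule k A} (hJ : ∀ (a : A) {x}, x ∈ J → a * x ∈ J) {d : ℕ} {m₀ : ℤ} {b : Fin n}
    {z : Ext (h.functor.obj T) ((regR 𝒜).shift (m₀ + s b)) d} (hz : IsExtGenerator J (e b) z) :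
    ∃ z' : Ext T ((regR ℬ).shift m₀) d, IsExtGenerator J (e b) z' := by
  -- Push `z` along the inclusion of the summand at `b`, then pull the result back through the
  -- isomorphism on `Ext`.
  obtain ⟨z', hz'⟩ := (h.mapExtAddHom_bijective T hT ((regR ℬ).shift m₀) d).2
    (z.comp (Ext.mk₀ (h.inj m₀ b)) (add_zero d))
  rw [Functor.mapExtAddHom_apply] at hz'
  have key : ∀ m a (ha : a ∈ ℬ (m - m₀)) j (hba : e j * a * e b ∈ 𝒜 (m + s j - (m₀ + s b))),
      ((extAct z' m a ha).mapExactFunctor h.functor).comp (Ext.mk₀ (h.proj m j)) (add_zero d) =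
        extAct z (m + s j) (e j * a * e b) hba := by
    intro m a ha j hba
    rw [extAct, extAct, ← h.inj_comp_map_comp_proj ha b j hba, Ext.mapExactFunctor_comp,
      Ext.mapExactFunctor_mk₀, hz', ← Ext.mk₀_comp_mk₀, ← Ext.mk₀_comp_mk₀]
    rw [Ext.comp_assoc_of_third_deg_zero, Ext.comp_assoc_of_third_deg_zero]
  have hba : ∀ {m a}, a ∈ ℬ (m - m₀) → ∀ j, e j * a * e b ∈ 𝒜 (m + s j - (m₀ + s b)) := by
    intro m a ha j
    have := (h.mem_iff _ _).1 ha j b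
    rwa [show m - m₀ + s j - s b = m + s j - (m₀ + s b) by ring] at this
  refine ⟨z', fun m x => ?_, fun m a ha => ?_⟩
  · choose c hc hcx using fun j => hz.gen (m + s j)
      ((x.mapExactFunctor h.functor).comp (Ext.mk₀ (h.proj m j)) (add_zero d))
    have hc' : ∀ j, e j * c j * e b ∈ ℬ (m - m₀) := fun j => by
      refine h.peirce_mem ?_
      rw [show m - m₀ + s j - s b = m + s j - (m₀ + s b) by ring]
      exact h.peirce_mem_left (hc j) j b
    have ha : ∑ j, e j * c j * e b ∈ ℬ (m - m₀) := sum_mem fun j _ => hc' j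
    -- Each component of `x` is a multiple of `z` with its own coefficient `c j`; the Peirce pieces
    -- `e_j c_j e_b` assemble to one coefficient that is homogeneous for the new grading.
    refine ⟨_, ha, (h.mapExtAddHom_bijective T hT _ d).1 ?_⟩
    rw [Functor.mapExtAddHom_apply, Functor.mapExtAddHom_apply, ← sub_eq_zero, h.ext_eq_zero_iff]
    intro j
    rw [sub_eq_add_neg, Ext.add_comp, Ext.neg_comp, ← sub_eq_add_neg, key m _ ha j (hba ha j),
      sub_eq_zero]
    have hjj : e j ∈ 𝒜 (m + s j - (m + s j)) := by
      rw [sub_self]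
      exact h.mem_left j
    have hjc : e j * c j ∈ 𝒜 (m + s j - (m₀ + s b)) := by
      have := SetLike.mul_mem_graded (h.mem_left j) (hc j)
      rwa [zero_add] at this
    have e1 : (x.mapExactFunctor h.functor).comp (Ext.mk₀ (h.proj m j)) (add_zero d) =
        extAct z (m + s j) (e j * c j) hjc := by
      rw [← extAct_extAct z (hc j) hjj, ← hcx, extAct]
      refine Eq.trans ?_ (Ext.comp_assoc_of_third_deg_zero _ _ _ _).symm
      rw [Ext.mk₀_comp_mk₀, h.proj_comp_lmulShift]
    have e2 : e j * (∑ l, e l * c l * e b) * e b = e j * c j * e b := by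
      rw [Finset.mul_sum, Finset.sum_mul, Finset.sum_eq_single j]
      · calc _ = e j * e j * c j * (e b * e b) := by noncomm_ring
          _ = _ := by rw [h.complete.idem_mul, h.complete.idem_mul]
      · intro l _ hl
        calc _ = e j * e l * (c l * e b * e b) := by noncomm_ring
          _ = _ := by rw [h.complete.ortho hl.symm, zero_mul]
      · exact fun hj => absurd (Finset.mem_univ j) hj
    rw [e1, ← sub_eq_zero, ← extAct_sub, hz.ann, e2, sub_mul, mul_assoc _ (e b) (e b),
      h.complete.idem_mul, sub_self]
    exact zero_mem _
  · rw [← map_eq_zero_iff _ (h.mapExtAddHom_bijective T hT _ d).1, Functor.mapExtAddHom_apply,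
      h.ext_eq_zero_iff]
    have h1 : ∀ j, e j * a * e b * e b = e j * (a * e b) := fun j => by
      rw [mul_assoc _ (e b) (e b), h.complete.idem_mul, mul_assoc]
    constructor
    · intro hall
      rw [← h.complete.sum_mul_left (a * e b)]
      refine sum_mem fun j _ => ?_
      have := hall j
      rwa [key m a ha j (hba ha j), hz.ann, h1] at this
    · intro haJ j
      rw [key m a ha j (hba ha j), hz.ann, h1]
      exact hJ _ haJ

end IsRegrading

end RegradingExt

/-! ### Shifts as constant regradings, and regraded simple modules -/

section RegradingSimple

open Abelian

variable {k : Type v} {A : Type u} [Field k] [Ring A] [Algebra k A]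
variable {𝒜 : ℤ → Submodule k A} [GradedAlgebra 𝒜] {n : ℕ}

theorem ext_eq_zero_of_iso {M N : GrRMod 𝒜} (f : M ≅ N) {t : ℕ}
    (h0 : ∀ m, ∀ x : Ext N ((regR 𝒜).shift m) t, x = 0) (m : ℤ)
    (x : Ext M ((regR 𝒜).shift m) t) : x = 0 := by
  have := congrArg (fun w => (Ext.mk₀ f.hom).comp w (zero_add t))
    (h0 m ((Ext.mk₀ f.inv).comp x (zero_add t)))
  simpa only [Ext.mk₀_comp_mk₀_assoc, f.hom_inv_id, Ext.mk₀_id_comp, Ext.comp_zero] using this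

section Shift

variable {e : Fin n → A} (he : CompleteOrthogonalIdempotents e) (he0 : ∀ i, e i ∈ 𝒜 0)
include he he0

/-- Shifting all degrees by the same integer does not change the grading. -/
theorem isRegrading_const (c : ℤ) : IsRegrading 𝒜 𝒜 e (fun _ => c) where
  complete := he
  mem_left := he0
  mem_iff m a := by
    constructor
    · intro ha j i
      have := SetLike.mul_mem_graded (SetLike.mul_mem_graded (he0 j) ha) (he0 i)
      rw [zero_add, add_zero] at this
      rwa [add_sub_cancel_right]
    · intro ha
      rw [← he.sum_sum a]
      refine sum_mem fun j _ => sum_mem fun i _ => ?_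
      have := ha j i
      rwa [add_sub_cancel_right] at this

/-- The functor of a constant regrading is a shift. -/
def regradeConstHom (l : ℤ) (T : GrRMod 𝒜) :
    (isRegrading_const he he0 (-l)).functor.obj (T.shift l) ⟶ T where
  lin := LinearMap.id
  map_deg t x hx := by
    change x ∈ T.deg t
    rw [← he.sum_op_smul x]
    refine sum_mem fun i _ => ?_
    have h1 : op (e i) • x ∈ T.deg (l + (t + -l)) := hx i
    rwa [show l + (t + -l) = t by ring] at h1

theorem isIso_regradeConstHom (l : ℤ) (T : GrRMod 𝒜) : IsIso (regradeConstHom he he0 l T) :=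
  GrMod.isIso_of_bijective _ Function.bijective_id

variable [IsNoetherianRing Aᵐᵒᵖ] {T : GrRMod 𝒜} (hT : Module.Finite Aᵐᵒᵖ T)
include hT

/-- A constant regrading leaves the algebra unchanged and acts on modules as a shift, so statements
about shifted modules follow from those about regradings. -/
theorem shift_ext_eq_zero {t : ℕ} (h0 : ∀ m, ∀ x : Ext T ((regR 𝒜).shift m) t, x = 0) (l m : ℤ)
    (x : Ext (T.shift l) ((regR 𝒜).shift m) t) : x = 0 := by
  have := isIso_regradeConstHom he he0 l T
  exact (isRegrading_const he he0 (-l)).ext_eq_zero (T.shift l) hT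
    (ext_eq_zero_of_iso (asIso (regradeConstHom he he0 l T)) h0) m x

theorem exists_isExtGenerator_shift {J : Submodule k A} (hJ : ∀ (a : A) {x}, x ∈ J → a * x ∈ J)
    {d : ℕ} {r : ℤ} {b : Fin n} {z : Ext T ((regR 𝒜).shift r) d} (hz : IsExtGenerator J (e b) z)
    {l m : ℤ} (hm : m = r + l) :
    ∃ z' : Ext (T.shift l) ((regR 𝒜).shift m) d, IsExtGenerator J (e b) z' := by
  obtain rfl : r = m + -l := by lia
  have := isIso_regradeConstHom he he0 l T
  exact (isRegrading_const he he0 (-l)).exists_isExtGenerator (T.shift l) hT hJ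
    (hz.of_iso (asIso (regradeConstHom he he0 l T)))

end Shift

variable {ℬ : ℤ → Submodule k A} [GradedAlgebra ℬ]
variable {e : Fin n → 𝒜 0} {e' : Fin n → ℬ 0} {s : Fin n → ℤ}

/-- A description of the graded radical which does not change under regradings. -/
theorem IsNGradedBasic.mem_gradedJacobson_iff (h : IsNGradedBasic 𝒜 e) {a : A} :
    a ∈ gradedJacobson 𝒜 ↔
      ∀ i, ∀ y : A, y * GradedRing.proj 𝒜 0 ((e i : A) * a * e i) ≠ e i := by
  have hp : ∀ j i, GradedRing.proj 𝒜 0 ((e j : A) * a * e i) =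
      (e j : A) * GradedRing.proj 𝒜 0 a * e i := fun j i => by
    rw [proj_mul_of_mem 𝒜 (e i).2, sub_zero, proj_of_mem_mul 𝒜 (e j).2, sub_zero]
  constructor
  · intro ha i y hy
    apply h.not_mem_gradedJacobson i
    rw [← hy]
    refine h.nGraded.mul_mem_gradedJacobson_left _ (proj_zero_mem_gradedJacobson.2 ?_)
    exact h.nGraded.mul_mem_gradedJacobson_right _ (h.nGraded.mul_mem_gradedJacobson_left _ ha)
  · intro hall
    rw [← h.complete.sum_sum a]
    refine sum_mem fun j _ => sum_mem fun i _ => ?_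
    by_contra hcon
    rw [← proj_zero_mem_gradedJacobson, hp] at hcon
    obtain ⟨rfl, y, -, hy, -⟩ := h.exists_inverse (j := j) (i := i)
      (x := (e j : A) * GradedRing.proj 𝒜 0 a * e i)
      (by rw [← hp]; exact proj_mem 𝒜 0 _) (by rw [← mul_assoc, ← mul_assoc, h.idem])
      (by rw [mul_assoc, h.idem]) hcon
    exact hall j y (by rw [hp, hy])

namespace IsRegrading

variable (h : IsRegrading 𝒜 ℬ (fun i => (e i : A)) s)
include h

/-- Diagonal Peirce components are not shifted. Since the radical is detected on them, it is the
same for both gradings. -/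
theorem proj_peirce (i : Fin n) (a : A) :
    GradedRing.proj ℬ 0 ((e i : A) * a * e i) = GradedRing.proj 𝒜 0 ((e i : A) * a * e i) := by
  obtain ⟨S, hS⟩ := sum_proj 𝒜 a
  rw [hS, Finset.mul_sum, Finset.sum_mul, map_sum, map_sum]
  refine Finset.sum_congr rfl fun t _ => ?_
  have h1 := h.peirce_mem_left (proj_mem 𝒜 t a) i i
  have h2 := h.peirce_mem (m := t) (j := i) (i := i) (a := GradedRing.proj 𝒜 t a)
    (by rwa [add_sub_cancel_right])
  rw [proj_of_mem 𝒜 h1, proj_of_mem ℬ h2]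

theorem gradedJacobson_eq (hA : IsNGradedBasic 𝒜 e) (hB : IsNGradedBasic ℬ e')
    (hee : ∀ i, (e' i : A) = e i) : gradedJacobson ℬ = gradedJacobson 𝒜 := by
  ext a
  rw [hA.mem_gradedJacobson_iff, hB.mem_gradedJacobson_iff]
  simp only [hee, h.proj_peirce]

omit [GradedAlgebra 𝒜] [GradedAlgebra ℬ] in
theorem finiteDimensional (hfin : ∀ i, FiniteDimensional k (𝒜 i)) (m : ℤ) :
    FiniteDimensional k (ℬ m) := by
  let f : ℬ m →ₗ[k] ∀ j i, 𝒜 (m + s j - s i) :=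
    { toFun := fun a j i => ⟨(e j : A) * a * e i, (h.mem_iff _ _).1 a.2 j i⟩
      map_add' := fun a b => by
        ext j i
        change (e j : A) * (a + b) * e i = (e j : A) * a * e i + (e j : A) * b * e i
        noncomm_ring
      map_smul' := fun c a => by
        ext j i
        change (e j : A) * (c • (a : A)) * e i = c • ((e j : A) * a * e i)
        rw [mul_smul_comm, smul_mul_assoc] }
  refine FiniteDimensional.of_injective f fun a b hab => Subtype.ext ?_
  rw [← h.complete.sum_sum (a : A), ← h.complete.sum_sum (b : A)]
  exact Finset.sum_congr rfl fun j _ => Finset.sum_congr rfl fun i _ =>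
    congrArg Subtype.val (congrFun (congrFun hab j) i)

omit [GradedAlgebra 𝒜] [GradedAlgebra ℬ] in
theorem isNGraded (hs : ∀ j i l, ∀ a ∈ 𝒜 l, (e j : A) * a * e i ≠ 0 → 0 ≤ l + s i - s j) :
    IsNGraded ℬ := by
  intro m hm
  rw [Submodule.eq_bot_iff]
  intro a ha
  rw [← h.complete.sum_sum a]
  refine Finset.sum_eq_zero fun j _ => Finset.sum_eq_zero fun i _ => ?_
  by_contra hne
  have h1 : (e j : A) * (e j * a * e i) * e i = e j * a * e i := by
    have h2 : ∀ i, (e i : A) * e i = e i := h.complete.idem_mul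
    calc _ = (e j : A) * e j * a * (e i * e i) := by noncomm_ring
      _ = _ := by rw [h2, h2]
  have := hs j i _ _ ((h.mem_iff _ _).1 ha j i) (by rwa [h1])
  lia

/-- Regrading a simple module gives a shift of a simple module. -/
theorem nonempty_iso_simpleR (hA : IsNGradedBasic 𝒜 e) (hB : IsNGradedBasic ℬ e')
    (hee : ∀ i, (e' i : A) = e i) (i : Fin n) :
    Nonempty (h.functor.obj (simpleR ℬ (e' i)) ≅ (simpleR 𝒜 (e i)).shift (s i)) := by
  obtain rfl : e' = fun i => ⟨(e i : A), h.mem_right i⟩ := funext fun i => Subtype.ext (hee i)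
  -- Both tops are quotients of the same module `e_i A` by the same radical, so only the degrees
  -- have to be compared.
  have hrad : (projR ℬ (⟨(e i : A), h.mem_right i⟩ : ℬ 0)).rad = (projR 𝒜 (e i)).rad := by
    ext v
    refine (hB.rad_projR i v).trans (Iff.trans ?_ (hA.rad_projR i v).symm)
    rw [h.gradedJacobson_eq hA hB hee]
  let f : h.functor.obj (simpleR ℬ (⟨(e i : A), h.mem_right i⟩ : ℬ 0)) ⟶
      (simpleR 𝒜 (e i)).shift (s i) :=
    { lin := (Submodule.quotEquivOfEq _ _ hrad).toLinearMap
      map_deg := fun t x hx => by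
        rw [← h.complete.sum_op_smul x, map_sum]
        refine sum_mem fun j _ => ?_
        obtain ⟨v, hv, hvx⟩ := hx j
        have hev : (e i : A) * (v : A) = v := by
          obtain ⟨_, w, rfl⟩ := v
          change (e i : A) * (e i * w) = e i * w
          rw [← mul_assoc, hA.idem]
        refine ⟨op (e j : A) • v, ?_, ?_⟩
        · change (v : A) * e j ∈ 𝒜 (s i + t)
          have := (h.mem_iff _ _).1 (show (v : A) ∈ ℬ (t + s j) from hv) i j
          rwa [hev, show t + s j + s i - s j = s i + t by ring] at this
        · have h2 : op (e j : A) • op (e j : A) • x = op (e j : A) • x := by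
            rw [← mul_smul, ← op_mul, hA.idem]
          rw [← h2, ← hvx]
          rfl }
  have : IsIso f := GrMod.isIso_of_bijective f (Submodule.quotEquivOfEq _ _ hrad).bijective
  exact ⟨asIso f⟩

end IsRegrading

end RegradingSimple

/-! ### Graded simple modules and maximal submodules of the radical -/

section SimpleModules

variable {k : Type v} {A : Type u} [Field k] [Ring A] [Algebra k A]
variable {𝒜 : ℤ → Submodule k A} [GradedAlgebra 𝒜] {n : ℕ} {e : Fin n → 𝒜 0}

theorem isNoetherian_regR (A : Type u) [Ring A] [IsNoetherianRing Aᵐᵒᵖ] : IsNoetherian Aᵐᵒᵖ A :=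
  isNoetherian_of_linearEquiv (MulOpposite.opLinearEquiv Aᵐᵒᵖ : A ≃ₗ[Aᵐᵒᵖ] Aᵐᵒᵖ).symm

theorem GrMod.IsHomog.sup {R : Type u} [Ring R] [Algebra k R] {ℬ : ℤ → Submodule k R}
    {M : GrMod ℬ} {P Q : Submodule R M} (hP : M.IsHomog P) (hQ : M.IsHomog Q) :
    M.IsHomog (P ⊔ Q) := by
  intro x hx m
  obtain ⟨p, hp, q, hq, rfl⟩ := Submodule.mem_sup.1 hx
  rw [map_add]
  exact add_mem (Submodule.mem_sup_left (hP p hp m)) (Submodule.mem_sup_right (hQ q hq m))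

/-- The homomorphism `A(-s) ⟶ M` given by a homogeneous element of degree `s`. -/
def GrMod.fromReg {M : GrRMod 𝒜} {s : ℤ} (y : M) (hy : y ∈ M.deg s) :
    (regR 𝒜).shift (-s) ⟶ M where
  lin :=
    { toFun := fun a => op a • y
      map_add' := fun a b => by rw [MulOpposite.op_add, add_smul]
      map_smul' := fun r a => mul_smul r (op a) y }
  map_deg i a ha := by
    have := M.smul_mem (r := op a) (show a ∈ 𝒜 (-s + i) from ha) hy
    rwa [show -s + i + s = i by ring] at this

namespace IsNGradedBasic

variable (h : IsNGradedBasic 𝒜 e)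
include h

/-- The generator of `e_i A`. -/
abbrev gen (_ : IsNGradedBasic 𝒜 e) (i : Fin n) : projR 𝒜 (e i) := ⟨e i, 1, mul_one _⟩

theorem mul_projR {i : Fin n} (v : projR 𝒜 (e i)) : (e i : A) * v = v := by
  obtain ⟨_, w, rfl⟩ := v
  change (e i : A) * (e i * w) = e i * w
  rw [← mul_assoc, h.idem]

theorem op_smul_gen {i : Fin n} (v : projR 𝒜 (e i)) : op (v : A) • h.gen i = v :=
  Subtype.ext (h.mul_projR v)

theorem simpleR_lin_ext {i : Fin n} {N : Type*} [AddCommGroup N] [Module Aᵐᵒᵖ N]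
    (f g : simpleR 𝒜 (e i) →ₗ[Aᵐᵒᵖ] N)
    (hfg : f ((projR 𝒜 (e i)).rad.mkQ (h.gen i)) = g ((projR 𝒜 (e i)).rad.mkQ (h.gen i))) :
    f = g := by
  ext v
  have hv := h.op_smul_gen v
  change f ((projR 𝒜 (e i)).rad.mkQ v) = g ((projR 𝒜 (e i)).rad.mkQ v)
  rw [← hv, map_smul, map_smul, map_smul, hfg]

theorem op_smul_simpleR_eq_zero {i : Fin n} (u : simpleR 𝒜 (e i)) {x : A}
    (hx : x ∈ gradedJacobson 𝒜) : op x • u = 0 := by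
  obtain ⟨v, rfl⟩ := Submodule.mkQ_surjective _ u
  rw [← map_smul]
  refine (Submodule.Quotient.mk_eq_zero _).2 ((h.rad_projR i _).2 ?_)
  exact h.nGraded.mul_mem_gradedJacobson_left (v : A) hx

/-- There are no nonzero homomorphisms between shifts of different simple modules. -/
theorem simpleR_hom_eq_zero {i j : Fin n} (hij : i ≠ j) {l : ℤ}
    (f : simpleR 𝒜 (e j) ⟶ (simpleR 𝒜 (e i)).shift l) : f = 0 := by
  refine GrMod.Hom.ext (h.simpleR_lin_ext _ _ ?_)
  change f.lin _ = 0
  have h0 : (projR 𝒜 (e j)).rad.mkQ (h.gen j) ∈ (simpleR 𝒜 (e j)).deg 0 :=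
    ⟨h.gen j, (e j).2, rfl⟩
  obtain ⟨v, hv, hvx⟩ := f.map_deg 0 _ h0
  have hv' : (v : A) ∈ 𝒜 l := by
    have : (v : A) ∈ 𝒜 (l + 0) := hv
    rwa [add_zero] at this
  have h1 : op (e j : A) • (projR 𝒜 (e j)).rad.mkQ (h.gen j) =
      (projR 𝒜 (e j)).rad.mkQ (h.gen j) := by
    rw [← map_smul]
    congr 1
    exact Subtype.ext (h.idem j)
  rw [← h1, map_smul, ← hvx]
  refine (Submodule.Quotient.mk_eq_zero _).2 ((h.rad_projR i (op (e j : A) • v)).2 ?_)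
  change (v : A) * e j ∈ gradedJacobson 𝒜
  -- Outside the radical the degree must be `0`, and then the element is invertible between the
  -- vertices `i` and `j`, which forces them to coincide.
  by_contra hcon
  by_cases hl : l = 0
  · subst hl
    refine hij (h.exists_inverse (j := i) (i := j) (x := (v : A) * e j) ?_ ?_ ?_ hcon).1
    · simpa using SetLike.mul_mem_graded hv' (e j).2
    · rw [← mul_assoc, h.mul_projR]
    · rw [mul_assoc, h.idem]
  · exact hcon (h.nGraded.mul_mem_gradedJacobson_right _ (mem_gradedJacobson_of_mem hl hv'))

theorem mul_mem_sq_right {x : A} (b : A) (hx : x ∈ gradedJacobson 𝒜 * gradedJacobson 𝒜) :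
    x * b ∈ gradedJacobson 𝒜 * gradedJacobson 𝒜 := by
  induction hx using Submodule.mul_induction_on' with
  | mem_mul_mem y hy z hz =>
    rw [mul_assoc]
    exact Submodule.mul_mem_mul hy (h.nGraded.mul_mem_gradedJacobson_right b hz)
  | add x hx y hy h₁ h₂ =>
    rw [add_mul]
    exact add_mem h₁ h₂

theorem sq_le : gradedJacobson 𝒜 * gradedJacobson 𝒜 ≤ gradedJacobson 𝒜 :=
  Submodule.mul_le.2 fun a _ _ hb => h.nGraded.mul_mem_gradedJacobson_left a hb

/-- A graded submodule `N` of `e_j J` containing `e_j J²` and maximal without the element `x`. -/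
theorem exists_maximal_submodule [IsNoetherianRing Aᵐᵒᵖ] {j : Fin n} {x : A}
    (hj : (e j : A) * x = x) (hx2 : x ∉ gradedJacobson 𝒜 * gradedJacobson 𝒜) :
    ∃ N : Submodule Aᵐᵒᵖ (projR 𝒜 (e j)), (projR 𝒜 (e j)).IsHomog N ∧
      (∀ v ∈ N, (v : A) ∈ gradedJacobson 𝒜) ∧
      (∀ v : projR 𝒜 (e j), (v : A) ∈ gradedJacobson 𝒜 * gradedJacobson 𝒜 → v ∈ N) ∧
      ⟨x, x, hj⟩ ∉ N ∧
      ∀ L, (projR 𝒜 (e j)).IsHomog L → (∀ v ∈ L, (v : A) ∈ gradedJacobson 𝒜) → N ≤ L →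
        ⟨x, x, hj⟩ ∉ L → L ≤ N := by
  have := isNoetherian_regR A
  let S : Set (Submodule Aᵐᵒᵖ (projR 𝒜 (e j))) := {N | (projR 𝒜 (e j)).IsHomog N ∧
      (∀ v ∈ N, (v : A) ∈ gradedJacobson 𝒜) ∧
      (∀ v : projR 𝒜 (e j), (v : A) ∈ gradedJacobson 𝒜 * gradedJacobson 𝒜 → v ∈ N) ∧
      ⟨x, x, hj⟩ ∉ N}
  have hne : S.Nonempty := by
    refine ⟨{ carrier := {v | (v : A) ∈ gradedJacobson 𝒜 * gradedJacobson 𝒜}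
              add_mem' := fun ha hb =>
                Submodule.add_mem (gradedJacobson 𝒜 * gradedJacobson 𝒜) ha hb
              zero_mem' := Submodule.zero_mem (gradedJacobson 𝒜 * gradedJacobson 𝒜)
              smul_mem' := fun c v hv => h.mul_mem_sq_right c.unop hv }, ?_, ?_, ?_, hx2⟩
    · intro v hv m
      change ((projR 𝒜 (e j)).pr m v : A) ∈ gradedJacobson 𝒜 * gradedJacobson 𝒜
      rw [projR_pr]
      exact isHomogeneousSubspace_gradedJacobson.mul isHomogeneousSubspace_gradedJacobson _ hv m
    · exact fun v hv => h.sq_le hv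
    · exact fun v hv => hv
  obtain ⟨N, hN, hmax⟩ := (wellFounded_gt (α := Submodule Aᵐᵒᵖ (projR 𝒜 (e j)))).has_min S hne
  refine ⟨N, hN.1, hN.2.1, hN.2.2.1, hN.2.2.2, fun L hL hLJ hNL hxL => ?_⟩
  by_contra hLN
  exact hmax L ⟨hL, hLJ, fun v hv => hNL (hN.2.2.1 v hv), hxL⟩ (lt_of_le_not_ge hNL hLN)

/-- If `N` is maximal without the element `x` of `e_j J e_i`, then `x` generates `e_j J / N`. -/
theorem exists_sub_mem {i j : Fin n} {x : A} (hj : (e j : A) * x = x) (hi : x * (e i : A) = x)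
    {N : Submodule Aᵐᵒᵖ (projR 𝒜 (e j))} (hN : (projR 𝒜 (e j)).IsHomog N)
    (hNJ : ∀ v ∈ N, (v : A) ∈ gradedJacobson 𝒜)
    (hJN : ∀ v : projR 𝒜 (e j), (v : A) ∈ gradedJacobson 𝒜 * gradedJacobson 𝒜 → v ∈ N)
    (hxN : ⟨x, x, hj⟩ ∉ N)
    (hmax : ∀ L, (projR 𝒜 (e j)).IsHomog L → (∀ v ∈ L, (v : A) ∈ gradedJacobson 𝒜) → N ≤ L →
      ⟨x, x, hj⟩ ∉ L → L ≤ N) (y : projR 𝒜 (e j)) (hy : (y : A) ∈ gradedJacobson 𝒜) :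
    ∃ c : A, y - op c • (⟨x, x, hj⟩ : projR 𝒜 (e j)) ∈ N := by
  set X : projR 𝒜 (e j) := ⟨x, x, hj⟩ with hX
  have key : ∀ (t : ℤ) (b : Fin n) (y : projR 𝒜 (e j)), y ∈ (projR 𝒜 (e j)).deg t →
      (y : A) * e b = y → (y : A) ∈ gradedJacobson 𝒜 → ∃ c : A, y - op c • X ∈ N := by
    intro t b y hyt hyb hyJ
    have hyJ2 : ∀ a ∈ gradedJacobson 𝒜, op a • y ∈ N := fun a ha =>
      hJN _ (Submodule.mul_mem_mul hyJ ha)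
    -- Enlarge `N` by `y`. Either the enlargement contains `x`, and the equation can be solved for
    -- `y`, or maximality puts `y` in `N`.
    let L := N ⊔ LinearMap.range (GrMod.fromReg y hyt).lin
    have hL : (projR 𝒜 (e j)).IsHomog L := hN.sup (GrMod.isHomog_range _)
    have hLJ : ∀ v ∈ L, (v : A) ∈ gradedJacobson 𝒜 := by
      intro v hv
      obtain ⟨p, hp, _, ⟨a, rfl⟩, rfl⟩ := Submodule.mem_sup.1 hv
      exact add_mem (hNJ p hp) (h.nGraded.mul_mem_gradedJacobson_right a hyJ)
    by_cases hXL : X ∈ L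
    · obtain ⟨p, hp, _, ⟨a, rfl⟩, hpa⟩ := Submodule.mem_sup.1 hXL
      have hpa' : (p : A) + y * a = x := congrArg Subtype.val hpa
      set a' := (e b : A) * a * e i with ha'
      have hxa : X = op (e i : A) • p + op a' • y := by
        refine Subtype.ext ?_
        change x = p * (e i : A) + y * a'
        rw [ha', ← mul_assoc, ← mul_assoc, hyb, ← add_mul, hpa', hi]
      -- A radical coefficient would put `y a'` in `J²`, hence `x` in `N`. So the degree `0` part of
      -- `a'` is invertible, and its remainder lies in the radical and is absorbed by `N`.
      have ha'J : a' ∉ gradedJacobson 𝒜 := fun hcon => hxN (by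
        rw [hxa]
        exact add_mem (N.smul_mem _ hp) (hyJ2 _ hcon))
      have hproj : GradedRing.proj 𝒜 0 a' = (e b : A) * GradedRing.proj 𝒜 0 a * e i := by
        rw [ha', proj_mul_of_mem 𝒜 (e i).2, sub_zero, proj_of_mem_mul 𝒜 (e b).2, sub_zero]
      obtain ⟨-, c, -, -, hc⟩ := h.exists_inverse (j := b) (i := i)
        (x := GradedRing.proj 𝒜 0 a') (proj_mem 𝒜 0 a')
        (by rw [hproj, ← mul_assoc, ← mul_assoc, h.idem]) (by rw [hproj, mul_assoc, h.idem])
        (fun hcon => ha'J (proj_zero_mem_gradedJacobson.1 hcon))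
      refine ⟨c, ?_⟩
      have hdiff : a' - GradedRing.proj 𝒜 0 a' ∈ gradedJacobson 𝒜 := by
        rw [← proj_zero_mem_gradedJacobson, map_sub, proj_of_mem 𝒜 (proj_mem 𝒜 0 a'), if_pos rfl,
          sub_self]
        exact zero_mem _
      have : y - op c • X = -(op c • op (e i : A) • p) -
          op c • op (a' - GradedRing.proj 𝒜 0 a') • y := by
        rw [hxa]
        refine Subtype.ext ?_
        change (y : A) - (p * (e i : A) + y * a') * c =
          -(p * (e i : A) * c) - y * (a' - GradedRing.proj 𝒜 0 a') * c
        have h3 : (y : A) * GradedRing.proj 𝒜 0 a' * c = y := by rw [mul_assoc, hc, hyb]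
        calc _ = (y : A) * GradedRing.proj 𝒜 0 a' * c - (p * (e i : A) + y * a') * c := by rw [h3]
          _ = _ := by noncomm_ring
      rw [this]
      exact sub_mem (neg_mem (N.smul_mem _ (N.smul_mem _ hp))) (N.smul_mem _ (hyJ2 _ hdiff))
    · refine ⟨0, ?_⟩
      rw [MulOpposite.op_zero, zero_smul, sub_zero]
      refine hmax L hL hLJ le_sup_left hXL (Submodule.mem_sup_right ⟨1, ?_⟩)
      exact Subtype.ext (mul_one _)
  obtain ⟨S, hS⟩ := (projR 𝒜 (e j)).exists_sum_pr y
  have hcomp : ∀ t b, ∃ c : A, op (e b : A) • (projR 𝒜 (e j)).pr t y - op c • X ∈ N := by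
    intro t b
    refine key t b _ ?_ ?_ ?_
    · have := (projR 𝒜 (e j)).smul_mem (r := op (e b : A)) (i := 0) (e b).2
        ((projR 𝒜 (e j)).pr_mem t y)
      rwa [zero_add] at this
    · change ((projR 𝒜 (e j)).pr t y : A) * e b * e b = (projR 𝒜 (e j)).pr t y * e b
      rw [mul_assoc, h.idem]
    · change ((projR 𝒜 (e j)).pr t y : A) * e b ∈ gradedJacobson 𝒜
      rw [projR_pr]
      exact h.nGraded.mul_mem_gradedJacobson_right _
        (isHomogeneousSubspace_gradedJacobson _ hy t)
  choose c hc using hcomp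
  refine ⟨∑ t ∈ S, ∑ b, c t b, ?_⟩
  have : y - op (∑ t ∈ S, ∑ b, c t b) • X =
      ∑ t ∈ S, ∑ b, (op (e b : A) • (projR 𝒜 (e j)).pr t y - op (c t b) • X) := by
    simp only [Finset.sum_sub_distrib, h.complete.sum_op_smul, Finset.op_sum, Finset.sum_smul]
    rw [← hS]
  rw [this]
  exact sum_mem fun t _ => sum_mem fun b _ => hc t b

end IsNGradedBasic

end SimpleModules

/-! ### The nonsplit extension attached to an arrow -/

section ArrowExtension

variable {k : Type v} {A : Type u} [Field k] [Ring A] [Algebra k A]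
variable {𝒜 : ℤ → Submodule k A} [GradedAlgebra 𝒜] {n : ℕ} {e : Fin n → 𝒜 0}

namespace IsNGradedBasic

variable (h : IsNGradedBasic 𝒜 e)
include h

/-- A homogeneous element of `e_j J e_i` outside of `J²` gives rise to a nonsplit extension of
`S_j` by a shift of `S_i`. -/
theorem exists_extension [IsNoetherianRing Aᵐᵒᵖ] {i j : Fin n} {l : ℤ} {x : A} (hxl : x ∈ 𝒜 l)
    (hj : (e j : A) * x = x) (hi : x * (e i : A) = x) (hxJ : x ∈ gradedJacobson 𝒜)
    (hx2 : x ∉ gradedJacobson 𝒜 * gradedJacobson 𝒜) :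
    ∃ (M : GrRMod 𝒜) (f : (simpleR 𝒜 (e i)).shift (-l) ⟶ M) (g : M ⟶ simpleR 𝒜 (e j))
      (w : f ≫ g = 0), Module.Finite Aᵐᵒᵖ M ∧ (ShortComplex.mk f g w).ShortExact ∧
      ∀ f' : M ⟶ (simpleR 𝒜 (e i)).shift (-l), f ≫ f' = 0 := by
  obtain ⟨N, hN, hNJ, hJN, hxN, hmax⟩ := h.exists_maximal_submodule hj hx2
  have hcov := h.exists_sub_mem hj hi hN hNJ hJN hxN hmax
  let φ : projR 𝒜 (e i) →ₗ[Aᵐᵒᵖ] projR 𝒜 (e j) :=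
    ((lmulLin x).comp (Submodule.subtype _)).codRestrict _ fun v => ⟨x * v, by
      change (e j : A) * (x * v) = x * v
      rw [← mul_assoc, hj]⟩
  have hφJ : ∀ v : projR 𝒜 (e i), (v : A) ∈ gradedJacobson 𝒜 → φ v ∈ N := fun v hv =>
    hJN _ (Submodule.mul_mem_mul hxJ hv)
  -- The preimage of `N` is a graded submodule of `e_i A` missing the generator, since `x ∉ N`; it
  -- is therefore contained in the radical.
  have hφinj : ∀ v : projR 𝒜 (e i), φ v ∈ N → (v : A) ∈ gradedJacobson 𝒜 := by
    intro v hv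
    refine h.mem_gradedJacobson_of_isHomog (L := N.comap φ) ?_ ?_ hv
    · intro v hv t
      have : φ ((projR 𝒜 (e i)).pr t v) = (projR 𝒜 (e j)).pr (l + t) (φ v) := by
        refine Subtype.ext ?_
        change x * ((projR 𝒜 (e i)).pr t v : A) = _
        rw [projR_pr, projR_pr]
        change x * _ = GradedRing.proj 𝒜 (l + t) (x * v)
        rw [proj_of_mem_mul 𝒜 hxl, add_sub_cancel_left]
      change φ _ ∈ N
      rw [this]
      exact hN _ hv _
    · intro htop
      have : h.gen i ∈ N.comap φ := htop ▸ Submodule.mem_top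
      refine hxN ?_
      have h1 : φ (h.gen i) = ⟨x, x, hj⟩ := Subtype.ext hi
      rw [← h1]
      exact this
  let M : GrRMod 𝒜 := (projR 𝒜 (e j)).quot N hN
  let f : (simpleR 𝒜 (e i)).shift (-l) ⟶ M :=
    { lin := (projR 𝒜 (e i)).rad.liftQ (N.mkQ.comp φ) fun v hv =>
        (Submodule.Quotient.mk_eq_zero _).2 (hφJ v ((h.rad_projR i v).1 hv))
      map_deg := by
        rintro t _ ⟨v, hv, rfl⟩
        refine ⟨φ v, ?_, rfl⟩
        have := SetLike.mul_mem_graded hxl (show (v : A) ∈ 𝒜 (-l + t) from hv)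
        rwa [show l + (-l + t) = t by ring] at this }
  let g : M ⟶ simpleR 𝒜 (e j) :=
    { lin := N.liftQ (projR 𝒜 (e j)).rad.mkQ fun v hv =>
        (Submodule.Quotient.mk_eq_zero _).2 ((h.rad_projR j v).2 (hNJ v hv))
      map_deg := by
        rintro t _ ⟨v, hv, rfl⟩
        exact ⟨v, hv, rfl⟩ }
  have w : f ≫ g = 0 := by
    refine GrMod.hom_ext fun u => ?_
    obtain ⟨v, rfl⟩ := Submodule.mkQ_surjective _ u
    exact (Submodule.Quotient.mk_eq_zero _).2 ((h.rad_projR j (φ v)).2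
      (h.nGraded.mul_mem_gradedJacobson_right (v : A) hxJ))
  have := isNoetherian_regR A
  refine ⟨M, f, g, w, inferInstanceAs (Module.Finite Aᵐᵒᵖ (projR 𝒜 (e j) ⧸ N)),
    GrMod.shortExact f g w ?_ ?_ ?_, fun f' => ?_⟩
  · rw [← LinearMap.ker_eq_bot, Submodule.eq_bot_iff]
    intro u hu
    obtain ⟨v, rfl⟩ := Submodule.mkQ_surjective _ u
    exact (Submodule.Quotient.mk_eq_zero _).2 ((h.rad_projR i v).2
      (hφinj v ((Submodule.Quotient.mk_eq_zero _).1 hu)))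
  · intro u
    obtain ⟨v, rfl⟩ := Submodule.mkQ_surjective _ u
    exact ⟨N.mkQ v, rfl⟩
  · intro u hu
    obtain ⟨y, rfl⟩ := Submodule.mkQ_surjective _ u
    obtain ⟨c, hc⟩ := hcov y ((h.rad_projR j y).1 ((Submodule.Quotient.mk_eq_zero _).1 hu))
    refine ⟨(projR 𝒜 (e i)).rad.mkQ (op c • h.gen i), ?_⟩
    refine Eq.symm ((Submodule.Quotient.eq N).2 ?_)
    have : φ (op c • h.gen i) = op c • (⟨x, x, hj⟩ : projR 𝒜 (e j)) := by
      refine Subtype.ext ?_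
      change x * ((e i : A) * c) = x * c
      rw [← mul_assoc, hi]
    rw [this]
    exact hc
  · refine GrMod.Hom.ext (h.simpleR_lin_ext _ _ ?_)
    -- The image of `S_i` in `M` is generated by `e_j x`, a multiple of the generator of `M` by a
    -- radical element; every map to a shift of `S_i` kills it.
    have h1 : φ (h.gen i) = op x • h.gen j := by
      refine Subtype.ext ?_
      change x * (e i : A) = e j * x
      rw [hi, hj]
    change f'.lin (N.mkQ (φ (h.gen i))) = 0
    rw [h1, map_smul, map_smul]
    exact h.op_smul_simpleR_eq_zero _ hxJ

end IsNGradedBasic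

end ArrowExtension

/-! ### The Nakayama permutation and its action on arrows -/

section Arrows

open Abelian

variable {k : Type v} {A : Type u} [Field k] [Ring A] [Algebra k A]
variable {𝒜 : ℤ → Submodule k A} [GradedAlgebra 𝒜]

theorem exists_hom_of_isExtGenerator [IsNoetherianRing Aᵐᵒᵖ] {c : ℕ}
    [HasInjectiveDimensionLT (ModuleCat.of A A) c] {M N : GrRMod 𝒜} (hM : Module.Finite Aᵐᵒᵖ M)
    (hN : Module.Finite Aᵐᵒᵖ N) {d : ℕ}
    (hM0 : ∀ t < d, ∀ m, ∀ x : Ext M ((regR 𝒜).shift m) t, x = 0)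
    (hN0 : ∀ t, d < t → ∀ m, ∀ x : Ext N ((regR 𝒜).shift m) t, x = 0)
    {r : ℤ} {z : Ext N ((regR 𝒜).shift r) d} {J : Submodule k A} {E : A}
    (hz : IsExtGenerator J E z) (y : Ext M ((regR 𝒜).shift r) d)
    (hy : ∀ m a (ha : a ∈ 𝒜 (m - r)), a * E ∈ J → extAct y m a ha = 0) :
    ∃ f : M ⟶ N, (Ext.mk₀ f).comp z (zero_add d) = y := by
  obtain ⟨R, rfl⟩ := exists_freeRes M hM
  obtain ⟨R', rfl⟩ := exists_freeRes N hN
  exact R.exists_hom_of_ext R' (c := c) hM0 hN0 z y hz.gen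
    fun m a ha h0 => hy m a ha ((hz.ann m a ha).1 h0)

variable {n : ℕ} {e : Fin n → 𝒜 0} {d : ℕ} {ν : Fin n → Fin n} {p : Fin n → ℤ}

namespace IsBasicASGorenstein

variable (h : IsBasicASGorenstein 𝒜 d e ν p) (hN : IsNGraded 𝒜)
include h

theorem isNGradedBasic (hN : IsNGraded 𝒜) : IsNGradedBasic 𝒜 e :=
  ⟨hN, h.locally_finite 0, h.complete, h.primitive, h.basic⟩

theorem finite_simpleR (i : Fin n) : Module.Finite Aᵐᵒᵖ (simpleR 𝒜 (e i)) := by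
  have := h.noetherian_right
  have := isNoetherian_regR A
  exact inferInstanceAs (Module.Finite Aᵐᵒᵖ (projR 𝒜 (e i) ⧸ (projR 𝒜 (e i)).rad))

theorem hasInjectiveDimensionLT : HasInjectiveDimensionLT (ModuleCat.of A A) (d + 1) := by
  rw [← injectiveDimension_lt_iff, h.injdim_left]
  exact_mod_cast Nat.lt_succ_self d

theorem simpleR_ext_eq_zero (i : Fin n) (t : ℕ) (ht : t ≠ d) (m : ℤ)
    (x : Ext (simpleR 𝒜 (e i)) ((regR 𝒜).shift m) t) : x = 0 :=
  (h.ext_eq_zero i t ht m).elim _ _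

theorem shift_simpleR_ext_eq_zero (i : Fin n) (t : ℕ) (ht : t ≠ d) (l m : ℤ)
    (x : Ext ((simpleR 𝒜 (e i)).shift l) ((regR 𝒜).shift m) t) : x = 0 :=
  have := h.noetherian_right
  shift_ext_eq_zero h.complete (fun i => (e i).2) (h.finite_simpleR i)
    (h.simpleR_ext_eq_zero i t ht) l m x

include hN

theorem exists_isExtGenerator (i : Fin n) {l m : ℤ} (hm : m = -p i + l) :
    ∃ z : Ext ((simpleR 𝒜 (e i)).shift l) ((regR 𝒜).shift m) d,
      IsExtGenerator (gradedJacobson 𝒜) (e (ν i) : A) z := by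
  have := h.noetherian_right
  obtain ⟨z, hz⟩ := (h.isNGradedBasic hN).exists_isExtGenerator (h.ext_iso i)
  exact exists_isExtGenerator_shift (e := fun i => (e i : A)) h.complete (fun i => (e i).2)
    (h.finite_simpleR i) (fun a _ hx => hN.mul_mem_gradedJacobson_left a hx) hz hm

/-- The map `ν` is a permutation. -/
theorem nakayama_injective : Function.Injective ν := by
  intro i j hij
  by_contra hne
  have hB := h.isNGradedBasic hN
  have := h.noetherian_right
  have := h.hasInjectiveDimensionLT
  obtain ⟨z, hz⟩ := hB.exists_isExtGenerator (h.ext_iso j)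
  obtain ⟨z', hz'⟩ := h.exists_isExtGenerator hN i (l := p i - p j) (m := -p j) (by ring)
  -- If `ν i = ν j`, the generators for `S_j` and `S_i(p i - p j)` have the same degree and
  -- annihilator, so one is the pullback of the other along some `f`. But `f = 0`, as the simple
  -- modules differ.
  obtain ⟨f, hf⟩ := exists_hom_of_isExtGenerator (c := d + 1) (h.finite_simpleR j)
    (N := (simpleR 𝒜 (e i)).shift (p i - p j)) (h.finite_simpleR i)
    (fun t ht => h.simpleR_ext_eq_zero j t ht.ne)
    (fun t ht => h.shift_simpleR_ext_eq_zero i t ht.ne' _) hz' z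
    (fun m a ha haJ => (hz.ann m a ha).2 (hij ▸ haJ))
  rw [hB.simpleR_hom_eq_zero hne f, Ext.mk₀_zero, Ext.zero_comp] at hf
  have h1 : (1 : A) ∈ 𝒜 (-p j - -p j) := by
    rw [sub_self]
    exact SetLike.GradedOne.one_mem
  have := (hz.ann _ 1 h1).1 (by rw [← hf, zero_extAct])
  rw [one_mul] at this
  exact hB.not_mem_gradedJacobson _ this

set_option maxHeartbeats 1000000 in
/-- The Nakayama permutation acts on the degrees of the homogeneous elements of `e_j J e_i`
outside of `J²`. -/
theorem exists_arrow {i j : Fin n} {l : ℤ} {x : A} (hxl : x ∈ 𝒜 l)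
    (hj : (e j : A) * x = x) (hi : x * (e i : A) = x) (hxJ : x ∈ gradedJacobson 𝒜)
    (hx2 : x ∉ gradedJacobson 𝒜 * gradedJacobson 𝒜) :
    ∃ a ∈ 𝒜 (l + p i - p j), (e (ν j) : A) * a = a ∧ a * (e (ν i) : A) = a ∧
      a ∈ gradedJacobson 𝒜 ∧ a ∉ gradedJacobson 𝒜 * gradedJacobson 𝒜 := by
  have hB := h.isNGradedBasic hN
  have := h.noetherian_right
  have := h.hasInjectiveDimensionLT
  obtain ⟨M, f, g, w, hM, hS, hsplit⟩ := hB.exists_extension hxl hj hi hxJ hx2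
  set r : ℤ := -p i + -l with hr
  obtain ⟨z, hz⟩ := h.exists_isExtGenerator hN i (l := -l) hr
  obtain ⟨zj, hzj⟩ := hB.exists_isExtGenerator (h.ext_iso j)
  have hM0 : ∀ t, t ≠ d → ∀ m, ∀ x : Ext M ((regR 𝒜).shift m) t, x = 0 := by
    intro t ht m x
    obtain ⟨x₃, rfl⟩ := Ext.contravariant_sequence_exact₂ hS _ x
      (h.shift_simpleR_ext_eq_zero i t ht _ _ _)
    rw [h.simpleR_ext_eq_zero j t ht _ x₃, Ext.comp_zero]
  have hmem : ∀ {m t : ℤ} {a b : A}, a ∈ 𝒜 0 → b ∈ 𝒜 (m - t) → a * b ∈ 𝒜 (m - t) :=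
    fun ha hb => by simpa using SetLike.mul_mem_graded ha hb
  have hmem' : ∀ {m t : ℤ} {a b : A}, a ∈ 𝒜 (m - t) → b ∈ 𝒜 0 → a * b ∈ 𝒜 (m - t) :=
    fun ha hb => by simpa using SetLike.mul_mem_graded ha hb
  have h0 : ∀ (t : ℤ) {a : A}, a ∈ 𝒜 0 → a ∈ 𝒜 (t - t) := fun t a ha => by rwa [sub_self]
  have hz0 : extAct z r (e (ν i) : A) (h0 r (e (ν i)).2) = z := by
    have h1 : (1 : A) ∈ 𝒜 (r - r) := h0 r SetLike.GradedOne.one_mem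
    conv_rhs => rw [← extAct_one z h1 rfl]
    rw [← sub_eq_zero, ← extAct_sub, hz.ann, sub_mul, one_mul, hB.idem, sub_self]
    exact zero_mem _
  -- The generator for the submodule extends to `M`, because `Ext^(d+1)` of `S_j` vanishes. Next it
  -- is replaced by its multiple by `e (ν i)`, which still restricts to `z`.
  obtain ⟨y₀, hy₀⟩ := Ext.contravariant_sequence_exact₁ hS _ z (add_comm 1 d)
    (h.simpleR_ext_eq_zero j (d + 1) (Nat.succ_ne_self d) _ _)
  set y := extAct y₀ r (e (ν i) : A) (h0 r (e (ν i)).2) with hy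
  have hfy : (Ext.mk₀ f).comp y (zero_add d) = z := by
    rw [hy, mk₀_comp_extAct]
    exact (congrArg (fun w => extAct w r (e (ν i) : A) (h0 r (e (ν i)).2)) hy₀).trans hz0
  have hye : ∀ m a (ha : a ∈ 𝒜 (m - r)), extAct y m a ha =
      extAct y m (a * e (ν i)) (hmem' ha (e (ν i)).2) := by
    intro m a ha
    have h1 : a * e (ν i) ∈ 𝒜 (m - r) := hmem' ha (e (ν i)).2
    have h2 : a * e (ν i) * e (ν i) ∈ 𝒜 (m - r) := hmem' h1 (e (ν i)).2
    rw [hy, extAct_extAct y₀ _ ha h1, extAct_extAct y₀ _ h1 h2]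
    congr 1
    rw [mul_assoc, hB.idem]
  have hker : ∀ m a (ha : a ∈ 𝒜 (m - r)), a ∈ gradedJacobson 𝒜 →
      ∃ w : Ext (simpleR 𝒜 (e j)) ((regR 𝒜).shift m) d,
        (Ext.mk₀ g).comp w (zero_add d) = extAct y m a ha := by
    intro m a ha haJ
    refine Ext.contravariant_sequence_exact₂ hS _ (extAct y m a ha) ?_
    change (Ext.mk₀ f).comp (extAct y m a ha) (zero_add d) = 0
    rw [mk₀_comp_extAct, hfy, hz.ann]
    exact hN.mul_mem_gradedJacobson_right _ haJ
  -- If every such `a` killed `y`, then `z ↦ y` would be a map of `Ext` groups induced by some `f' :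
  -- M ⟶ S_i(-l)` with `y` the pullback of `z`. Restricting along `f` would give `z = 0`, as `f ≫ f'
  -- = 0`.
  obtain ⟨m, a, ha, haJ, hay⟩ : ∃ m a, ∃ ha : a ∈ 𝒜 (m - r), a * e (ν i) ∈ gradedJacobson 𝒜 ∧
      extAct y m a ha ≠ 0 := by
    by_contra hcon
    push Not at hcon
    obtain ⟨f', hf'⟩ := exists_hom_of_isExtGenerator (c := d + 1) hM
      (N := (simpleR 𝒜 (e i)).shift (-l)) (h.finite_simpleR i)
      (fun t ht => hM0 t ht.ne) (fun t ht => h.shift_simpleR_ext_eq_zero i t ht.ne' _) hz y hcon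
    rw [← hf', Ext.mk₀_comp_mk₀_assoc, hsplit f', Ext.mk₀_zero, Ext.zero_comp] at hfy
    have h1 : (1 : A) ∈ 𝒜 (r - r) := h0 r SetLike.GradedOne.one_mem
    have := (hz.ann _ 1 h1).1 (by rw [← hfy, zero_extAct])
    rw [one_mul] at this
    exact hB.not_mem_gradedJacobson _ this
  -- Radical multiples of `y` come from `Ext^d(S_j, A)`, which the radical annihilates; so products
  -- of two radical elements kill `y`.
  have hsq : ∀ c ∈ AddSubgroup.closure {c | ∃ s, ∃ b ∈ gradedJacobson 𝒜, ∃ b' ∈ gradedJacobson 𝒜,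
      b ∈ 𝒜 s ∧ b' ∈ 𝒜 (m - r - s) ∧ c = b * b'}, ∃ hc : c ∈ 𝒜 (m - r), extAct y m c hc = 0 := by
    intro c hc
    induction hc using AddSubgroup.closure_induction with
    | mem c hc =>
      obtain ⟨s, b, hbJ, b', hbJ', hb, hb', rfl⟩ := hc
      have hb1 : b' ∈ 𝒜 (m - s - r) := by rwa [show m - s - r = m - r - s by ring]
      have hb2 : b ∈ 𝒜 (m - (m - s)) := by rwa [sub_sub_cancel]
      have hbb : b * b' ∈ 𝒜 (m - r) := by
        have := SetLike.mul_mem_graded hb hb'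
        rwa [add_sub_cancel] at this
      refine ⟨hbb, ?_⟩
      obtain ⟨w, hw⟩ := hker (m - s) b' hb1 hbJ'
      obtain ⟨c, hc, rfl⟩ := hzj.gen _ w
      have hbc : b * c ∈ 𝒜 (m - -p j) := by
        have := SetLike.mul_mem_graded hb hc
        rwa [show s + (m - s - -p j) = m - -p j by ring] at this
      rw [← extAct_extAct y hb1 hb2 hbb, ← hw, ← mk₀_comp_extAct, extAct_extAct zj hc hb2 hbc,
        (hzj.ann _ _ hbc).2 (hN.mul_mem_gradedJacobson_right _
          (hN.mul_mem_gradedJacobson_right _ hbJ)), Ext.comp_zero]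
    | zero => exact ⟨zero_mem _, extAct_zero y _ rfl⟩
    | add b c _ _ hb hc =>
      obtain ⟨hb, hb0⟩ := hb
      obtain ⟨hc, hc0⟩ := hc
      exact ⟨add_mem hb hc, by rw [extAct_add y hb hc, hb0, hc0, add_zero]⟩
    | neg b _ hb =>
      obtain ⟨hb, hb0⟩ := hb
      refine ⟨neg_mem hb, ?_⟩
      have h1 := extAct_add y hb (neg_mem hb)
      rw [hb0, zero_add, extAct_zero y _ (add_neg_cancel b)] at h1
      exact h1.symm
  have ha1 : a * e (ν i) ∈ 𝒜 (m - r) := hmem' ha (e (ν i)).2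
  rw [hye] at hay
  -- Some left Peirce component of `a e (ν i)` still acts nontrivially on `y`; it is the candidate
  -- arrow, from a vertex `b` yet to be identified.
  obtain ⟨b, hb⟩ : ∃ b, extAct y m ((e b : A) * (a * e (ν i))) (hmem (e b).2 ha1) ≠ 0 := by
    by_contra hcon
    push Not at hcon
    apply hay
    have h1 := extAct_sum y (m := m) (a := fun b => (e b : A) * (a * e (ν i)))
      fun b => hmem (e b).2 ha1
    rw [Finset.sum_eq_zero fun b _ => hcon b] at h1
    refine Eq.trans ?_ h1
    congr 1
    exact (hB.sum_mul _).symm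
  have ha2 : (e b : A) * (a * e (ν i)) ∈ 𝒜 (m - r) := hmem (e b).2 ha1
  have ha2J : (e b : A) * (a * e (ν i)) ∈ gradedJacobson 𝒜 :=
    hN.mul_mem_gradedJacobson_left _ haJ
  have heb : (e b : A) * (e b * (a * e (ν i))) = e b * (a * e (ν i)) := by
    rw [← mul_assoc, hB.idem]
  obtain ⟨w, hw⟩ := hker m _ ha2 ha2J
  obtain ⟨c, hc, rfl⟩ := hzj.gen _ w
  have hbc : (e b : A) * c ∈ 𝒜 (m - -p j) := hmem (e b).2 hc
  have hbcJ : (e b : A) * c * e (ν j) ∉ gradedJacobson 𝒜 := by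
    intro hcon
    apply hb
    have h2 := extAct_extAct y ha2 (h0 m (e b).2) (hmem (e b).2 ha2)
    rw [← hw, ← mk₀_comp_extAct, extAct_extAct zj hc (h0 m (e b).2) hbc,
      (hzj.ann _ _ hbc).2 hcon, Ext.comp_zero] at h2
    refine Eq.trans ?_ h2.symm
    congr 1
    exact heb.symm
  have hdeg : (e b : A) * c * e (ν j) ∈ 𝒜 (m - -p j) := hmem' hbc (e (ν j)).2
  -- The value of the candidate on `y` is a nonzero class from `Ext^d(S_j, A)`, a simple module at
  -- `ν j` concentrated in degree `-p j`. This fixes the degree of the arrow, and then `b = ν j`.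
  have hm : m - -p j = 0 := by
    by_contra hne
    exact hbcJ (mem_gradedJacobson_of_mem hne hdeg)
  rw [hm] at hdeg
  obtain ⟨rfl, -⟩ := hB.exists_inverse (j := b) (i := ν j) hdeg
    (by rw [← mul_assoc, ← mul_assoc, hB.idem]) (by rw [mul_assoc, hB.idem]) hbcJ
  refine ⟨(e (ν j) : A) * (a * e (ν i)), ?_, heb, ?_, ha2J, fun hcon => hb ?_⟩
  · rwa [show l + p i - p j = m - r by rw [hr, sub_eq_zero.1 hm]; ring]
  · rw [mul_assoc, mul_assoc, hB.idem]
  · have h3 := proj_mem_closure_of_mem_mul isHomogeneousSubspace_gradedJacobson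
      isHomogeneousSubspace_gradedJacobson hcon (m - r)
    rw [proj_of_mem 𝒜 ha2, if_pos rfl] at h3
    exact (hsq _ h3).2

end IsBasicASGorenstein

end Arrows

/-! ### Balancing the parameter along orbits -/

section ParameterCombinatorics

variable {n : ℕ}

/-- The partial sums of the parameter along the orbits of `ν`. -/
def orbitSum (ν : Fin n → Fin n) (p : Fin n → ℤ) (m : ℕ) (i : Fin n) : ℤ :=
  ∑ t ∈ Finset.range m, p (ν^[t] i)

/-- The sum of the partial sums of the parameter along the orbits of `ν`. -/
def orbitWeight (ν : Fin n → Fin n) (p : Fin n → ℤ) (N : ℕ) (i : Fin n) : ℤ :=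
  ∑ m ∈ Finset.range N, orbitSum ν p m i

variable {ν : Fin n → Fin n} {p : Fin n → ℤ}

theorem orbitSum_succ (m : ℕ) (i : Fin n) :
    orbitSum ν p (m + 1) i = orbitSum ν p m i + p (ν^[m] i) := Finset.sum_range_succ _ _

theorem orbitSum_apply (m : ℕ) (i : Fin n) :
    orbitSum ν p m (ν i) = orbitSum ν p (m + 1) i - p i := by
  rw [orbitSum, orbitSum, Finset.sum_range_succ']
  simp

/-- Passing from `i` to `ν i` shifts the partial sums by one index and drops the first term `p i`
from each of the `N` of them. -/
theorem orbitWeight_apply (N : ℕ) (i : Fin n) :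
    orbitWeight ν p N (ν i) = orbitWeight ν p N i + orbitSum ν p N i - N * p i := by
  have h1 : ∑ m ∈ Finset.range N, orbitSum ν p (m + 1) i =
      orbitWeight ν p N i + orbitSum ν p N i := by
    have h2 := Finset.sum_range_succ (fun m => orbitSum ν p m i) N
    rw [Finset.sum_range_succ'] at h2
    have h3 : orbitSum ν p 0 i = 0 := Finset.sum_range_zero _
    rw [h3, add_zero] at h2
    exact h2
  rw [orbitWeight, Finset.sum_congr rfl fun m _ => orbitSum_apply m i, Finset.sum_sub_distrib, h1]
  simp

/-- The correction cancels in the sum over the permutation `ν`, so the average is unchanged; by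
`orbitWeight_apply` it equals `S / N`. Dividing the weights by `N` with remainder gives `N p' i = S
- r (ν i) + r i`, and two remainders in `[0, N)` differ by less than `N`. -/
theorem abs_sub_averageParameter_lt (hν : Function.Injective ν) {N : ℕ} (hN : 0 < N) {S : ℤ}
    (hS : ∀ i, orbitSum ν p N i = S) {p' : Fin n → ℤ}
    (hp' : ∀ i, p' i = p i + orbitWeight ν p N (ν i) / N - orbitWeight ν p N i / N) :
    averageParameter p' = averageParameter p ∧
      ∀ i, |(p' i : ℚ) - averageParameter p'| < 1 := by
  have hbij : Function.Bijective ν := Finite.injective_iff_bijective.1 hν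
  have hperm : ∀ f : Fin n → ℤ, ∑ i, f (ν i) = ∑ i, f i := fun f =>
    Fintype.sum_bijective ν hbij _ _ fun _ => rfl
  have hsum : ∑ i, p' i = ∑ i, p i := by
    simp only [hp', Finset.sum_sub_distrib, Finset.sum_add_distrib]
    rw [hperm fun i => orbitWeight ν p N i / N]
    ring
  have havg : averageParameter p' = averageParameter p := by
    rw [averageParameter, averageParameter]
    congr 1
    exact_mod_cast hsum
  refine ⟨havg, fun i => ?_⟩
  have hNS : (N : ℤ) * ∑ i, p i = n * S := by
    have h1 : ∀ i, (N : ℤ) * p i = orbitWeight ν p N i - orbitWeight ν p N (ν i) + S := fun i => by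
      rw [orbitWeight_apply, hS]
      ring
    rw [Finset.mul_sum, Finset.sum_congr rfl fun i _ => h1 i, Finset.sum_add_distrib,
      Finset.sum_sub_distrib, hperm fun i => orbitWeight ν p N i]
    simp
  have hn : 0 < n := i.pos
  have hNQ : (0 : ℚ) < N := by exact_mod_cast hN
  have havg' : averageParameter p' = S / N := by
    rw [havg, averageParameter, div_eq_div_iff (by positivity) (by positivity)]
    have h2 : ((N : ℤ) * ∑ i, p i : ℤ) = ((n * S : ℤ) : ℚ) := by exact_mod_cast hNS
    push_cast at h2
    linarith
  have hNp : (N : ℤ) * p' i = S - orbitWeight ν p N (ν i) % N + orbitWeight ν p N i % N := by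
    have h1 := Int.mul_ediv_add_emod (orbitWeight ν p N (ν i)) N
    have h2 := Int.mul_ediv_add_emod (orbitWeight ν p N i) N
    have h3 := orbitWeight_apply (ν := ν) (p := p) N i
    rw [hS] at h3
    rw [hp', mul_sub, mul_add]
    linarith
  have hN' : (0 : ℤ) < N := by exact_mod_cast hN
  have b1 := Int.emod_nonneg (orbitWeight ν p N (ν i)) hN'.ne'
  have b2 := Int.emod_lt_of_pos (orbitWeight ν p N (ν i)) hN'
  have b3 := Int.emod_nonneg (orbitWeight ν p N i) hN'.ne'
  have b4 := Int.emod_lt_of_pos (orbitWeight ν p N i) hN'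
  have u1 : (N : ℤ) * p' i < S + N := by linarith
  have u2 : S - N < (N : ℤ) * p' i := by linarith
  have u1' : (N : ℚ) * p' i < S + N := by exact_mod_cast u1
  have u2' : (S : ℚ) - N < N * p' i := by exact_mod_cast u2
  rw [havg', abs_sub_lt_iff]
  constructor
  · rw [sub_lt_iff_lt_add, ← sub_lt_iff_lt_add', lt_div_iff₀ hNQ]
    linarith
  · rw [sub_lt_iff_lt_add, div_lt_iff₀ hNQ]
    linarith

end ParameterCombinatorics

/-! ### Generation by arrows -/

section Paths

variable {k : Type v} {A : Type u} [Field k] [Ring A] [Algebra k A]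
variable {𝒜 : ℤ → Submodule k A} [GradedAlgebra 𝒜] {n : ℕ} {e : Fin n → 𝒜 0}

/-- There is an arrow of degree `l` from `j` to `i` in the Gabriel quiver of `A`. -/
def IsArrow (e : Fin n → 𝒜 0) (j i : Fin n) (l : ℤ) : Prop :=
  ∃ x ∈ 𝒜 l, (e j : A) * x = x ∧ x * (e i : A) = x ∧ x ∈ gradedJacobson 𝒜 ∧
    x ∉ gradedJacobson 𝒜 * gradedJacobson 𝒜

namespace IsNGradedBasic

variable (h : IsNGradedBasic 𝒜 e)
include h

omit h in
theorem isHomogeneousSubspace_pow (r : ℕ) :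
    IsHomogeneousSubspace 𝒜 (gradedJacobson 𝒜 ^ (r + 1)) := by
  induction r with
  | zero =>
    rw [zero_add, pow_one]
    exact isHomogeneousSubspace_gradedJacobson
  | succ r ih =>
    rw [pow_succ]
    exact ih.mul isHomogeneousSubspace_gradedJacobson

theorem mul_mem_pow_left {r : ℕ} (a : A) {x : A} (hx : x ∈ gradedJacobson 𝒜 ^ (r + 1)) :
    a * x ∈ gradedJacobson 𝒜 ^ (r + 1) := by
  rw [pow_succ'] at hx ⊢
  induction hx using Submodule.mul_induction_on' with
  | mem_mul_mem y hy z hz =>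
    rw [← mul_assoc]
    exact Submodule.mul_mem_mul (h.nGraded.mul_mem_gradedJacobson_left a hy) hz
  | add x hx y hy h₁ h₂ =>
    rw [mul_add]
    exact add_mem h₁ h₂

theorem mul_mem_pow_right {r : ℕ} (a : A) {x : A} (hx : x ∈ gradedJacobson 𝒜 ^ (r + 1)) :
    x * a ∈ gradedJacobson 𝒜 ^ (r + 1) := by
  rw [pow_succ] at hx ⊢
  induction hx using Submodule.mul_induction_on' with
  | mem_mul_mem y hy z hz =>
    rw [mul_assoc]
    exact Submodule.mul_mem_mul hy (h.nGraded.mul_mem_gradedJacobson_right a hz)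
  | add x hx y hy h₁ h₂ =>
    rw [add_mul]
    exact add_mem h₁ h₂

omit h in
theorem peirce_mem_graded {l : ℤ} {a : A} (ha : a ∈ 𝒜 l) (j i : Fin n) :
    (e j : A) * a * e i ∈ 𝒜 l := by
  simpa using SetLike.mul_mem_graded (SetLike.mul_mem_graded (e j).2 ha) (e i).2

/-- The algebra is generated by arrows: a relation on vertices and degrees which holds for the
arrows and is compatible with composition holds for all nonzero elements. -/
theorem induction_on_arrows {Q : Fin n → Fin n → ℤ → Prop} (hrefl : ∀ i, Q i i 0)
    (htrans : ∀ j a i s t, Q j a s → Q a i t → Q j i (s + t))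
    (harrow : ∀ j i l, IsArrow e j i l → Q j i l) {j i : Fin n} {l : ℤ} {x : A} (hx : x ∈ 𝒜 l)
    (hne : (e j : A) * x * e i ≠ 0) : Q j i l := by
  -- Induction on the radical layer. Outside `J` only the trivial path occurs, and in `J` outside
  -- `J²` the element is an arrow by definition.
  have key : ∀ r j i l x, x ∈ 𝒜 l → (e j : A) * x * e i ∉ gradedJacobson 𝒜 ^ (r + 1) →
      Q j i l := by
    intro r
    induction r with
    | zero =>
      intro j i l x hx hxJ
      rw [zero_add, pow_one] at hxJ
      have hdeg := peirce_mem_graded (e := e) hx j i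
      have hl : l = 0 := by
        by_contra hl
        exact hxJ (mem_gradedJacobson_of_mem hl hdeg)
      subst hl
      obtain ⟨rfl, -⟩ := h.exists_inverse hdeg (by rw [← mul_assoc, ← mul_assoc, h.idem])
        (by rw [mul_assoc, h.idem]) hxJ
      exact hrefl j
    | succ r ih =>
      intro j i l x hx hxJ
      by_cases hxr : (e j : A) * x * e i ∈ gradedJacobson 𝒜 ^ (r + 1)
      · cases r with
        | zero =>
          rw [zero_add, pow_one] at hxr
          rw [zero_add, one_add_one_eq_two, pow_two] at hxJ
          exact harrow j i l ⟨_, peirce_mem_graded hx j i,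
            by rw [← mul_assoc, ← mul_assoc, h.idem], by rw [mul_assoc, h.idem], hxr, hxJ⟩
        | succ r =>
          by_contra hQ
          apply hxJ
          rw [pow_succ'] at hxr
          have hcl := proj_mem_closure_of_mem_mul isHomogeneousSubspace_gradedJacobson
            (isHomogeneousSubspace_pow r) hxr l
          rw [proj_of_mem 𝒜 (peirce_mem_graded hx j i), if_pos rfl] at hcl
          have hpe : (e j : A) * (e j * x * e i) * e i = e j * x * e i := by
            calc _ = (e j : A) * e j * x * (e i * e i) := by noncomm_ring
              _ = _ := by rw [h.idem, h.idem]
          rw [← hpe]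
          revert hcl
          generalize (e j : A) * x * e i = c
          intro hcl
          induction hcl using AddSubgroup.closure_induction with
          | mem c hc =>
            obtain ⟨s, b, hbJ, b', hbJ', hb, hb', rfl⟩ := hc
            have hsum : (e j : A) * (b * b') * e i =
                ∑ a, ((e j : A) * b * e a) * (e a * b' * e i) := by
              have h1 : ∀ a, ((e j : A) * b * e a) * (e a * b' * e i) =
                  e j * b * (e a * (b' * e i)) := fun a => by
                calc _ = (e j : A) * b * (e a * e a) * b' * e i := by noncomm_ring
                  _ = _ := by rw [h.idem]; noncomm_ring
              rw [Finset.sum_congr rfl fun a _ => h1 a, ← Finset.mul_sum, h.sum_mul]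
              noncomm_ring
            rw [hsum]
            refine sum_mem fun a _ => ?_
            have hy : (e j : A) * b * e a ∈ gradedJacobson 𝒜 :=
              h.nGraded.mul_mem_gradedJacobson_right _ (h.nGraded.mul_mem_gradedJacobson_left _ hbJ)
            have hz : (e a : A) * b' * e i ∈ gradedJacobson 𝒜 ^ (r + 1) :=
              h.mul_mem_pow_right _ (h.mul_mem_pow_left _ hbJ')
            -- If the first factor lies in `J²`, or the second in the next power of `J`, the summand
            -- lies too deep. Otherwise it is an arrow followed by an element covered by the
            -- induction hypothesis.
            by_cases hy2 : (e j : A) * b * e a ∈ gradedJacobson 𝒜 * gradedJacobson 𝒜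
            · have := Submodule.mul_mem_mul hy2 hz
              rwa [← pow_two, ← pow_add, show 2 + (r + 1) = r + 1 + 1 + 1 by ring] at this
            by_cases hz2 : (e a : A) * b' * e i ∈ gradedJacobson 𝒜 ^ (r + 1 + 1)
            · have := Submodule.mul_mem_mul hy hz2
              rwa [← pow_succ'] at this
            exfalso
            apply hQ
            have q1 : Q j a s := harrow j a s ⟨_, peirce_mem_graded hb j a,
              by rw [← mul_assoc, ← mul_assoc, h.idem], by rw [mul_assoc, h.idem], hy, hy2⟩
            have q2 : Q a i (l - s) := ih a i (l - s) b' hb' hz2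
            have := htrans j a i _ _ q1 q2
            rwa [add_sub_cancel] at this
          | zero => rw [mul_zero, zero_mul]; exact zero_mem _
          | add b c _ _ hb hc => rw [mul_add, add_mul]; exact add_mem hb hc
          | neg b _ hb => rw [mul_neg, neg_mul]; exact neg_mem hb
      · exact ih j i l x hx hxr
  obtain ⟨r, hr⟩ := h.exists_pow_disjoint l
  exact key r j i l x hx fun hmem => hne (hr _ hmem (peirce_mem_graded hx j i))

end IsNGradedBasic

end Paths

/-! ### Degrees of arrows and constancy of the orbit sums -/

section ArrowDegrees

variable {k : Type v} {A : Type u} [Field k] [Ring A] [Algebra k A]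
variable {𝒜 : ℤ → Submodule k A} [GradedAlgebra 𝒜] {n : ℕ} {e : Fin n → 𝒜 0}

namespace IsNGradedBasic

variable (h : IsNGradedBasic 𝒜 e)
include h

/-- The radical is finitely generated as a right module. In degrees above those of the generators, a
component of a radical element only involves generators multiplied by elements of positive degree,
hence lies in `J²`. -/
theorem exists_arrow_bound [IsNoetherianRing Aᵐᵒᵖ] :
    ∃ D : ℤ, ∀ j i l, IsArrow e j i l → l ≤ D := by
  classical
  have := isNoetherian_regR A
  let R : Submodule Aᵐᵒᵖ A :=
    { carrier := {x | x ∈ gradedJacobson 𝒜}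
      add_mem' := fun ha hb => (gradedJacobson 𝒜).add_mem ha hb
      zero_mem' := (gradedJacobson 𝒜).zero_mem
      smul_mem' := fun c x hx => h.nGraded.mul_mem_gradedJacobson_right c.unop hx }
  obtain ⟨S, hS⟩ := IsNoetherian.noetherian R
  obtain ⟨D, hD⟩ := (S.biUnion fun g => (DirectSum.decompose 𝒜 g).support).exists_le
  refine ⟨D, fun j i l ⟨x, hx, _, _, hxJ, hx2⟩ => ?_⟩
  by_contra hl
  let Q : Submodule Aᵐᵒᵖ A :=
    { carrier := {x | x ∈ gradedJacobson 𝒜 ∧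
        ∀ m > D, GradedRing.proj 𝒜 m x ∈ gradedJacobson 𝒜 * gradedJacobson 𝒜}
      add_mem' := fun ha hb => ⟨(gradedJacobson 𝒜).add_mem ha.1 hb.1, fun m hm => by
        rw [map_add]
        exact add_mem (ha.2 m hm) (hb.2 m hm)⟩
      zero_mem' := ⟨(gradedJacobson 𝒜).zero_mem, fun m _ => by
        rw [map_zero]
        exact zero_mem _⟩
      smul_mem' := fun c x hx => by
        refine ⟨h.nGraded.mul_mem_gradedJacobson_right c.unop hx.1, fun m hm => ?_⟩
        change GradedRing.proj 𝒜 m (x * c.unop) ∈ _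
        obtain ⟨T, hT⟩ := sum_proj 𝒜 c.unop
        rw [hT, Finset.mul_sum, map_sum]
        refine sum_mem fun t _ => ?_
        rw [proj_mul_of_mem 𝒜 (proj_mem 𝒜 t _)]
        by_cases hmt : m - t > D
        · exact h.mul_mem_sq_right _ (hx.2 _ hmt)
        · exact Submodule.mul_mem_mul (isHomogeneousSubspace_gradedJacobson _ hx.1 _)
            (mem_gradedJacobson_of_mem (by lia) (proj_mem 𝒜 t _)) }
  have hRQ : R ≤ Q := by
    rw [← hS, Submodule.span_le]
    intro g hg
    have hgR : g ∈ R := hS ▸ Submodule.subset_span hg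
    refine ⟨hgR, fun m hm => ?_⟩
    have : GradedRing.proj 𝒜 m g = 0 := by
      by_contra hne
      refine absurd (hD m (Finset.mem_biUnion.2 ⟨g, hg, DFinsupp.mem_support_iff.2 fun h0 => ?_⟩))
        (not_le.2 hm)
      exact hne (congrArg Subtype.val h0)
    rw [this]
    exact zero_mem _
  have := (hRQ hxJ).2 l (not_le.1 hl)
  rw [proj_of_mem 𝒜 hx, if_pos rfl] at this
  exact hx2 this

/-- A function on the vertices of the quiver of a ring-indecomposable algebra which is constant
along arrows is constant. -/
theorem eq_of_isRingIndecomposable (hind : IsRingIndecomposable A) {α : Type*} {c : Fin n → α}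
    (hc : ∀ j i l, IsArrow e j i l → c j = c i) (i j : Fin n) : c i = c j := by
  classical
  -- The sum of the idempotents with the same value of `c` as `i`. It is central because nonzero
  -- Peirce components only join vertices with equal values, so it must be `1`.
  let E : A := ∑ a, if c a = c i then (e a : A) else 0
  have hEl : ∀ b, (e b : A) * E = if c b = c i then (e b : A) else 0 := by
    intro b
    rw [Finset.mul_sum, Finset.sum_eq_single b]
    · rw [mul_ite, h.idem, mul_zero]
    · intro a _ hab
      rw [mul_ite, h.complete.ortho hab.symm, mul_zero, ite_self]
    · exact fun hb => absurd (Finset.mem_univ b) hb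
  have hEr : ∀ b, E * (e b : A) = if c b = c i then (e b : A) else 0 := by
    intro b
    rw [Finset.sum_mul, Finset.sum_eq_single b]
    · rw [ite_mul, h.idem, zero_mul]
    · intro a _ hab
      rw [ite_mul, h.complete.ortho hab, zero_mul, ite_self]
    · exact fun hb => absurd (Finset.mem_univ b) hb
  have hcon : ∀ (x : A) a b, (e a : A) * x * e b ≠ 0 → c a = c b := by
    intro x a b hne
    obtain ⟨S, hS⟩ := sum_proj 𝒜 x
    rw [hS, Finset.mul_sum, Finset.sum_mul] at hne
    obtain ⟨t, -, ht⟩ := Finset.exists_ne_zero_of_sum_ne_zero hne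
    exact h.induction_on_arrows (Q := fun a b _ => c a = c b) (fun _ => rfl)
      (fun _ _ _ _ _ h₁ h₂ => h₁.trans h₂) hc (proj_mem 𝒜 t x) ht
  have hcomm : ∀ x, E * x = x * E := by
    intro x
    rw [← h.complete.sum_sum x, Finset.mul_sum, Finset.sum_mul]
    refine Finset.sum_congr rfl fun a _ => ?_
    rw [Finset.mul_sum, Finset.sum_mul]
    refine Finset.sum_congr rfl fun b _ => ?_
    rw [← mul_assoc, ← mul_assoc, hEr, mul_assoc _ (e b : A) E, hEl]
    by_cases hab : (e a : A) * x * e b = 0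
    · split_ifs <;> simp [hab]
    · rw [hcon x a b hab]
      split_ifs <;> simp
  have hid : IsIdempotentElem E := by
    have h1 : ∀ a, (if c a = c i then (e a : A) else 0) * E = if c a = c i then (e a : A) else 0 :=
      fun a => by
        split_ifs with hca
        · rw [hEl, if_pos hca]
        · rw [zero_mul]
    change (∑ a, if c a = c i then (e a : A) else 0) * E = _
    rw [Finset.sum_mul]
    exact Finset.sum_congr rfl fun a _ => h1 a
  rcases hind.2 E hid hcomm with h0 | h1
  · have := hEl i
    rw [h0, mul_zero, if_pos rfl] at this
    exact absurd this.symm (h.primitive i).2.1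
  · have := hEl j
    rw [h1, mul_one] at this
    by_contra hij
    rw [if_neg (Ne.symm hij)] at this
    exact (h.primitive j).2.1 this

end IsNGradedBasic

namespace IsBasicASGorenstein

variable {d : ℕ} {ν : Fin n → Fin n} {p : Fin n → ℤ}
variable (h : IsBasicASGorenstein 𝒜 d e ν p) (hN : IsNGraded 𝒜)
include h hN

theorem isArrow_iterate {j i : Fin n} {l : ℤ} (ha : IsArrow e j i l) (m : ℕ) :
    IsArrow e (ν^[m] j) (ν^[m] i) (l + orbitSum ν p m i - orbitSum ν p m j) := by
  induction m with
  | zero => simpa [orbitSum] using ha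
  | succ m ih =>
    obtain ⟨x, hx, hj, hi, hJ, hJ2⟩ := ih
    rw [Function.iterate_succ_apply', Function.iterate_succ_apply', orbitSum_succ, orbitSum_succ,
      show l + (orbitSum ν p m i + p (ν^[m] i)) - (orbitSum ν p m j + p (ν^[m] j)) =
        l + orbitSum ν p m i - orbitSum ν p m j + p (ν^[m] i) - p (ν^[m] j) by ring]
    exact h.exists_arrow hN hx hj hi hJ hJ2

omit h in
theorem isArrow_nonneg {j i : Fin n} {l : ℤ} (ha : IsArrow e j i l) : 0 ≤ l := by
  obtain ⟨x, hx, -, -, -, hJ2⟩ := ha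
  by_contra hl
  apply hJ2
  rw [hN.eq_zero (not_le.1 hl) hx]
  exact zero_mem _

/-- The ends of an arrow have orbits with the same average of the Gorenstein parameter. -/
theorem orbitSum_eq {N : ℕ} (hν : ν^[N] = id) {j i : Fin n} {l : ℤ} (ha : IsArrow e j i l) :
    orbitSum ν p N j = orbitSum ν p N i := by
  have := h.noetherian_right
  obtain ⟨D, hD⟩ := (h.isNGradedBasic hN).exists_arrow_bound
  -- Since `ν^N` fixes both ends, iterating it gives arrows between the same vertices with degrees
  -- in arithmetic progression.
  have key : ∀ m : ℕ, IsArrow e j i (l + m * (orbitSum ν p N i - orbitSum ν p N j)) := by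
    intro m
    induction m with
    | zero => simpa using ha
    | succ m ih =>
      have := h.isArrow_iterate hN ih N
      rw [hν, id, id] at this
      rwa [show l + ((m + 1 : ℕ) : ℤ) * (orbitSum ν p N i - orbitSum ν p N j) =
        l + m * (orbitSum ν p N i - orbitSum ν p N j) + orbitSum ν p N i - orbitSum ν p N j by
          push_cast; ring]
  have h1 := isArrow_nonneg hN ha
  have h2 := hD _ _ _ ha
  -- A negative step makes the degree negative after `l + 1` iterations; a positive one exceeds `D`
  -- after `D + 1`.
  have h3 := isArrow_nonneg hN (key (l.toNat + 1))
  have h4 := hD _ _ _ (key (D.toNat + 1))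
  rcases lt_trichotomy (orbitSum ν p N j) (orbitSum ν p N i) with hlt | heq | hlt
  · exfalso
    have h5 : ((D.toNat + 1 : ℕ) : ℤ) = D + 1 := by lia
    rw [h5] at h4
    nlinarith
  · exact heq
  · exfalso
    have h5 : ((l.toNat + 1 : ℕ) : ℤ) = l + 1 := by lia
    rw [h5] at h3
    nlinarith

/-- For an arrow, add up the nonnegative degrees of its first `N` iterates under `ν`. The inequality
is additive along composition, so it extends to all nonzero Peirce elements. -/
theorem orbitWeight_le {N : ℕ} {j i : Fin n} {l : ℤ} {x : A} (hx : x ∈ 𝒜 l)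
    (hne : (e j : A) * x * e i ≠ 0) :
    orbitWeight ν p N j ≤ N * l + orbitWeight ν p N i := by
  refine (h.isNGradedBasic hN).induction_on_arrows
    (Q := fun j i l => orbitWeight ν p N j ≤ N * l + orbitWeight ν p N i) (fun i => by simp)
    (fun j a i s t h₁ h₂ => by rw [mul_add]; linarith) (fun j i l ha => ?_) hx hne
  have h1 : ∑ m ∈ Finset.range N, orbitSum ν p m j ≤
      ∑ m ∈ Finset.range N, (l + orbitSum ν p m i) :=
    Finset.sum_le_sum fun m _ => by
      have := isArrow_nonneg hN (h.isArrow_iterate hN ha m)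
      linarith
  rw [Finset.sum_add_distrib, Finset.sum_const, Finset.card_range, nsmul_eq_mul] at h1
  exact h1

end IsBasicASGorenstein

end ArrowDegrees

/-! ### Regrading the Gorenstein structure and the choice of shifts -/

section MainTheorem

variable {k : Type v} {A : Type u} [Field k] [Ring A] [Algebra k A]
variable {𝒜 : ℤ → Submodule k A} [GradedAlgebra 𝒜] {n : ℕ} {e : Fin n → 𝒜 0}
  {d : ℕ} {ν : Fin n → Fin n} {p : Fin n → ℤ}

theorem exists_iterate_eq_id {ν : Fin n → Fin n} (hν : Function.Injective ν) :
    ∃ N : ℕ, 0 < N ∧ ν^[N] = id := by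
  let σ : Equiv.Perm (Fin n) := Equiv.ofBijective ν (Finite.injective_iff_bijective.1 hν)
  refine ⟨orderOf σ, orderOf_pos σ, ?_⟩
  have := congrArg (fun τ : Equiv.Perm (Fin n) => ⇑τ) (pow_orderOf_eq_one σ)
  rwa [Equiv.Perm.coe_pow] at this

/-- Regrading an Artin-Schelter Gorenstein algebra changes its Gorenstein parameter in a
controlled way. -/
theorem IsBasicASGorenstein.regrade (h : IsBasicASGorenstein 𝒜 d e ν p) (hN : IsNGraded 𝒜)
    {ℬ : ℤ → Submodule k A} [GradedAlgebra ℬ] {s : Fin n → ℤ} {e' : Fin n → ℬ 0}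
    (hreg : IsRegrading 𝒜 ℬ (fun i => (e i : A)) s) (hee : ∀ i, (e' i : A) = e i)
    (hNB : IsNGraded ℬ) :
    IsBasicASGorenstein ℬ d e' ν (fun i => p i + s (ν i) - s i) := by
  obtain rfl : e' = fun i => ⟨(e i : A), hreg.mem_right i⟩ := funext fun i => Subtype.ext (hee i)
  have hA := h.isNGradedBasic hN
  have hfin := hreg.finiteDimensional h.locally_finite
  have hB : IsNGradedBasic ℬ fun i => (⟨(e i : A), hreg.mem_right i⟩ : ℬ 0) :=
    ⟨hNB, hfin 0, h.complete, h.primitive, h.basic⟩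
  have hJ := hreg.gradedJacobson_eq hA hB hee
  have := h.noetherian_right
  have := isNoetherian_regR A
  have hfs : ∀ i, Module.Finite Aᵐᵒᵖ (simpleR ℬ (⟨(e i : A), hreg.mem_right i⟩ : ℬ 0)) := fun i =>
    inferInstanceAs (Module.Finite Aᵐᵒᵖ (projR ℬ (⟨(e i : A), hreg.mem_right i⟩ : ℬ 0) ⧸
      (projR ℬ (⟨(e i : A), hreg.mem_right i⟩ : ℬ 0)).rad))
  refine ⟨h.noetherian_left, h.noetherian_right, hfin, ⟨0, hNB⟩, h.complete, h.primitive, h.basic,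
    h.injdim_right, h.injdim_left, fun i l hl m => ?_, fun i => ?_⟩
  · obtain ⟨φ⟩ := hreg.nonempty_iso_simpleR hA hB hee i
    refine subsingleton_of_forall_eq 0 fun x => ?_
    exact hreg.ext_eq_zero _ (hfs i)
      (ext_eq_zero_of_iso φ (h.shift_simpleR_ext_eq_zero i l hl (s i))) m x
  · obtain ⟨φ⟩ := hreg.nonempty_iso_simpleR hA hB hee i
    -- The degree `-p i + s i` of the generator is rewritten as minus the new parameter plus `s (ν
    -- i)`, the form required for transport at the vertex `ν i`.
    obtain ⟨z, hz⟩ := h.exists_isExtGenerator hN i (l := s i)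
      (m := -(p i + s (ν i) - s i) + s (ν i)) (by ring)
    obtain ⟨z', hz'⟩ := hreg.exists_isExtGenerator _ (hfs i)
      (fun a _ hx => hN.mul_mem_gradedJacobson_left a hx) (hz.of_iso φ)
    rw [← hJ] at hz'
    exact hB.gradedExtIso (b := ν i) hz'

end MainTheorem

theorem mainTheorem4 {k : Type v} {A : Type u} [Field k] [Ring A] [Algebra k A]
    (𝒜 : ℤ → Submodule k A) [GradedAlgebra 𝒜]
    (hind : IsRingIndecomposable A) (hN : IsNGraded 𝒜)
    (d n : ℕ) (e : Fin n → 𝒜 0) (ν : Fin n → Fin n) (p : Fin n → ℤ)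
    (hA : IsBasicASGorenstein 𝒜 d e ν p) :
    ∃ (B : Type u) (_ : Ring B) (_ : Algebra k B) (ℬ : ℤ → Submodule k B) (_ : GradedAlgebra ℬ)
      (n' : ℕ) (e' : Fin n' → ℬ 0) (ν' : Fin n' → Fin n') (p' : Fin n' → ℤ),
      IsRingIndecomposable B ∧ IsNGraded ℬ ∧ IsBasicASGorenstein ℬ d e' ν' p' ∧
      GradedMoritaEquivalent ℬ 𝒜 ∧
      (∀ i, |(p' i : ℚ) - averageParameter p'| < 1) ∧
      (averageParameter p ≤ 0 → ∀ i, p' i ≤ 0) := by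
  have hν := hA.nakayama_injective hN
  obtain ⟨N, hN0, hNν⟩ := exists_iterate_eq_id hν
  obtain ⟨S, hS⟩ : ∃ S, ∀ i, orbitSum ν p N i = S := by
    have hc := (hA.isNGradedBasic hN).eq_of_isRingIndecomposable hind (c := orbitSum ν p N)
      fun j i l ha => hA.orbitSum_eq hN hNν ha
    rcases isEmpty_or_nonempty (Fin n) with hn | ⟨⟨i⟩⟩
    · exact ⟨0, fun i => hn.elim i⟩
    · exact ⟨orbitSum ν p N i, fun j => hc j i⟩
  -- Without rounding, these shifts would make the new parameter constant; the floor keeps them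
  -- integral.
  let s : Fin n → ℤ := fun i => orbitWeight ν p N i / N
  have hreg := isRegrading_regraded (𝒜 := 𝒜) (e := fun i => (e i : A)) s hA.complete
    fun i => (e i).2
  obtain ⟨hℬ⟩ := hreg.nonempty_gradedAlgebra
  have hNB : IsNGraded (regraded 𝒜 (fun i => (e i : A)) s) := by
    refine hreg.isNGraded fun j i l a ha hne => ?_
    have h1 := hA.orbitWeight_le hN (N := N) ha hne
    have hN0' : (0 : ℤ) < N := by exact_mod_cast hN0
    have h2 := Int.ediv_le_ediv hN0' h1
    -- The multiple `N * l` passes exactly through the floor, so rounding preserves the inequality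
    -- needed for nonnegative degrees.
    rw [add_comm, Int.add_mul_ediv_left _ _ hN0'.ne'] at h2
    change 0 ≤ l + orbitWeight ν p N i / N - orbitWeight ν p N j / N
    linarith
  obtain ⟨havg, hlt⟩ := abs_sub_averageParameter_lt hν hN0 hS
    (p' := fun i => p i + s (ν i) - s i) fun i => rfl
  refine ⟨A, _, _, regraded 𝒜 (fun i => (e i : A)) s, hℬ, n, fun i => ⟨e i, hreg.mem_right i⟩, ν,
    fun i => p i + s (ν i) - s i, hind, hNB, hA.regrade hN hreg (fun _ => rfl) hNB,
    hreg.gradedMoritaEquivalent, hlt, fun h0 i => ?_⟩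
  have h1 := (abs_sub_lt_iff.1 (hlt i)).1
  rw [havg] at h1
  -- Each new parameter is less than the unchanged average plus `1`; if the average is nonpositive,
  -- an integer below `1` is nonpositive.
  have h2 : ((p i + s (ν i) - s i : ℤ) : ℚ) < 1 := by linarith
  have h3 : p i + s (ν i) - s i < 1 := by exact_mod_cast h2
  exact Int.lt_add_one_iff.1 h3
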